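/- Let $\mathbb{D}$ be the open unit disk, $\mathbb{T}$ its boundary circle with normalized Lebesgue measure $m$, and let $b:\mathbb{D}\to\mathbb{D}$ be an analytic function that is a non-extreme point of the unit ball of $H^\infty$, i.e. that has a Pythagorean mate: an outer function $a$ on $\mathbb{D}$ with $|a|^2+|b|^2=1$ almost everywhere on $\mathbb{T}$ (in the sense of radial boundary values). Let $\phi=b/a$, and let $\mathcal{H}(b)$ be the de Branges–Rovnyak space, that is, the Hilbert space of analytic functions on $\mathbb{D}$ with reproducing kernel $$k_b(\lambda,z)=\frac{1-\overline{b(\lambda)}\,b(z)}{1-\overline{\lambda}z}.$$ Let $H^2$ be the Hardy space of analytic functions $f$ on $\mathbb{D}$ with $\sup_{0<r<1}\int_{\mathbb{T}}|f(r\zeta)|^2\,dm(\zeta)<\infty$, $H^\infty$ the space of bounded analytic functions on $\mathbb{D}$, $\mathcal{A}$ the disk algebra of analytic functions on $\mathbb{D}$ that extend continuously to $\overline{\mathbb{D}}$, and $\mathrm{BMOA}$ (respectively $\mathrm{VMOA}$) the space of $f\in H^2$ whose boundary function on $\mathbb{T}$ has bounded (respectively vanishing) mean oscillation over arcs. Then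 the following statements are equivalent: 1. $\phi\in H^2$; 2. $H^\infty\subset\mathcal{H}(b)$; 3. $\mathcal{A}\subset\mathcal{H}(b)$; 4. $\mathrm{VMOA}\subset\mathcal{H}(b)$; 5. $\mathrm{BMOA}\subset\mathcal{H}(b)$. -/

import Mathlib

open Filter Topology MeasureTheory Metric ComplexConjugate

/-! Spaces of analytic functions on the open unit disk `ball (0 : ℂ) 1`.  A function on the disk is
represented by a function `ℂ → ℂ`; only its values on the disk matter in the definitions below.
The point `r * exp (i θ)` is `circleMap 0 r θ`, and functions on the unit circle are represented by
functions of the angle `θ : ℝ`. -/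

/-- The Hardy space `H²`: analytic functions on the unit disk with
`sup_{0 < r < 1} (1/2π) ∫ |f(r exp(iθ))|² dθ < ∞`. -/
def hardyTwo : Set (ℂ → ℂ) :=
  {f | DifferentiableOn ℂ f (ball 0 1) ∧
    ∃ C : ℝ, ∀ r : ℝ, 0 < r → r < 1 → Real.circleAverage (fun z => ‖f z‖ ^ 2) 0 r ≤ C}

/-- `H^∞`: bounded analytic functions on the unit disk. -/
def hardyInfty : Set (ℂ → ℂ) :=
  {f | DifferentiableOn ℂ f (ball 0 1) ∧ ∃ C : ℝ, ∀ z ∈ ball (0 : ℂ) 1, ‖f z‖ ≤ C}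

/-- The disk algebra: analytic functions on the unit disk that extend continuously to the closed
unit disk. -/
def diskAlgebra : Set (ℂ → ℂ) :=
  {f | DifferentiableOn ℂ f (ball 0 1) ∧
    ∃ g : ℂ → ℂ, ContinuousOn g (closedBall 0 1) ∧ Set.EqOn g f (ball 0 1)}

/-- `u` is the boundary function of `f`: for almost every `θ`, the radial limit of `f` at
`exp (i θ)` exists and equals `u θ`. -/
def HasBoundaryFunction (f : ℂ → ℂ) (u : ℝ → ℂ) : Prop :=
  ∀ᵐ θ : ℝ, Tendsto (fun r : ℝ => f (circleMap 0 r θ)) (𝓝[<] 1) (𝓝 (u θ))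

/-- The mean oscillation `(1/|I|) ∫_I |u - u_I|` of `u` over the arc `I` of angles between `α` and
`β`, where `u_I` is the mean of `u` over `I`. -/
noncomputable def meanOscillation (u : ℝ → ℂ) (α β : ℝ) : ℝ :=
  ⨍ θ in α..β, ‖u θ - ⨍ t in α..β, u t‖

/-- Bounded mean oscillation over all arcs of the circle. -/
def IsBMO (u : ℝ → ℂ) : Prop :=
  (∀ α β : ℝ, IntervalIntegrable u volume α β) ∧
    ∃ C : ℝ, ∀ α β : ℝ, α < β → β ≤ α + 2 * Real.pi → meanOscillation u α β ≤ C

/-- Vanishing mean oscillation: bounded mean oscillation, and the mean oscillation over an arc tends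
to `0` uniformly as the length of the arc tends to `0`. -/
def IsVMO (u : ℝ → ℂ) : Prop :=
  IsBMO u ∧ ∀ ε : ℝ, 0 < ε → ∃ δ : ℝ, 0 < δ ∧ ∀ α β : ℝ,
    α < β → β ≤ α + 2 * Real.pi → β - α < δ → meanOscillation u α β < ε

/-- `BMOA`: functions in `H²` whose boundary function has bounded mean oscillation. -/
def BMOA : Set (ℂ → ℂ) :=
  {f | f ∈ hardyTwo ∧ ∃ u : ℝ → ℂ, HasBoundaryFunction f u ∧ IsBMO u}

/-- `VMOA`: functions in `H²` whose boundary function has vanishing mean oscillation. -/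
def VMOA : Set (ℂ → ℂ) :=
  {f | f ∈ hardyTwo ∧ ∃ u : ℝ → ℂ, HasBoundaryFunction f u ∧ IsVMO u}

/-- Outer functions: `a(z) = c exp ((1/2π) ∫ (exp(iθ) + z)/(exp(iθ) - z) log |a(exp(iθ))| dθ)` in
the unit disk, with `|c| = 1` and `log |a|` integrable on the unit circle. -/
def IsOuter (a : ℂ → ℂ) : Prop :=
  DifferentiableOn ℂ a (ball 0 1) ∧
    ∃ u : ℝ → ℂ, HasBoundaryFunction a u ∧ (∀ᵐ θ : ℝ, u θ ≠ 0) ∧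
      IntervalIntegrable (fun θ => Real.log ‖u θ‖) volume 0 (2 * Real.pi) ∧
      ∃ c : ℂ, ‖c‖ = 1 ∧ ∀ z ∈ ball (0 : ℂ) 1,
        a z = c * Complex.exp ((2 * (Real.pi : ℂ))⁻¹ * ∫ θ in (0 : ℝ)..(2 * Real.pi),
          (circleMap 0 1 θ + z) / (circleMap 0 1 θ - z) * (Real.log ‖u θ‖ : ℂ))

/-- `a` is a Pythagorean mate of `b`: `a` is outer and `|a|² + |b|² = 1` almost everywhere on the
unit circle. -/
def IsPythagoreanMate (a b : ℂ → ℂ) : Prop :=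
  IsOuter a ∧ ∃ u v : ℝ → ℂ, HasBoundaryFunction a u ∧ HasBoundaryFunction b v ∧
    ∀ᵐ θ : ℝ, ‖u θ‖ ^ 2 + ‖v θ‖ ^ 2 = 1

/-- The kernel `(1 - conj (b w) * b z) / (1 - conj w * z)`, the value at `z` of the kernel function
at `w`; the scalar is regarded as an operator on the one-dimensional space `ℂ`. -/
noncomputable def deBrangesRovnyakKernel (b : ℂ → ℂ) :
    Matrix Complex.UnitDisc Complex.UnitDisc (ℂ →L[ℂ] ℂ) :=
  Matrix.of fun z w =>
    ((1 - conj (b (w : ℂ)) * b (z : ℂ)) / (1 - conj (w : ℂ) * (z : ℂ))) •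
      ContinuousLinearMap.id ℂ ℂ

/-- The de Branges–Rovnyak space `H(b)`: the functions in the reproducing kernel Hilbert space on
the unit disk with the kernel above.  (For analytic `b` from the disk to itself that kernel is
positive semidefinite, so that the space exists.) -/
def deBrangesRovnyak (b : ℂ → ℂ) : Set (ℂ → ℂ) :=
  {f | ∃ _ : Fact (deBrangesRovnyakKernel b).PosSemidef,
    ∃ h : RKHS.OfKernel (deBrangesRovnyakKernel b), ∀ z : Complex.UnitDisc, h z = f z}

/-! Since `(a, b)` acts isometrically on `H²`, the vectors `(k_b(w, ·), conj (b w) a k_w)` of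
`H² × H²`, where `k_w` is the Szegő kernel, have the kernel of `H(b)` as Gram matrix, and `F` in
their closed span represents `f ∈ H(b)` when `F₁ = f` and `T_{conj b} f = T_{conj a} F₂`. As `a` is
outer, `F₂` is determined by `f`, and for a polynomial `p` it is `T_{conj φ} p`.

If the disk algebra lies in `H(b)`, the closed graph theorem, applied to the Wiener algebra, bounds
the monomials in `H(b)`. The coefficients of `T_{conj φ} z^n` are the conjugates of the first ones
of `φ`, so their square sums are bounded and `φ ∈ H²`.

Conversely, if `φ ∈ H²` and the Hankel form `(g, h) ↦ ⟪p, g h⟫` is bounded by `C` on `H²`, then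
`‖T_{conj φ} p‖² = ⟪p, φ T_{conj φ} p⟫ ≤ C ‖φ‖ ‖T_{conj φ} p‖` bounds `p` in `H(b)`. The Hankel
form is controlled by the mean oscillation of `p` on the circle: with `U` analytic and
`Re U = |p|²` on the circle, the defect `D = Re U - |p|²` is the variance of `p` against the Poisson
kernel, which a self-improving inequality bounds in terms of the mean oscillation. As
`ΔD = -4 |p'|²`, a function of `D` gives an explicit subharmonic correction that dominates the
Laplacian `4 conj p' (g h)'` of `conj p (g h)`, and its mean over the circle is the required bound.
Applying this to polynomials close to the dilates of `f`, whose mean oscillation is controlled by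
that of `f`, writes `f` as a pointwise limit of a bounded sequence in `H(b)`. -/

/-! ### Circle averages -/

section CircleAverage

variable {c : ℂ} {r : ℝ}

theorem hasSum_circleAverage_of_summable {E : Type*} [NormedAddCommGroup E] [NormedSpace ℝ E]
    {f : ℕ → ℂ → E} {F : ℂ → E} {B : ℕ → ℝ} (hf : ∀ n, ContinuousOn (f n) (sphere c |r|))
    (hB : Summable B) (hfB : ∀ n, ∀ z ∈ sphere c |r|, ‖f n z‖ ≤ B n)
    (hF : ∀ z ∈ sphere c |r|, HasSum (fun n => f n z) (F z)) :
    HasSum (fun n => Real.circleAverage (f n) c r) (Real.circleAverage F c r) := by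
  have hmem : ∀ θ, circleMap c r θ ∈ sphere c |r| := circleMap_mem_sphere' c r
  exact (intervalIntegral.hasSum_integral_of_dominated_convergence (fun n _ => B n)
    (fun n => ((hf n).comp_continuous (continuous_circleMap c r) hmem).aestronglyMeasurable)
    (fun n => .of_forall fun θ _ => hfB n _ (hmem θ)) (.of_forall fun _ _ => hB)
    intervalIntegrable_const (.of_forall fun θ _ => hF _ (hmem θ))).const_smul _

theorem circleAverage_conj {𝕜 : Type*} [RCLike 𝕜] {f : ℂ → 𝕜} :
    Real.circleAverage (fun z => conj (f z)) c r = conj (Real.circleAverage f c r) := by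
  simp only [Real.circleAverage, RCLike.real_smul_eq_coe_mul, map_mul, RCLike.conj_ofReal,
    intervalIntegral.integral_of_le Real.two_pi_pos.le, integral_conj]

theorem circleAverage_ofReal {f : ℂ → ℝ} :
    Real.circleAverage (fun z => (f z : ℂ)) c r = ((Real.circleAverage f c r : ℝ) : ℂ) := by
  simp only [Real.circleAverage, Complex.real_smul, intervalIntegral.integral_ofReal, smul_eq_mul,
    Complex.ofReal_mul]

theorem circleAverage_const_mul {𝕜 : Type*} [RCLike 𝕜] (k : 𝕜) (f : ℂ → 𝕜) :
    Real.circleAverage (fun z => k * f z) c r = k * Real.circleAverage f c r := by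
  simpa only [smul_eq_mul] using Real.circleAverage_fun_smul (a := k) (f := f)

theorem circleIntegrable_of_continuous {E : Type*} [NormedAddCommGroup E] {f : ℂ → E}
    (hf : Continuous f) : CircleIntegrable f c r :=
  ContinuousOn.circleIntegrable' hf.continuousOn

theorem circleAverage_re {f : ℂ → ℂ} (hf : CircleIntegrable f c r) :
    Real.circleAverage (fun z => (f z).re) c r = (Real.circleAverage f c r).re :=
  Complex.reCLM.circleAverage_comp_comm hf

theorem circleAverage_pow (n : ℕ) (r : ℝ) :
    Real.circleAverage (fun z : ℂ => z ^ n) 0 r = if n = 0 then 1 else 0 := by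
  have hdiff : DiffContOnCl ℂ (fun z : ℂ => z ^ n) (ball 0 |r|) :=
    (differentiable_id.pow n).diffContOnCl
  rw [hdiff.circleAverage]
  split_ifs with h <;> simp [h]

theorem circleAverage_pow_mul_conj_pow (n k : ℕ) (r : ℝ) :
    Real.circleAverage (fun z : ℂ => z ^ n * conj (z ^ k)) 0 r =
      if n = k then (r : ℂ) ^ (2 * k) else 0 := by
  wlog h : k ≤ n generalizing n k
  · have hswap := congrArg conj (this k n (by omega))
    rw [← circleAverage_conj] at hswap
    simp only [map_mul, Complex.conj_conj, mul_comm (conj _)] at hswap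
    rw [hswap]
    split_ifs with h1 h2 h2
    · simp [h1]
    · omega
    · omega
    · simp
  obtain ⟨m, rfl⟩ := Nat.exists_eq_add_of_le h
  have heq : Set.EqOn (fun z : ℂ => z ^ (k + m) * conj (z ^ k))
      (fun z => (r : ℂ) ^ (2 * k) * z ^ m) (sphere 0 |r|) := by
    intro z hz
    have hconj : z * conj z = (r : ℂ) ^ 2 := by
      rw [Complex.mul_conj, Complex.normSq_eq_norm_sq, mem_sphere_zero_iff_norm.1 hz, sq_abs]
      norm_cast
    simp only [map_pow]
    rw [pow_mul, ← hconj]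
    ring
  rw [Real.circleAverage_congr_sphere heq, circleAverage_const_mul, circleAverage_pow]
  split_ifs with h1 h2 h2 <;> first | omega | simp

end CircleAverage

/-! ### Taylor coefficients on the unit disk -/

/-- `F` is the sum of the power series with coefficients `c` on the open unit disk. -/
def HasTaylor (F : ℂ → ℂ) (c : ℕ → ℂ) : Prop :=
  ∀ z ∈ ball (0 : ℂ) 1, HasSum (fun n => c n * z ^ n) (F z)

theorem exists_hasTaylor {F : ℂ → ℂ} (hF : DifferentiableOn ℂ F (ball 0 1)) :
    ∃ c, HasTaylor F c := by
  refine ⟨fun n => (n.factorial : ℂ)⁻¹ * iteratedDeriv n F 0, fun z hz => ?_⟩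
  refine (Complex.hasSum_taylorSeries_on_ball (r := 1) (c := 0) (f := F) hF hz).congr_fun
    fun n => ?_
  simp only [sub_zero, smul_eq_mul]
  ring

namespace HasTaylor

variable {F G : ℂ → ℂ} {c d : ℕ → ℂ} {r : ℝ}

theorem summable_norm (h : HasTaylor F c) (hr : |r| < 1) :
    Summable (fun n => ‖c n‖ * |r| ^ n) := by
  simpa using (h (r : ℂ) (by simpa using hr)).summable.norm

theorem congr (h : HasTaylor F c) (hG : Set.EqOn F G (ball 0 1)) : HasTaylor G c :=
  fun z hz => hG hz ▸ h z hz

theorem add (h : HasTaylor F c) (h' : HasTaylor G d) :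
    HasTaylor (fun z => F z + G z) (fun n => c n + d n) := fun z hz => by
  simpa [add_mul] using (h z hz).add (h' z hz)

theorem sub (h : HasTaylor F c) (h' : HasTaylor G d) :
    HasTaylor (fun z => F z - G z) (fun n => c n - d n) := fun z hz => by
  simpa [sub_mul] using (h z hz).sub (h' z hz)

theorem const_mul (h : HasTaylor F c) (a : ℂ) :
    HasTaylor (fun z => a * F z) (fun n => a * c n) := fun z hz => by
  simpa [mul_assoc] using (h z hz).mul_left a

theorem mul (h : HasTaylor F c) (h' : HasTaylor G d) :
    HasTaylor (fun z => F z * G z) (fun n => ∑ k ∈ Finset.range (n + 1), c k * d (n - k)) := by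
  intro z hz
  have hprod := hasSum_sum_range_mul_of_summable_norm (h z hz).summable.norm (h' z hz).summable.norm
  rw [(h z hz).tsum_eq, (h' z hz).tsum_eq] at hprod
  refine hprod.congr_fun fun n => ?_
  rw [Finset.sum_mul]
  refine Finset.sum_congr rfl fun k hk => ?_
  rw [← pow_mul_pow_sub z (Finset.mem_range_succ_iff.1 hk)]
  ring

theorem differentiableOn (h : HasTaylor F c) : DifferentiableOn ℂ F (ball 0 1) := by
  intro z hz
  obtain ⟨r, hzr, hr1⟩ := exists_between (mem_ball_zero_iff.1 hz)
  have h0 : 0 ≤ r := (norm_nonneg z).trans hzr.le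
  have hr : |r| < 1 := by rwa [abs_of_nonneg h0]
  have htsum : DifferentiableOn ℂ (fun w => ∑' n, c n * w ^ n) (ball 0 r) := by
    refine Complex.differentiableOn_tsum_of_summable_norm (h.summable_norm hr)
      (fun n => by fun_prop) isOpen_ball fun n w hw => ?_
    rw [norm_mul, norm_pow, abs_of_nonneg h0]
    gcongr
    exact (mem_ball_zero_iff.1 hw).le
  have heq : Set.EqOn F (fun w => ∑' n, c n * w ^ n) (ball 0 r) := fun w hw =>
    (h w (ball_subset_ball hr1.le hw)).tsum_eq.symm
  exact ((htsum.congr heq).differentiableAt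
    (isOpen_ball.mem_nhds (mem_ball_zero_iff.2 hzr))).differentiableWithinAt

theorem continuousOn_sphere (h : HasTaylor F c) (hr : |r| < 1) :
    ContinuousOn F (sphere 0 |r|) :=
  h.differentiableOn.continuousOn.mono (sphere_subset_ball hr)

theorem circleAverage_mul_conj_pow (h : HasTaylor F c) (hr : |r| < 1) (k : ℕ) :
    Real.circleAverage (fun z => F z * conj (z ^ k)) 0 r = c k * (r : ℂ) ^ (2 * k) := by
  have hsum := hasSum_circleAverage_of_summable (c := 0) (r := r)
    (f := fun n z => c n * z ^ n * conj (z ^ k)) (F := fun z => F z * conj (z ^ k))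
    (B := fun n => ‖c n‖ * |r| ^ n * |r| ^ k) (fun n => by fun_prop)
    ((h.summable_norm hr).mul_right _)
    (fun n z hz => by simp [mem_sphere_zero_iff_norm.1 hz])
    (fun z hz => (h z (sphere_subset_ball hr hz)).mul_right _)
  have hterm : (fun n => Real.circleAverage (fun z => c n * z ^ n * conj (z ^ k)) 0 r) =
      fun n => if n = k then c k * (r : ℂ) ^ (2 * k) else 0 := by
    ext n
    simp only [mul_assoc]
    rw [circleAverage_const_mul, circleAverage_pow_mul_conj_pow]
    split_ifs with hnk
    · rw [hnk]
    · simp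
  rw [hterm] at hsum
  exact hsum.unique (hasSum_ite_eq k _)

theorem unique (h : HasTaylor F c) (h' : HasTaylor F d) : c = d := by
  have hr : |(1 / 2 : ℝ)| < 1 := by norm_num [abs_lt]
  ext k
  exact mul_right_cancel₀ (by norm_num)
    ((h.circleAverage_mul_conj_pow hr k).symm.trans (h'.circleAverage_mul_conj_pow hr k))

theorem hasSum_circleAverage_mul_conj (h : HasTaylor F c) (h' : HasTaylor G d) (hr : |r| < 1) :
    HasSum (fun n => c n * conj (d n) * (r : ℂ) ^ (2 * n))
      (Real.circleAverage (fun z => F z * conj (G z)) 0 r) := by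
  obtain ⟨C, hC⟩ := (isCompact_sphere (0 : ℂ) |r|).exists_bound_of_continuousOn
    (h.continuousOn_sphere hr)
  have hsum := hasSum_circleAverage_of_summable (c := 0) (r := r)
    (f := fun n z => F z * conj (d n * z ^ n)) (F := fun z => F z * conj (G z))
    (B := fun n => C * (‖d n‖ * |r| ^ n))
    (fun n => (h.continuousOn_sphere hr).mul (by fun_prop))
    ((h'.summable_norm hr).mul_left _)
    (fun n z hz => by
      rw [norm_mul, Complex.norm_conj, norm_mul, norm_pow, mem_sphere_zero_iff_norm.1 hz]
      gcongr
      exact hC z hz)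
    (fun z hz => (h' z (sphere_subset_ball hr hz)).star.mul_left _)
  refine hsum.congr_fun fun n => ?_
  have hcoeff := circleAverage_const_mul (c := 0) (r := r) (conj (d n)) fun z => F z * conj (z ^ n)
  rw [h.circleAverage_mul_conj_pow hr] at hcoeff
  rw [mul_assoc, mul_left_comm, ← hcoeff]
  congr 1
  ext z
  simp only [map_mul]
  ring

theorem hasSum_circleAverage_norm_sq (h : HasTaylor F c) (hr : |r| < 1) :
    HasSum (fun n => ‖c n‖ ^ 2 * r ^ (2 * n)) (Real.circleAverage (fun z => ‖F z‖ ^ 2) 0 r) := by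
  have hsum := h.hasSum_circleAverage_mul_conj h hr
  simp only [Complex.mul_conj, Complex.normSq_eq_norm_sq, circleAverage_ofReal] at hsum
  exact_mod_cast hsum

theorem summable_norm_sq_and_tsum_le (h : HasTaylor F c) {C : ℝ}
    (hC : ∀ r : ℝ, 0 < r → r < 1 → Real.circleAverage (fun z => ‖F z‖ ^ 2) 0 r ≤ C) :
    Summable (fun n => ‖c n‖ ^ 2) ∧ ∑' n, ‖c n‖ ^ 2 ≤ C := by
  have hpartial : ∀ s : Finset ℕ, ∑ n ∈ s, ‖c n‖ ^ 2 ≤ C := by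
    intro s
    have hlim : Tendsto (fun r : ℝ => ∑ n ∈ s, ‖c n‖ ^ 2 * r ^ (2 * n)) (𝓝[<] 1)
        (𝓝 (∑ n ∈ s, ‖c n‖ ^ 2)) := by
      have hcont : Continuous (fun r : ℝ => ∑ n ∈ s, ‖c n‖ ^ 2 * r ^ (2 * n)) := by fun_prop
      simpa using hcont.continuousWithinAt (s := Set.Iio 1) (x := 1) |>.tendsto
    refine le_of_tendsto hlim ?_
    filter_upwards [Ioo_mem_nhdsLT (zero_lt_one' ℝ)] with r ⟨h0, h1⟩
    exact (sum_le_hasSum s (fun n _ => by positivity)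
      (h.hasSum_circleAverage_norm_sq (abs_lt.2 ⟨by linarith, h1⟩))).trans (hC r h0 h1)
  have hs := summable_of_sum_le (f := fun n => ‖c n‖ ^ 2) (fun n => by positivity) hpartial
  exact ⟨hs, hs.tsum_le_of_sum_le hpartial⟩

theorem mem_hardyTwo_iff (h : HasTaylor F c) : F ∈ hardyTwo ↔ Summable (fun n => ‖c n‖ ^ 2) := by
  refine ⟨fun ⟨_, C, hC⟩ => (h.summable_norm_sq_and_tsum_le hC).1,
    fun hs => ⟨h.differentiableOn, ∑' n, ‖c n‖ ^ 2, fun r h0 h1 => ?_⟩⟩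
  have hr := h.hasSum_circleAverage_norm_sq (r := r) (abs_lt.2 ⟨by linarith, h1⟩)
  rw [← hr.tsum_eq]
  exact hr.summable.tsum_le_tsum
    (fun n => mul_le_of_le_one_right (by positivity) (pow_le_one₀ h0.le h1.le)) hs

end HasTaylor

/-! ### The Hardy space as a sequence space -/

theorem circleAverage_norm_sq_le_sq {E : Type*} [NormedAddCommGroup E] {F : ℂ → E} {c : ℂ}
    {r C : ℝ} (hF : ContinuousOn F (sphere c |r|)) (hC : ∀ z ∈ sphere c |r|, ‖F z‖ ≤ C) :
    Real.circleAverage (fun z => ‖F z‖ ^ 2) c r ≤ C ^ 2 :=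
  Real.circleAverage_mono_on_of_le_circle (hF.norm.pow 2).circleIntegrable' fun z hz =>
    pow_le_pow_left₀ (norm_nonneg _) (hC z hz) 2

theorem circleAverage_norm_sq_le_sq_of_norm_le {F : ℂ → ℂ} (hF : DifferentiableOn ℂ F (ball 0 1))
    {C : ℝ} (hC : ∀ z ∈ ball (0 : ℂ) 1, ‖F z‖ ≤ C) {r : ℝ} (hr : |r| < 1) :
    Real.circleAverage (fun z => ‖F z‖ ^ 2) 0 r ≤ C ^ 2 :=
  circleAverage_norm_sq_le_sq (hF.continuousOn.mono (sphere_subset_ball hr))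
    fun z hz => hC z (sphere_subset_ball hr hz)

theorem hardyInfty_subset_hardyTwo : hardyInfty ⊆ hardyTwo := fun _ ⟨hf, C, hC⟩ =>
  ⟨hf, C ^ 2, fun _ h0 h1 =>
    circleAverage_norm_sq_le_sq_of_norm_le hf hC (abs_lt.2 ⟨by linarith, h1⟩)⟩

/-- Square summable sequences of complex numbers: `H²`, seen through Taylor coefficients, as a
Hilbert space in the sense of Mathlib. -/
noncomputable abbrev HardySeq := lp (fun _ : ℕ => ℂ) 2

theorem memℓp_two_iff {ι : Type*} {E : ι → Type*} [∀ i, NormedAddCommGroup (E i)]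
    {x : ∀ i, E i} : Memℓp x 2 ↔ Summable (fun i => ‖x i‖ ^ 2) := by
  rw [memℓp_gen_iff (by norm_num)]
  norm_num

open Classical in
/-- The sequence of Taylor coefficients of a function in `H²`, as a vector of a Hilbert space; it
is `0` by convention for a function outside `H²`. -/
noncomputable def hardyVec (F : ℂ → ℂ) : HardySeq :=
  if h : ∃ x : HardySeq, HasTaylor F x then h.choose else 0

theorem HasTaylor.hardyVec_eq {F : ℂ → ℂ} {x : HardySeq} (h : HasTaylor F x) : hardyVec F = x := by
  have hex : ∃ x : HardySeq, HasTaylor F x := ⟨x, h⟩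
  rw [hardyVec, dif_pos hex]
  exact lp.ext (hex.choose_spec.unique h)

theorem hasTaylor_hardyVec {F : ℂ → ℂ} (h : F ∈ hardyTwo) : HasTaylor F (hardyVec F) := by
  obtain ⟨c, hc⟩ := exists_hasTaylor h.1
  have hseq : HasTaylor F (⟨c, memℓp_two_iff.2 (hc.mem_hardyTwo_iff.1 h)⟩ : HardySeq) := hc
  rwa [hseq.hardyVec_eq]

theorem norm_hardySeq_sq (x : HardySeq) : ‖x‖ ^ 2 = ∑' n, ‖x n‖ ^ 2 := by
  simpa using lp.norm_rpow_eq_tsum (p := 2) (by norm_num) x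

theorem norm_hardyVec_le {F : ℂ → ℂ} (hF : DifferentiableOn ℂ F (ball 0 1)) {C : ℝ}
    (hC : ∀ z ∈ ball (0 : ℂ) 1, ‖F z‖ ≤ C) : ‖hardyVec F‖ ≤ C := by
  have hmem : F ∈ hardyTwo := hardyInfty_subset_hardyTwo ⟨hF, C, hC⟩
  have htsum := ((hasTaylor_hardyVec hmem).summable_norm_sq_and_tsum_le fun r h0 h1 =>
    circleAverage_norm_sq_le_sq_of_norm_le hF hC (abs_lt.2 ⟨by linarith, h1⟩)).2
  rw [← norm_hardySeq_sq] at htsum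
  exact (sq_le_sq₀ (norm_nonneg _) ((norm_nonneg _).trans (hC 0 (by simp)))).1 htsum

theorem tendsto_circleAverage_mul_conj {F G : ℂ → ℂ} (hF : F ∈ hardyTwo) (hG : G ∈ hardyTwo) :
    Tendsto (fun r : ℝ => Real.circleAverage (fun z => F z * conj (G z)) 0 r) (𝓝[<] 1)
      (𝓝 (inner ℂ (hardyVec G) (hardyVec F))) := by
  have hsummable : Summable fun n => ‖hardyVec F n * conj (hardyVec G n)‖ := by
    simpa using (lp.summable_inner (𝕜 := ℂ) (hardyVec G) (hardyVec F)).norm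
  have hlim := tendsto_tsum_of_dominated_convergence (𝓕 := 𝓝[<] (1 : ℝ))
    (f := fun (r : ℝ) n => hardyVec F n * conj (hardyVec G n) * (r : ℂ) ^ (2 * n))
    (g := fun n => hardyVec F n * conj (hardyVec G n)) hsummable (fun n => by
      have hcont : Continuous
          fun r : ℝ => hardyVec F n * conj (hardyVec G n) * (r : ℂ) ^ (2 * n) := by fun_prop
      simpa using hcont.continuousWithinAt (s := Set.Iio 1) (x := 1) |>.tendsto) (by
      filter_upwards [Ioo_mem_nhdsLT (zero_lt_one' ℝ)] with r ⟨h0, h1⟩ n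
      rw [norm_mul _ ((r : ℂ) ^ _), norm_pow, Complex.norm_real, Real.norm_of_nonneg h0.le]
      exact mul_le_of_le_one_right (norm_nonneg _) (pow_le_one₀ h0.le h1.le))
  rw [lp.inner_eq_tsum]
  refine hlim.congr' ?_
  filter_upwards [Ioo_mem_nhdsLT (zero_lt_one' ℝ)] with r ⟨h0, h1⟩
  exact ((hasTaylor_hardyVec hF).hasSum_circleAverage_mul_conj (hasTaylor_hardyVec hG)
    (abs_lt.2 ⟨by linarith, h1⟩)).tsum_eq

/-! ### Gram matrices and weak compactness -/

section Gram

variable {𝕜 ι E F : Type*} [RCLike 𝕜] [NormedAddCommGroup E] [InnerProductSpace 𝕜 E]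
  [NormedAddCommGroup F] [InnerProductSpace 𝕜 F]

theorem inner_linearCombination_eq {u : ι → E} {v : ι → F}
    (h : ∀ i j, inner 𝕜 (u i) (u j) = inner 𝕜 (v i) (v j)) (c d : ι →₀ 𝕜) :
    inner 𝕜 (Finsupp.linearCombination 𝕜 u c) (Finsupp.linearCombination 𝕜 u d) =
      inner 𝕜 (Finsupp.linearCombination 𝕜 v c) (Finsupp.linearCombination 𝕜 v d) := by
  simp only [Finsupp.linearCombination_apply, Finsupp.sum_inner, Finsupp.inner_sum, h,
    inner_smul_left, inner_smul_right]

theorem exists_linearIsometry_of_inner_eq [CompleteSpace F] {u : ι → E} {v : ι → F}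
    (h : ∀ i j, inner 𝕜 (u i) (u j) = inner 𝕜 (v i) (v j))
    (hu : Dense (Submodule.span 𝕜 (Set.range u) : Set E)) :
    ∃ T : E →ₗᵢ[𝕜] F, (∀ i, T (u i) = v i) ∧
      ∀ x, T x ∈ (Submodule.span 𝕜 (Set.range v)).topologicalClosure := by
  set e := Finsupp.linearCombination 𝕜 u
  set f := Finsupp.linearCombination 𝕜 v
  have hdense : DenseRange e := by
    rw [DenseRange, ← LinearMap.coe_range, Finsupp.range_linearCombination]
    exact hu
  have hnorm : ∀ x, ‖f x‖ = ‖e x‖ := fun x => by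
    rw [@norm_eq_sqrt_re_inner 𝕜, @norm_eq_sqrt_re_inner 𝕜, inner_linearCombination_eq h]
  have hbound : ∃ C : ℝ, ∀ x, ‖f x‖ ≤ C * ‖e x‖ := ⟨1, fun x => by rw [hnorm, one_mul]⟩
  have hext := LinearMap.extendOfNorm_eq hdense hbound
  refine ⟨⟨(f.extendOfNorm e).toLinearMap, ?_⟩, fun i => ?_, fun x => ?_⟩
  · refine fun x => hdense.induction_on (p := fun x => ‖f.extendOfNorm e x‖ = ‖x‖) x
      (isClosed_eq (by fun_prop) (by fun_prop)) fun a => ?_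
    rw [hext, hnorm]
  · simpa [e, f] using hext (Finsupp.single i 1)
  · refine hdense.induction_on
      (p := fun x => f.extendOfNorm e x ∈ (Submodule.span 𝕜 (Set.range v)).topologicalClosure) x
      ?_ fun a => ?_
    · exact (Submodule.isClosed_topologicalClosure _).preimage (by fun_prop)
    · rw [hext]
      refine Submodule.le_topologicalClosure _ ?_
      rw [← Finsupp.range_linearCombination]
      exact LinearMap.mem_range_self _ _

theorem exists_ultrafilter_tendsto_inner [CompleteSpace E] {l : Filter ι} [l.NeBot] {x : ι → E}
    {C : ℝ} (hx : ∀ n, ‖x n‖ ≤ C) : ∃ (y : E) (U : Ultrafilter ι), (U : Filter ι) ≤ l ∧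
      ∀ z : E, Tendsto (fun n => inner 𝕜 (x n) z) U (𝓝 (inner 𝕜 y z)) := by
  let D : E → WeakDual 𝕜 E := fun w => StrongDual.toWeakDual (InnerProductSpace.toDual 𝕜 E w)
  obtain ⟨U, hU⟩ := Ultrafilter.exists_le l
  obtain ⟨y, -, hy⟩ := (WeakDual.isCompact_closedBall (𝕜 := 𝕜) (E := E) 0 C).ultrafilter_le_nhds
    (U.map fun n => D (x n)) (by
      rw [Ultrafilter.coe_map, Filter.le_principal_iff, Filter.mem_map]
      refine Filter.univ_mem' fun n => ?_
      simpa [D] using hx n)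
  refine ⟨(InnerProductSpace.toDual 𝕜 E).symm (WeakDual.toStrongDual y), U, hU, fun z => ?_⟩
  have heval : Continuous fun w : WeakDual 𝕜 E => w z := WeakDual.eval_continuous z
  simpa [Function.comp_def, D] using
    (heval.tendsto y).comp (show Tendsto (fun n => D (x n)) U (𝓝 y) from hy)

theorem eq_of_inner_eq_of_mem_topologicalClosure_span {v : ι → E} {x y : E}
    (hx : x ∈ (Submodule.span 𝕜 (Set.range v)).topologicalClosure)
    (hy : y ∈ (Submodule.span 𝕜 (Set.range v)).topologicalClosure)
    (h : ∀ i, inner 𝕜 (v i) x = inner 𝕜 (v i) y) : x = y := by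
  have horth : x - y ∈ (Submodule.span 𝕜 (Set.range v)).topologicalClosureᗮ := by
    rw [Submodule.orthogonal_closure]
    refine (Submodule.mem_orthogonal _ _).2 fun z hz => ?_
    induction hz using Submodule.span_induction with
    | mem _ hz =>
      obtain ⟨i, rfl⟩ := hz
      rw [inner_sub_right, h, sub_self]
    | zero => simp
    | add z w _ _ hz hw => rw [inner_add_left, hz, hw, add_zero]
    | smul c z _ hz => rw [inner_smul_left, hz, mul_zero]
  exact sub_eq_zero.1 (inner_self_eq_zero.1
    ((Submodule.mem_orthogonal _ _).1 horth _ (Submodule.sub_mem _ hx hy)))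

theorem exists_continuousLinearMap_inner_eq [CompleteSpace E] {X : Type*} [NormedAddCommGroup X]
    [NormedSpace 𝕜 X] [CompleteSpace X] {v : ι → E} (e : ι → X →L[𝕜] 𝕜)
    (h : ∀ x, ∃ y ∈ (Submodule.span 𝕜 (Set.range v)).topologicalClosure,
      ∀ i, inner 𝕜 (v i) y = e i x) :
    ∃ T : X →L[𝕜] E, (∀ x, T x ∈ (Submodule.span 𝕜 (Set.range v)).topologicalClosure) ∧
      ∀ x i, inner 𝕜 (v i) (T x) = e i x := by
  choose A hA hAe using h
  let T : X →ₗ[𝕜] E :=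
    { toFun := A
      map_add' := fun x y => eq_of_inner_eq_of_mem_topologicalClosure_span (hA _)
        (Submodule.add_mem _ (hA x) (hA y)) fun i => by
          rw [inner_add_right, hAe, hAe, hAe, map_add]
      map_smul' := fun c x => eq_of_inner_eq_of_mem_topologicalClosure_span (hA _)
        (Submodule.smul_mem _ c (hA x)) fun i => by
          rw [RingHom.id_apply, inner_smul_right, hAe, hAe, map_smul, smul_eq_mul] }
  have hT : Continuous T := by
    refine T.continuous_of_seq_closed_graph fun u x y hu hy => ?_
    have hymem : y ∈ (Submodule.span 𝕜 (Set.range v)).topologicalClosure :=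
      (Submodule.isClosed_topologicalClosure _).mem_of_tendsto hy
        (Eventually.of_forall fun n => hA (u n))
    refine eq_of_inner_eq_of_mem_topologicalClosure_span hymem (hA x) fun i => ?_
    refine tendsto_nhds_unique (tendsto_const_nhds.inner hy) ?_
    simpa only [Function.comp_def, T, LinearMap.coe_mk, AddHom.coe_mk, hAe] using
      ((e i).continuous.tendsto x).comp hu
  exact ⟨⟨T, hT⟩, hA, hAe⟩

end Gram

/-! ### Models of the de Branges–Rovnyak space -/

/-- `v` is a family of vectors whose Gram matrix is the de Branges–Rovnyak kernel of `b`: a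
realization of `H(b)` inside another Hilbert space, `f` being in `H(b)` exactly when
`f z = ⟪v z, F⟫` for some vector `F`. -/
def IsKernelModel {E : Type*} [NormedAddCommGroup E] [InnerProductSpace ℂ E] (b : ℂ → ℂ)
    (v : Complex.UnitDisc → E) : Prop :=
  ∀ z w : Complex.UnitDisc, inner ℂ (v z) (v w) =
    (1 - conj (b (w : ℂ)) * b (z : ℂ)) / (1 - conj (w : ℂ) * (z : ℂ))

namespace IsKernelModel

variable {E : Type*} [NormedAddCommGroup E] [InnerProductSpace ℂ E] {b : ℂ → ℂ}
  {v : Complex.UnitDisc → E}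

theorem posSemidef (h : IsKernelModel b v) : (deBrangesRovnyakKernel b).PosSemidef := by
  have hK : ∀ z w, deBrangesRovnyakKernel b z w =
      inner ℂ (v z) (v w) • ContinuousLinearMap.id ℂ ℂ := fun z w => by
    rw [h z w]; rfl
  have htfae := (RKHS.posSemidef_tfae (K := deBrangesRovnyakKernel b)).out 0 2
  refine htfae.2 ⟨?_, fun c => ?_⟩
  · ext z w
    rw [Matrix.conjTranspose_apply, hK, hK, star_smul, ← ContinuousLinearMap.one_def, star_one]
    simp
  · have hsum : (c.sum fun x w => c.sum fun x' w' =>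
        inner ℂ (deBrangesRovnyakKernel b x' x w) w') =
        inner ℂ (Finsupp.linearCombination ℂ v c) (Finsupp.linearCombination ℂ v c) := by
      simp only [Finsupp.linearCombination_apply, Finsupp.sum_inner, Finsupp.inner_sum,
        inner_smul_left, inner_smul_right, hK]
      rw [Finsupp.sum_comm]
      refine Finsupp.sum_congr fun x _ => ?_
      rw [Finsupp.mul_sum]
      refine Finsupp.sum_congr fun y _ => ?_
      simp only [_root_.smul_apply, ContinuousLinearMap.id_apply, smul_eq_mul,
        RCLike.inner_apply, map_mul, inner_conj_symm]
      ring
    rw [hsum]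
    exact inner_self_nonneg

theorem exists_linearIsometry [CompleteSpace E] (h : IsKernelModel b v)
    [Fact (deBrangesRovnyakKernel b).PosSemidef] :
    ∃ T : RKHS.OfKernel (deBrangesRovnyakKernel b) →ₗᵢ[ℂ] E,
      (∀ z, T (RKHS.kerFun _ z 1) = v z) ∧
      ∀ x, T x ∈ (Submodule.span ℂ (Set.range v)).topologicalClosure := by
  set H := RKHS.OfKernel (deBrangesRovnyakKernel b)
  let k : Complex.UnitDisc → H := fun z => RKHS.kerFun H z 1
  have hk : ∀ z w, inner ℂ (k z) (k w) = inner ℂ (v z) (v w) := fun z w => by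
    rw [RKHS.kerFun_inner, RKHS.kerFun_apply, RKHS.OfKernel.kernel_ofKernel, h z w]
    simp [deBrangesRovnyakKernel]
  refine exists_linearIsometry_of_inner_eq hk ?_
  rw [Submodule.dense_iff_topologicalClosure_eq_top, eq_top_iff, ← RKHS.kerFun_dense H]
  refine Submodule.topologicalClosure_mono (Submodule.span_le.2 ?_)
  rintro _ ⟨z, c, rfl⟩
  rw [show RKHS.kerFun H z c = c • k z by rw [← map_smul, smul_eq_mul, mul_one]]
  exact Submodule.smul_mem _ _ (Submodule.subset_span ⟨z, rfl⟩)

theorem exists_inner_eq_of_mem [CompleteSpace E] (h : IsKernelModel b v) {f : ℂ → ℂ}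
    (hf : f ∈ deBrangesRovnyak b) : ∃ F ∈ (Submodule.span ℂ (Set.range v)).topologicalClosure,
      ∀ z : Complex.UnitDisc, inner ℂ (v z) F = f z := by
  obtain ⟨_, g, hg⟩ := hf
  obtain ⟨T, hT, hT'⟩ := h.exists_linearIsometry
  refine ⟨T g, hT' g, fun z => ?_⟩
  rw [← hT, T.inner_map_map, ← hg]
  simp

theorem mem_of_inner_eq [CompleteSpace E] (h : IsKernelModel b v) {f : ℂ → ℂ} {F : E}
    (hF : ∀ z : Complex.UnitDisc, inner ℂ (v z) F = f z) : f ∈ deBrangesRovnyak b := by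
  have hp : Fact (deBrangesRovnyakKernel b).PosSemidef := ⟨h.posSemidef⟩
  obtain ⟨T, hT, -⟩ := h.exists_linearIsometry
  refine ⟨hp, ContinuousLinearMap.adjoint T.toContinuousLinearMap F, fun z => ?_⟩
  have hrepr := RKHS.kerFun_inner z (1 : ℂ) (ContinuousLinearMap.adjoint T.toContinuousLinearMap F)
  rw [ContinuousLinearMap.adjoint_inner_right, LinearIsometry.coe_toContinuousLinearMap, hT,
    hF] at hrepr
  simpa using hrepr.symm

theorem mem_of_tendsto [CompleteSpace E] (h : IsKernelModel b v) {f : ℂ → ℂ} {F : ℕ → E} {C : ℝ}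
    (hC : ∀ n, ‖F n‖ ≤ C)
    (hF : ∀ z : Complex.UnitDisc, Tendsto (fun n => inner ℂ (v z) (F n)) atTop (𝓝 (f z))) :
    f ∈ deBrangesRovnyak b := by
  obtain ⟨y, U, hU, hy⟩ := exists_ultrafilter_tendsto_inner (𝕜 := ℂ) (l := atTop) hC
  refine h.mem_of_inner_eq (F := y) fun z => ?_
  refine tendsto_nhds_unique ?_ ((hF z).mono_left hU)
  simpa [Function.comp_def] using (Complex.continuous_conj.tendsto _).comp (hy (v z))

end IsKernelModel

/-! ### Bounded analytic functions and the Szegő kernel -/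

theorem mul_mem_hardyInfty {F G : ℂ → ℂ} (hF : F ∈ hardyInfty) (hG : G ∈ hardyInfty) :
    (fun z => F z * G z) ∈ hardyInfty := by
  obtain ⟨hF, C, hC⟩ := hF
  obtain ⟨hG, D, hD⟩ := hG
  refine ⟨hF.mul hG, C * D, fun z hz => ?_⟩
  rw [norm_mul]
  exact mul_le_mul (hC z hz) (hD z hz) (norm_nonneg _) ((norm_nonneg _).trans (hC z hz))

theorem pow_mem_hardyInfty (n : ℕ) : (fun z : ℂ => z ^ n) ∈ hardyInfty := by
  refine ⟨by fun_prop, 1, fun z hz => ?_⟩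
  rw [norm_pow]
  exact pow_le_one₀ (norm_nonneg _) (by simpa using (mem_ball_zero_iff.1 hz).le)

/-- The Szegő kernel function at `w`, the reproducing kernel of `H²`. -/
noncomputable def szego (w z : ℂ) : ℂ := (1 - conj w * z)⁻¹

theorem hasTaylor_szego {w : ℂ} (hw : w ∈ ball (0 : ℂ) 1) :
    HasTaylor (szego w) (fun n => conj w ^ n) := fun z hz => by
  have hlt : ‖conj w * z‖ < 1 := by
    rw [norm_mul, Complex.norm_conj]
    exact mul_lt_one_of_nonneg_of_lt_one_left (norm_nonneg _) (mem_ball_zero_iff.1 hw)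
      (mem_ball_zero_iff.1 hz).le
  simpa [mul_pow, szego] using hasSum_geometric_of_norm_lt_one hlt

theorem szego_mem_hardyInfty {w : ℂ} (hw : w ∈ ball (0 : ℂ) 1) : szego w ∈ hardyInfty := by
  refine ⟨(hasTaylor_szego hw).differentiableOn, (1 - ‖w‖)⁻¹, fun z hz => ?_⟩
  have hw' : ‖w‖ < 1 := mem_ball_zero_iff.1 hw
  have hz' : ‖z‖ < 1 := mem_ball_zero_iff.1 hz
  rw [szego, norm_inv]
  refine inv_anti₀ (by linarith) ?_
  have hsub := norm_sub_norm_le (1 : ℂ) (conj w * z)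
  rw [norm_one, norm_mul, Complex.norm_conj] at hsub
  nlinarith [norm_nonneg w, norm_nonneg z]

theorem hasTaylor_inner_szego (x : HardySeq) :
    HasTaylor (fun w => inner ℂ (hardyVec (szego w)) x) x := fun w hw => by
  have hcoeff := (hasTaylor_hardyVec
    (hardyInfty_subset_hardyTwo (szego_mem_hardyInfty hw))).unique (hasTaylor_szego hw)
  refine (lp.hasSum_inner (𝕜 := ℂ) (hardyVec (szego w)) x).congr_fun fun n => ?_
  simp [hcoeff]

theorem inner_szego {F : ℂ → ℂ} (hF : F ∈ hardyTwo) {w : ℂ} (hw : w ∈ ball (0 : ℂ) 1) :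
    inner ℂ (hardyVec (szego w)) (hardyVec F) = F w :=
  (hasTaylor_inner_szego _ w hw).unique (hasTaylor_hardyVec hF w hw)

/-! ### Poisson and Herglotz integrals -/

/-- The Poisson integral at `lam` of a function on the unit circle. -/
noncomputable def poissonMean (lam : ℂ) (v : ℂ → ℝ) : ℝ :=
  Real.circleAverage (fun ζ => poissonKernel 0 lam ζ * v ζ) 0 1

section PoissonMean

variable {lam : ℂ} {v w : ℂ → ℝ}

theorem continuousOn_poissonKernel_sphere (hl : lam ∈ ball (0 : ℂ) 1) :
    ContinuousOn (poissonKernel 0 lam) (sphere 0 |1|) := by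
  rw [poissonKernel_eq_re_herglotzRieszKernel]
  exact Complex.continuous_re.comp_continuousOn (continuousOn_herglotzRieszKernel_sphere hl)

theorem circleIntegrable_poissonKernel_mul (hl : lam ∈ ball (0 : ℂ) 1)
    (hv : CircleIntegrable v 0 1) : CircleIntegrable (fun ζ => poissonKernel 0 lam ζ * v ζ) 0 1 :=
  hv.continuousOn_smul (continuousOn_poissonKernel_sphere hl)

theorem poissonKernel_nonneg_of_mem_sphere (hl : lam ∈ ball (0 : ℂ) 1) {ζ : ℂ}
    (hζ : ζ ∈ sphere (0 : ℂ) |1|) : 0 ≤ poissonKernel 0 lam ζ := by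
  have hζ1 : ‖ζ‖ = 1 := by simpa using hζ
  have hl1 : ‖lam‖ < 1 := by simpa using hl
  rw [poissonKernel]
  refine div_nonneg ?_ (by positivity)
  simp only [sub_zero, hζ1]
  nlinarith [norm_nonneg lam]

theorem poissonMean_mono (hl : lam ∈ ball (0 : ℂ) 1) (hv : CircleIntegrable v 0 1)
    (hw : CircleIntegrable w 0 1) (h : ∀ ζ ∈ sphere (0 : ℂ) 1, v ζ ≤ w ζ) :
    poissonMean lam v ≤ poissonMean lam w :=
  Real.circleAverage_mono (circleIntegrable_poissonKernel_mul hl hv)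
    (circleIntegrable_poissonKernel_mul hl hw) fun ζ hζ =>
      mul_le_mul_of_nonneg_left (h ζ (by simpa using hζ)) (poissonKernel_nonneg_of_mem_sphere hl hζ)

theorem poissonMean_congr (h : ∀ ζ ∈ sphere (0 : ℂ) 1, v ζ = w ζ) :
    poissonMean lam v = poissonMean lam w :=
  Real.circleAverage_congr_sphere fun ζ hζ => by rw [h ζ (by simpa using hζ)]

theorem poissonMean_add (hl : lam ∈ ball (0 : ℂ) 1) (hv : CircleIntegrable v 0 1)
    (hw : CircleIntegrable w 0 1) :
    poissonMean lam (fun ζ => v ζ + w ζ) = poissonMean lam v + poissonMean lam w := by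
  simp only [poissonMean, mul_add]
  exact Real.circleAverage_fun_add (circleIntegrable_poissonKernel_mul hl hv)
    (circleIntegrable_poissonKernel_mul hl hw)

theorem poissonMean_const_mul (c : ℝ) :
    poissonMean lam (fun ζ => c * v ζ) = c * poissonMean lam v := by
  simp only [poissonMean, ← circleAverage_const_mul, mul_left_comm]

theorem poissonMean_re (hl : lam ∈ ball (0 : ℂ) 1) {F : ℂ → ℂ} (hF : Differentiable ℂ F) :
    poissonMean lam (fun ζ => (F ζ).re) = (F lam).re := by
  have hi : CircleIntegrable (poissonKernel 0 lam • F) 0 1 :=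
    ContinuousOn.circleIntegrable' ((continuousOn_poissonKernel_sphere hl).smul
      hF.continuous.continuousOn)
  rw [← (hF.diffContOnCl (s := ball 0 1)).circleAverage_poissonKernel_smul hl,
    ← circleAverage_re hi]
  simp [poissonMean]

theorem poissonMean_const (hl : lam ∈ ball (0 : ℂ) 1) (c : ℝ) :
    poissonMean lam (fun _ => c) = c := by
  simpa using poissonMean_re hl (differentiable_const (c : ℂ))

theorem poissonMean_nonneg (hl : lam ∈ ball (0 : ℂ) 1) (h : ∀ ζ ∈ sphere (0 : ℂ) 1, 0 ≤ v ζ) :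
    0 ≤ poissonMean lam v :=
  Real.circleAverage_nonneg_of_nonneg fun ζ hζ =>
    mul_nonneg (poissonKernel_nonneg_of_mem_sphere hl hζ) (h ζ (by simpa using hζ))

end PoissonMean

theorem circleIntegrable_ofReal {ℓ : ℂ → ℝ} (hℓ : CircleIntegrable ℓ 0 1) :
    CircleIntegrable (fun ζ => (ℓ ζ : ℂ)) 0 1 := by
  simp only [CircleIntegrable, intervalIntegrable_iff] at hℓ ⊢
  exact hℓ.ofReal

/-- The Herglotz integral of a real function on the unit circle: the analytic function on the unit
disk whose real part is the Poisson integral of that function. -/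
noncomputable def herglotz (ℓ : ℂ → ℝ) (z : ℂ) : ℂ :=
  Real.circleAverage (fun ζ => herglotzRieszKernel 0 z ζ • (ℓ ζ : ℂ)) 0 1

section Herglotz

variable {ℓ m : ℂ → ℝ} {z : ℂ}

theorem differentiableOn_herglotz (hℓ : CircleIntegrable ℓ 0 1) :
    DifferentiableOn ℂ (herglotz ℓ) (ball 0 1) :=
  differentiableOn_circleAverage_herglotzRieszKernel_smul (circleIntegrable_ofReal hℓ)

theorem circleIntegrable_herglotzRieszKernel_smul (hℓ : CircleIntegrable ℓ 0 1)
    (hz : z ∈ ball (0 : ℂ) 1) :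
    CircleIntegrable (fun ζ => herglotzRieszKernel 0 z ζ • (ℓ ζ : ℂ)) 0 1 :=
  (circleIntegrable_ofReal hℓ).continuousOn_smul (continuousOn_herglotzRieszKernel_sphere hz)

theorem herglotz_add (hℓ : CircleIntegrable ℓ 0 1) (hm : CircleIntegrable m 0 1)
    (hz : z ∈ ball (0 : ℂ) 1) : herglotz (fun ζ => ℓ ζ + m ζ) z = herglotz ℓ z + herglotz m z := by
  simp only [herglotz, Complex.ofReal_add, smul_add]
  exact Real.circleAverage_fun_add (circleIntegrable_herglotzRieszKernel_smul hℓ hz)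
    (circleIntegrable_herglotzRieszKernel_smul hm hz)

theorem re_herglotz (hℓ : CircleIntegrable ℓ 0 1) (hz : z ∈ ball (0 : ℂ) 1) :
    (herglotz ℓ z).re = poissonMean z ℓ := by
  rw [herglotz, re_circleAverage_herglotzRieszKernel_smul hℓ hz,
    ← poissonKernel_eq_re_herglotzRieszKernel]
  rfl

theorem re_herglotz_le (hℓ : CircleIntegrable ℓ 0 1) {C : ℝ} (hC : ∀ ζ, ℓ ζ ≤ C)
    (hz : z ∈ ball (0 : ℂ) 1) : (herglotz ℓ z).re ≤ C := by
  rw [re_herglotz hℓ hz, ← poissonMean_const hz C]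
  exact poissonMean_mono hz hℓ (circleIntegrable_const _ _ _) fun ζ _ => hC ζ

theorem tendsto_herglotz_zero {ℓ : ℕ → ℂ → ℝ} (hm : CircleIntegrable m 0 1)
    (hℓ : ∀ n, CircleIntegrable (ℓ n) 0 1) (hℓm : ∀ n ζ, |ℓ n ζ| ≤ |m ζ|)
    (hlim : ∀ ζ, Tendsto (fun n => ℓ n ζ) atTop (𝓝 0)) (hz : z ∈ ball (0 : ℂ) 1) :
    Tendsto (fun n => herglotz (ℓ n) z) atTop (𝓝 0) := by
  have hint : Tendsto (fun n => ∫ θ in (0 : ℝ)..(2 * Real.pi),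
      herglotzRieszKernel 0 z (circleMap 0 1 θ) • (ℓ n (circleMap 0 1 θ) : ℂ)) atTop
      (𝓝 (∫ _ in (0 : ℝ)..(2 * Real.pi), 0)) := by
    refine intervalIntegral.tendsto_integral_filter_of_dominated_convergence
      (fun θ => ‖herglotzRieszKernel 0 z (circleMap 0 1 θ) • (m (circleMap 0 1 θ) : ℂ)‖) ?_ ?_
      (circleIntegrable_herglotzRieszKernel_smul hm hz).norm ?_
    · exact .of_forall fun n =>
        (intervalIntegrable_iff.1 (circleIntegrable_herglotzRieszKernel_smul (hℓ n) hz)).1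
    · refine .of_forall fun n => .of_forall fun θ _ => ?_
      rw [norm_smul, norm_smul, Complex.norm_real, Complex.norm_real]
      exact mul_le_mul_of_nonneg_left (hℓm n _) (norm_nonneg _)
    · refine .of_forall fun θ _ => ?_
      simpa [Function.comp_def] using ((Complex.continuous_ofReal.tendsto _).comp
        (hlim (circleMap 0 1 θ))).const_smul (herglotzRieszKernel 0 z (circleMap 0 1 θ))
  simpa [herglotz, Real.circleAverage] using hint.const_smul (2 * Real.pi)⁻¹

end Herglotz

/-! ### Isometric pairs -/

/-- A pair of bounded analytic functions `a`, `b` with `|a|² + |b|² = 1` on the unit circle in the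
weak sense, such that `a` has no zeros in the disk and `a H^∞` is dense in `H²`. -/
structure IsOuterPair (a b : ℂ → ℂ) : Prop where
  left_mem : a ∈ hardyInfty
  right_mem : b ∈ hardyInfty
  ne_zero : ∀ z ∈ ball (0 : ℂ) 1, a z ≠ 0
  inner_add : ∀ p ∈ hardyInfty, ∀ q ∈ hardyInfty,
    inner ℂ (hardyVec fun z => a z * p z) (hardyVec fun z => a z * q z) +
      inner ℂ (hardyVec fun z => b z * p z) (hardyVec fun z => b z * q z) =
      inner ℂ (hardyVec p) (hardyVec q)
  eq_zero : ∀ x : HardySeq, (∀ q ∈ hardyInfty, inner ℂ (hardyVec fun z => a z * q z) x = 0) → x = 0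

theorem abs_lt_one_of_mem_Ioo {r : ℝ} (hr : r ∈ Set.Ioo (0 : ℝ) 1) : |r| < 1 :=
  abs_lt.2 ⟨by linarith [hr.1], hr.2⟩

theorem eventually_abs_lt_one : ∀ᶠ r : ℝ in 𝓝[<] 1, |r| < 1 := by
  filter_upwards [Ioo_mem_nhdsLT zero_lt_one] with r hr using abs_lt_one_of_mem_Ioo hr

theorem circleMap_mem_unitBall {r : ℝ} (hr : |r| < 1) (θ : ℝ) :
    circleMap 0 r θ ∈ ball (0 : ℂ) 1 := by
  simpa using hr

theorem continuous_comp_circleMap {E : Type*} [TopologicalSpace E] {F : ℂ → E}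
    (hF : ContinuousOn F (ball 0 1)) {r : ℝ} (hr : |r| < 1) :
    Continuous fun θ => F (circleMap 0 r θ) :=
  hF.comp_continuous (continuous_circleMap 0 r) fun θ => circleMap_mem_unitBall hr θ

theorem tendsto_circleAverage_of_hasBoundaryFunction {f : ℂ → ℂ} {u : ℝ → ℂ} {C : ℝ}
    (hf : ContinuousOn f (ball 0 1)) (hC : ∀ z ∈ ball (0 : ℂ) 1, ‖f z‖ ≤ C)
    (hu : HasBoundaryFunction f u) :
    Tendsto (fun r : ℝ => Real.circleAverage f 0 r) (𝓝[<] 1)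
      (𝓝 ((2 * Real.pi)⁻¹ • ∫ θ in (0 : ℝ)..2 * Real.pi, u θ)) := by
  refine (intervalIntegral.tendsto_integral_filter_of_dominated_convergence (fun _ => C) ?_ ?_
    intervalIntegrable_const (hu.mono fun θ hθ _ => hθ)).const_smul _
  · filter_upwards [eventually_abs_lt_one] with r hr
    exact (continuous_comp_circleMap hf hr).aestronglyMeasurable
  · filter_upwards [eventually_abs_lt_one] with r hr
    exact .of_forall fun θ _ => hC _ (circleMap_mem_unitBall hr θ)

theorem HasBoundaryFunction.unique {f : ℂ → ℂ} {u v : ℝ → ℂ} (hu : HasBoundaryFunction f u)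
    (hv : HasBoundaryFunction f v) : u =ᵐ[volume] v := by
  filter_upwards [hu, hv] with θ hu hv using tendsto_nhds_unique hu hv

section PythagoreanWeight

variable {a b p q : ℂ → ℂ}

theorem circleIntegrable_mul_conj {F G : ℂ → ℂ} (hF : F ∈ hardyInfty) (hG : G ∈ hardyInfty)
    {r : ℝ} (hr : |r| < 1) : CircleIntegrable (fun z => F z * conj (G z)) 0 r :=
  ((continuous_comp_circleMap hF.1.continuousOn hr).mul
    (Complex.continuous_conj.comp
      (continuous_comp_circleMap hG.1.continuousOn hr))).intervalIntegrable _ _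

theorem circleAverage_pythagoreanWeight_mul (ha : a ∈ hardyInfty) (hb : b ∈ hardyInfty)
    (hp : p ∈ hardyInfty) (hq : q ∈ hardyInfty) {r : ℝ} (hr : |r| < 1) :
    Real.circleAverage
        (fun z => ((‖a z‖ ^ 2 + ‖b z‖ ^ 2 - 1 : ℝ) : ℂ) * (q z * conj (p z))) 0 r =
      Real.circleAverage (fun z => a z * q z * conj (a z * p z)) 0 r +
        Real.circleAverage (fun z => b z * q z * conj (b z * p z)) 0 r -
        Real.circleAverage (fun z => q z * conj (p z)) 0 r := by
  have hia := circleIntegrable_mul_conj (mul_mem_hardyInfty ha hq) (mul_mem_hardyInfty ha hp) hr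
  have hib := circleIntegrable_mul_conj (mul_mem_hardyInfty hb hq) (mul_mem_hardyInfty hb hp) hr
  rw [← Real.circleAverage_add hia hib,
    ← Real.circleAverage_sub (hia.add hib) (circleIntegrable_mul_conj hq hp hr)]
  congr 1
  ext z
  simp only [Pi.add_apply, Pi.sub_apply]
  push_cast
  rw [← Complex.mul_conj', ← Complex.mul_conj']
  simp only [map_mul]
  ring

theorem tendsto_circleAverage_pythagoreanWeight_mul (ha : a ∈ hardyInfty) (hb : b ∈ hardyInfty)
    {u v : ℝ → ℂ} (hu : HasBoundaryFunction a u) (hv : HasBoundaryFunction b v)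
    (huv : ∀ᵐ θ : ℝ, ‖u θ‖ ^ 2 + ‖v θ‖ ^ 2 = 1) (hp : p ∈ hardyInfty) (hq : q ∈ hardyInfty) :
    Tendsto (fun r : ℝ => Real.circleAverage
      (fun z => ((‖a z‖ ^ 2 + ‖b z‖ ^ 2 - 1 : ℝ) : ℂ) * (q z * conj (p z))) 0 r) (𝓝[<] 1)
      (𝓝 0) := by
  obtain ⟨had, A, hA⟩ := ha
  obtain ⟨hbd, B, hB⟩ := hb
  obtain ⟨hpd, P, hP⟩ := hp
  obtain ⟨hqd, Q, hQ⟩ := hq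
  have hqp : ∀ z ∈ ball (0 : ℂ) 1, ‖q z * conj (p z)‖ ≤ Q * P := fun z hz => by
    rw [norm_mul, Complex.norm_conj]
    exact mul_le_mul (hQ z hz) (hP z hz) (norm_nonneg _) ((norm_nonneg _).trans (hQ z hz))
  have hweight : ∀ z ∈ ball (0 : ℂ) 1, ‖((‖a z‖ ^ 2 + ‖b z‖ ^ 2 - 1 : ℝ) : ℂ)‖ ≤
      A ^ 2 + B ^ 2 + 1 := fun z hz => by
    rw [Complex.norm_real, Real.norm_eq_abs, abs_le]
    constructor <;> nlinarith [sq_nonneg ‖a z‖, sq_nonneg ‖b z‖,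
      pow_le_pow_left₀ (norm_nonneg _) (hA z hz) 2, pow_le_pow_left₀ (norm_nonneg _) (hB z hz) 2]
  have hcont : ContinuousOn
      (fun z => ((‖a z‖ ^ 2 + ‖b z‖ ^ 2 - 1 : ℝ) : ℂ) * (q z * conj (p z))) (ball 0 1) :=
    (Complex.continuous_ofReal.comp_continuousOn (((had.continuousOn.norm.pow 2).add
      (hbd.continuousOn.norm.pow 2)).sub continuousOn_const)).mul
      (hqd.continuousOn.mul (Complex.continuous_conj.comp_continuousOn hpd.continuousOn))
  have hbdry : HasBoundaryFunction
      (fun z => ((‖a z‖ ^ 2 + ‖b z‖ ^ 2 - 1 : ℝ) : ℂ) * (q z * conj (p z))) (fun _ => 0) := by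
    filter_upwards [hu, hv, huv] with θ hu hv huv
    have hlim := (Complex.continuous_ofReal.tendsto _).comp
      (((hu.norm.pow 2).add (hv.norm.pow 2)).sub_const 1)
    rw [huv, sub_self, Complex.ofReal_zero] at hlim
    refine hlim.zero_mul_isBoundedUnder_le (isBoundedUnder_of_eventually_le (a := Q * P) ?_)
    filter_upwards [eventually_abs_lt_one] with r hr using hqp _ (circleMap_mem_unitBall hr θ)
  simpa using tendsto_circleAverage_of_hasBoundaryFunction hcont (fun z hz =>
    norm_mul_le_of_le (hweight z hz) (hqp z hz)) hbdry

theorem inner_add_inner_of_boundary (ha : a ∈ hardyInfty) (hb : b ∈ hardyInfty)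
    {u v : ℝ → ℂ} (hu : HasBoundaryFunction a u) (hv : HasBoundaryFunction b v)
    (huv : ∀ᵐ θ : ℝ, ‖u θ‖ ^ 2 + ‖v θ‖ ^ 2 = 1) (hp : p ∈ hardyInfty) (hq : q ∈ hardyInfty) :
    inner ℂ (hardyVec fun z => a z * p z) (hardyVec fun z => a z * q z) +
      inner ℂ (hardyVec fun z => b z * p z) (hardyVec fun z => b z * q z) =
      inner ℂ (hardyVec p) (hardyVec q) := by
  have hlim : ∀ {F G : ℂ → ℂ}, F ∈ hardyInfty → G ∈ hardyInfty → _ := fun hF hG =>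
    tendsto_circleAverage_mul_conj (hardyInfty_subset_hardyTwo hF) (hardyInfty_subset_hardyTwo hG)
  have hsum := ((hlim (mul_mem_hardyInfty ha hq) (mul_mem_hardyInfty ha hp)).add
    (hlim (mul_mem_hardyInfty hb hq) (mul_mem_hardyInfty hb hp))).sub (hlim hq hp)
  rw [← sub_eq_zero]
  refine tendsto_nhds_unique hsum
    ((tendsto_circleAverage_pythagoreanWeight_mul ha hb hu hv huv hp hq).congr' ?_)
  filter_upwards [eventually_abs_lt_one] with r hr
    using circleAverage_pythagoreanWeight_mul ha hb hp hq hr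

end PythagoreanWeight

/-! ### Outer functions -/

theorem hasTaylor_monomial (j : ℕ) (c : ℂ) :
    HasTaylor (fun z => c * z ^ j) (Pi.single j c : ℕ → ℂ) := fun z _ => by
  simpa using hasSum_single (f := fun n => (Pi.single j c : ℕ → ℂ) n * z ^ n) j
    (fun n hn => by simp [hn])

/-- The functions `a g_n z^j` are bounded in `H²` and converge pointwise to `c z^j`, so `c z^j` is
a weak limit point of them and hence orthogonal to `x`. -/
theorem eq_zero_of_inner_eq_zero {a : ℂ → ℂ} {g : ℕ → ℂ → ℂ} {c : ℂ} {C : ℝ} (hc : c ≠ 0)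
    (ha : DifferentiableOn ℂ a (ball 0 1)) (hg : ∀ n, g n ∈ hardyInfty)
    (hag : ∀ n, ∀ z ∈ ball (0 : ℂ) 1, ‖a z * g n z‖ ≤ C)
    (hlim : ∀ z ∈ ball (0 : ℂ) 1, Tendsto (fun n => a z * g n z) atTop (𝓝 c)) {x : HardySeq}
    (hx : ∀ q ∈ hardyInfty, inner ℂ (hardyVec fun z => a z * q z) x = 0) : x = 0 := by
  ext j
  let F : ℕ → ℂ → ℂ := fun n z => a z * (g n z * z ^ j)
  have hFd : ∀ n, DifferentiableOn ℂ (F n) (ball 0 1) := fun n =>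
    ha.mul ((hg n).1.mul (by fun_prop))
  have hFb : ∀ n, ∀ z ∈ ball (0 : ℂ) 1, ‖F n z‖ ≤ C := fun n z hz => by
    simp only [F]
    rw [← mul_assoc, norm_mul, norm_pow]
    exact (mul_le_of_le_one_right (norm_nonneg _) (pow_le_one₀ (norm_nonneg _)
      (mem_ball_zero_iff.1 hz).le)).trans (hag n z hz)
  have hF2 : ∀ n, F n ∈ hardyTwo := fun n => hardyInfty_subset_hardyTwo ⟨hFd n, C, hFb n⟩
  obtain ⟨y, U, hU, hy⟩ := exists_ultrafilter_tendsto_inner (𝕜 := ℂ) (l := atTop)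
    (x := fun n => hardyVec (F n)) (fun n => norm_hardyVec_le (hFd n) (hFb n))
  have hyT : HasTaylor (fun z => c * z ^ j) y := by
    refine (hasTaylor_inner_szego y).congr fun w hw => ?_
    have hconj := (Complex.continuous_conj.tendsto _).comp (hy (hardyVec (szego w)))
    simp only [Function.comp_def, inner_conj_symm, inner_szego (hF2 _) hw] at hconj
    simp only [F, ← mul_assoc] at hconj
    exact tendsto_nhds_unique hconj (((hlim w hw).mul_const _).mono_left hU)
  have hyx : inner ℂ y x = 0 := by
    have hFx : ∀ n, inner ℂ (hardyVec (F n)) x = 0 := fun n =>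
      hx _ (mul_mem_hardyInfty (hg n) (pow_mem_hardyInfty j))
    refine tendsto_nhds_unique (hy x) ?_
    simp only [hFx]
    exact tendsto_const_nhds
  have hinner := lp.hasSum_inner (𝕜 := ℂ) y x
  rw [hyx, hyT.unique (hasTaylor_monomial j c)] at hinner
  simpa [hc] using (hinner.unique (hasSum_single j fun n hn => by simp [hn])).symm

theorem exp_herglotz_mem_hardyInfty {ℓ : ℂ → ℝ} (hℓ : CircleIntegrable ℓ 0 1) {C : ℝ}
    (hC : ∀ ζ, ℓ ζ ≤ C) : (fun z => Complex.exp (herglotz ℓ z)) ∈ hardyInfty := by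
  refine ⟨(differentiableOn_herglotz hℓ).cexp, Real.exp C, fun z hz => ?_⟩
  rw [Complex.norm_exp, Real.exp_le_exp]
  exact re_herglotz_le hℓ hC hz

theorem tendsto_add_min_neg (x : ℝ) : Tendsto (fun n : ℕ => x + min (-x) n) atTop (𝓝 0) := by
  refine tendsto_const_nhds.congr' ?_
  filter_upwards [eventually_ge_atTop ⌈-x⌉₊] with n hn
  rw [min_eq_left (Nat.ceil_le.1 hn), add_neg_cancel]

/-- The exponentials of the Herglotz integrals of the truncations `min (-ℓ) n` of `-ℓ` are bounded
approximate inverses of `exp (herglotz ℓ)`. -/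
theorem eq_zero_of_inner_exp_herglotz_eq_zero {a : ℂ → ℂ} {ℓ : ℂ → ℝ} {c : ℂ} (hc : c ≠ 0)
    (hℓ : CircleIntegrable ℓ 0 1) (hℓ0 : ∀ ζ, ℓ ζ ≤ 0)
    (ha : ∀ z ∈ ball (0 : ℂ) 1, a z = c * Complex.exp (herglotz ℓ z)) {x : HardySeq}
    (hx : ∀ q ∈ hardyInfty, inner ℂ (hardyVec fun z => a z * q z) x = 0) : x = 0 := by
  let W : ℕ → ℂ → ℝ := fun n ζ => min (-ℓ ζ) n
  have hW : ∀ n, CircleIntegrable (W n) 0 1 := fun n => by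
    simp only [CircleIntegrable, intervalIntegrable_iff] at hℓ ⊢
    exact hℓ.neg.inf (integrableOn_const (by simp [Set.uIoc]))
  have hℓW : ∀ n, CircleIntegrable (fun ζ => ℓ ζ + W n ζ) 0 1 := fun n => hℓ.add (hW n)
  have hℓW0 : ∀ n ζ, ℓ ζ + W n ζ ≤ 0 := fun n ζ => by
    linarith [min_le_left (-ℓ ζ) (n : ℝ)]
  have hag : ∀ n, ∀ z ∈ ball (0 : ℂ) 1, a z * Complex.exp (herglotz (W n) z) =
      c * Complex.exp (herglotz (fun ζ => ℓ ζ + W n ζ) z) := fun n z hz => by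
    rw [ha z hz, herglotz_add hℓ (hW n) hz, Complex.exp_add, mul_assoc]
  have had : DifferentiableOn ℂ a (ball 0 1) :=
    ((differentiableOn_herglotz hℓ).cexp.const_mul c).congr ha
  refine eq_zero_of_inner_eq_zero (g := fun n z => Complex.exp (herglotz (W n) z)) (C := ‖c‖) hc had
    (fun n => exp_herglotz_mem_hardyInfty (hW n) fun ζ => min_le_right _ _) (fun n z hz => ?_)
    (fun z hz => ?_) hx
  · rw [hag n z hz, norm_mul, Complex.norm_exp]
    exact mul_le_of_le_one_right (norm_nonneg _)
      (Real.exp_le_one_iff.2 (re_herglotz_le (hℓW n) (hℓW0 n) hz))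
  · simp only [hag _ z hz]
    have hbound : ∀ n ζ, |ℓ ζ + W n ζ| ≤ |ℓ ζ| := fun n ζ => by
      have hW0 : 0 ≤ W n ζ := le_min (by linarith [hℓ0 ζ]) n.cast_nonneg
      rw [abs_of_nonpos (hℓW0 n ζ), abs_of_nonpos (hℓ0 ζ)]
      linarith
    simpa [Function.comp_def] using ((Complex.continuous_exp.tendsto _).comp
      (tendsto_herglotz_zero hℓ hℓW hbound (fun ζ => tendsto_add_min_neg (ℓ ζ)) hz)).const_mul c

/-- The function on the unit circle with the given values on the angles in `[0, 2π)`; it transfers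
functions of the angle to Mathlib's circle averages. -/
noncomputable def ofAngle (L : ℝ → ℝ) (ζ : ℂ) : ℝ :=
  L (toIcoMod Real.two_pi_pos 0 ζ.arg)

theorem ofAngle_circleMap (L : ℝ → ℝ) {θ : ℝ} (hθ : θ ∈ Set.Ico 0 (2 * Real.pi)) :
    ofAngle L (circleMap 0 1 θ) = L θ := by
  rw [ofAngle, circleMap]
  congr 1
  simp only [Complex.ofReal_one, one_mul, zero_add]
  rw [Complex.arg_exp_mul_I, toIcoMod_toIocMod, toIcoMod_eq_self]
  simpa using hθ

theorem ae_ofAngle_circleMap (L : ℝ → ℝ) :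
    ∀ᵐ θ : ℝ, θ ∈ Set.uIoc 0 (2 * Real.pi) → ofAngle L (circleMap 0 1 θ) = L θ := by
  filter_upwards [Measure.ae_ne volume (2 * Real.pi)] with θ hne hmem
  rw [Set.uIoc_of_le Real.two_pi_pos.le] at hmem
  exact ofAngle_circleMap L ⟨hmem.1.le, lt_of_le_of_ne hmem.2 hne⟩

theorem circleIntegrable_ofAngle {L : ℝ → ℝ} (hL : IntervalIntegrable L volume 0 (2 * Real.pi)) :
    CircleIntegrable (ofAngle L) 0 1 := by
  refine hL.congr_ae ?_
  rw [EventuallyEq, ae_restrict_iff' measurableSet_uIoc]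
  filter_upwards [ae_ofAngle_circleMap L] with θ h hθ using (h hθ).symm

theorem herglotz_ofAngle (L : ℝ → ℝ) (z : ℂ) :
    herglotz (ofAngle L) z = (2 * (Real.pi : ℂ))⁻¹ * ∫ θ in (0 : ℝ)..(2 * Real.pi),
      (circleMap 0 1 θ + z) / (circleMap 0 1 θ - z) * (L θ : ℂ) := by
  rw [herglotz, Real.circleAverage, Complex.real_smul]
  push_cast
  congr 1
  refine intervalIntegral.integral_congr_ae ?_
  filter_upwards [ae_ofAngle_circleMap L] with θ h hθ
  rw [h hθ]
  simp [herglotzRieszKernel]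

theorem IsOuter.exists_eq_exp_herglotz {a : ℂ → ℂ} {u : ℝ → ℂ} (ha : IsOuter a)
    (hu : HasBoundaryFunction a u) (hu1 : ∀ᵐ θ : ℝ, ‖u θ‖ ≤ 1) :
    ∃ ℓ : ℂ → ℝ, CircleIntegrable ℓ 0 1 ∧ (∀ ζ, ℓ ζ ≤ 0) ∧ ∃ c : ℂ, c ≠ 0 ∧
      ∀ z ∈ ball (0 : ℂ) 1, a z = c * Complex.exp (herglotz ℓ z) := by
  obtain ⟨-, u', hu', -, hL, c, hc, hac⟩ := ha
  have hlog : (fun θ => min (Real.log ‖u' θ‖) 0) =ᵐ[volume] fun θ => Real.log ‖u' θ‖ := by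
    filter_upwards [hu1, hu.unique hu'] with θ hθ huu'
    exact min_eq_left (Real.log_nonpos (norm_nonneg _) (huu' ▸ hθ))
  refine ⟨ofAngle fun θ => min (Real.log ‖u' θ‖) 0,
    circleIntegrable_ofAngle (hL.congr_ae (ae_restrict_of_ae hlog.symm)),
    fun ζ => min_le_right _ _, c, norm_ne_zero_iff.1 (by simp [hc]), fun z hz => ?_⟩
  rw [hac z hz, herglotz_ofAngle]
  congr 3
  refine intervalIntegral.integral_congr_ae ?_
  filter_upwards [hlog] with θ hθ _
  rw [hθ]

theorem IsPythagoreanMate.isOuterPair {a b : ℂ → ℂ} (hb : DifferentiableOn ℂ b (ball 0 1))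
    (hbD : Set.MapsTo b (ball 0 1) (ball 0 1)) (hab : IsPythagoreanMate a b) :
    IsOuterPair a b := by
  obtain ⟨hOuter, u, v, hu, hv, huv⟩ := hab
  have hu1 : ∀ᵐ θ : ℝ, ‖u θ‖ ≤ 1 := huv.mono fun θ h => by
    nlinarith [sq_nonneg ‖v θ‖, norm_nonneg (u θ)]
  obtain ⟨ℓ, hℓ, hℓ0, c, hc, hac⟩ := hOuter.exists_eq_exp_herglotz hu hu1
  have ha : a ∈ hardyInfty := by
    refine ⟨hOuter.1, ‖c‖, fun z hz => ?_⟩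
    rw [hac z hz, norm_mul, Complex.norm_exp]
    exact mul_le_of_le_one_right (norm_nonneg _)
      (Real.exp_le_one_iff.2 (re_herglotz_le hℓ hℓ0 hz))
  have hb : b ∈ hardyInfty := ⟨hb, 1, fun z hz => (mem_ball_zero_iff.1 (hbD hz)).le⟩
  exact {
    left_mem := ha
    right_mem := hb
    ne_zero := fun z hz => by
      rw [hac z hz]
      exact mul_ne_zero hc (Complex.exp_ne_zero _)
    inner_add := fun p hp q hq => inner_add_inner_of_boundary ha hb hu hv huv hp hq
    eq_zero := fun x => eq_zero_of_inner_exp_herglotz_eq_zero hc hℓ hℓ0 hac }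

/-! ### Polynomials and co-analytic Toeplitz operators -/

theorem hasTaylor_eval (p : Polynomial ℂ) : HasTaylor (fun z => p.eval z) p.coeff := fun z _ => by
  simp only [Polynomial.eval_eq_sum, Polynomial.sum]
  refine hasSum_sum_of_ne_finset_zero fun n hn => ?_
  simp [Polynomial.notMem_support_iff.1 hn]

theorem eval_mem_hardyInfty (p : Polynomial ℂ) : (fun z => p.eval z) ∈ hardyInfty := by
  refine ⟨p.differentiable.differentiableOn, ?_⟩
  obtain ⟨C, hC⟩ := (isCompact_closedBall (0 : ℂ) 1).exists_bound_of_continuousOn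
    p.continuous.continuousOn
  exact ⟨C, fun z hz => hC z (ball_subset_closedBall hz)⟩

theorem hardyVec_eval_apply (p : Polynomial ℂ) (n : ℕ) :
    hardyVec (fun z => p.eval z) n = p.coeff n :=
  congrFun ((hasTaylor_hardyVec (hardyInfty_subset_hardyTwo (eval_mem_hardyInfty p))).unique
    (hasTaylor_eval p)) n

/-- The coefficient sequence of a polynomial, as a vector of `ℓ²`. -/
noncomputable def polyVec : Polynomial ℂ →ₗ[ℂ] HardySeq where
  toFun p := hardyVec fun z => p.eval z
  map_add' p q := by
    ext n
    simp only [hardyVec_eval_apply, Polynomial.coeff_add, lp.coeFn_add, Pi.add_apply]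
  map_smul' c p := by
    ext n
    simp only [hardyVec_eval_apply, Polynomial.coeff_smul, lp.coeFn_smul, Pi.smul_apply,
      RingHom.id_apply]

theorem polyVec_apply (p : Polynomial ℂ) (n : ℕ) : polyVec p n = p.coeff n :=
  hardyVec_eval_apply p n

theorem inner_polyVec_monomial (x : HardySeq) (n : ℕ) (c : ℂ) :
    inner ℂ x (polyVec (Polynomial.monomial n c)) = c * conj (x n) := by
  have hsingle := hasSum_single
    (f := fun m => inner ℂ (x m) (polyVec (Polynomial.monomial n c) m)) n
    fun m hm => by simp [polyVec_apply, Polynomial.coeff_monomial, hm.symm]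
  refine (lp.hasSum_inner (𝕜 := ℂ) x (polyVec (Polynomial.monomial n c))).unique ?_
  simpa [polyVec_apply] using hsingle

theorem inner_polyVec_monomial_left (x : HardySeq) (n : ℕ) (c : ℂ) :
    inner ℂ (polyVec (Polynomial.monomial n c)) x = conj c * x n := by
  rw [← inner_conj_symm, inner_polyVec_monomial, map_mul, Complex.conj_conj]

theorem inner_polyVec (p s : Polynomial ℂ) : inner ℂ (polyVec p) (polyVec s) =
    Real.circleAverage (fun z => conj (p.eval z) * s.eval z) 0 1 := by
  have hlim := tendsto_circleAverage_mul_conj (hardyInfty_subset_hardyTwo (eval_mem_hardyInfty s))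
    (hardyInfty_subset_hardyTwo (eval_mem_hardyInfty p))
  have hcont : Continuous fun z : ℂ => s.eval z * conj (p.eval z) := by fun_prop
  have hlim' := ((Real.Continuous.circleAverage (c := 0) hcont).tendsto 1).mono_left
    (nhdsWithin_le_nhds (s := Set.Iio (1 : ℝ)))
  refine (tendsto_nhds_unique hlim hlim').trans ?_
  simp only [mul_comm]

theorem norm_polyVec_sq (p : Polynomial ℂ) : ‖polyVec p‖ ^ 2 =
    Real.circleAverage (fun z => ‖p.eval z‖ ^ 2) 0 1 := by
  refine Complex.ofReal_injective ?_
  have hinner := inner_polyVec p p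
  simp only [Complex.conj_mul', inner_self_eq_norm_sq_to_K, ← Complex.ofReal_pow,
    circleAverage_ofReal] at hinner
  simpa using hinner

theorem norm_polyVec_one : ‖polyVec 1‖ = 1 := by
  have hsq := norm_polyVec_sq 1
  simp only [Polynomial.eval_one, norm_one, one_pow, Real.circleAverage_const] at hsq
  exact (pow_eq_one_iff_of_nonneg (norm_nonneg _) two_ne_zero).1 hsq

/-- The co-analytic Toeplitz operator `T_{conj φ}`, where `φ` has Taylor coefficients `d`. It acts
on polynomials because multiplication by `conj z` followed by the Riesz projection lowers the
degree. -/
noncomputable def coanalyticToeplitz (d : ℕ → ℂ) : Polynomial ℂ →ₗ[ℂ] Polynomial ℂ :=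
  Polynomial.lsum fun k => ∑ j ∈ Finset.range (k + 1),
    (Polynomial.monomial (k - j)).comp (LinearMap.lsmul ℂ ℂ (conj (d j)))

theorem coanalyticToeplitz_monomial (d : ℕ → ℂ) (k : ℕ) (c : ℂ) :
    coanalyticToeplitz d (Polynomial.monomial k c) =
      ∑ j ∈ Finset.range (k + 1), Polynomial.monomial (k - j) (conj (d j) * c) := by
  simp [coanalyticToeplitz, Polynomial.lsum_apply, Polynomial.sum_monomial_index,
    LinearMap.sum_apply]

theorem coeff_coanalyticToeplitz_monomial (d : ℕ → ℂ) {m n : ℕ} (hmn : m ≤ n) (c : ℂ) :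
    (coanalyticToeplitz d (Polynomial.monomial n c)).coeff m = conj (d (n - m)) * c := by
  rw [coanalyticToeplitz_monomial, Polynomial.finsetSum_coeff, Finset.sum_eq_single (n - m)]
  · rw [Polynomial.coeff_monomial, if_pos (by omega)]
  · intro j hj hjm
    have := Finset.mem_range.1 hj
    rw [Polynomial.coeff_monomial, if_neg (by omega)]
  · intro hj
    exact absurd (Finset.mem_range.2 (by omega)) hj

theorem sum_norm_sq_le_norm_coanalyticToeplitz_sq (d : ℕ → ℂ) (n : ℕ) :
    ∑ j ∈ Finset.range n, ‖d j‖ ^ 2 ≤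
      ‖polyVec (coanalyticToeplitz d (Polynomial.monomial n 1))‖ ^ 2 := by
  set t := coanalyticToeplitz d (Polynomial.monomial n 1)
  calc ∑ j ∈ Finset.range n, ‖d j‖ ^ 2 ≤ ∑ j ∈ Finset.range (n + 1), ‖d j‖ ^ 2 :=
        Finset.sum_le_sum_of_subset_of_nonneg (Finset.range_mono (by omega))
          fun _ _ _ => by positivity
    _ = ∑ j ∈ Finset.range (n + 1), ‖polyVec t j‖ ^ 2 := by
        rw [← Finset.sum_range_reflect]
        refine Finset.sum_congr rfl fun j hj => ?_
        have := Finset.mem_range.1 hj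
        rw [polyVec_apply, coeff_coanalyticToeplitz_monomial d (by omega), mul_one,
          Complex.norm_conj]
        congr 3
    _ ≤ ‖polyVec t‖ ^ 2 := by
        rw [norm_hardySeq_sq]
        exact (memℓp_two_iff.1 (lp.memℓp (polyVec t))).sum_le_tsum _ fun _ _ => by positivity

/-! ### The model of `H(b)` attached to a Pythagorean pair -/

/-- The vectors realizing the kernel functions of `H(b)` in `ℓ² × ℓ²`: in terms of functions,
the pair `(k_b(w, ·), conj (b w) a k_w)`, where `k_w` is the Szegő kernel. -/
noncomputable def modelVec (a b : ℂ → ℂ) (w : Complex.UnitDisc) :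
    WithLp 2 (HardySeq × HardySeq) :=
  WithLp.toLp 2 (hardyVec (szego w) - conj (b w) • hardyVec fun z => b z * szego w z,
    conj (b w) • hardyVec fun z => a z * szego w z)

theorem modelVec_fst (a b : ℂ → ℂ) (w : Complex.UnitDisc) : (modelVec a b w).fst =
    hardyVec (szego w) - conj (b w) • hardyVec fun z => b z * szego w z := rfl

theorem modelVec_snd (a b : ℂ → ℂ) (w : Complex.UnitDisc) : (modelVec a b w).snd =
    conj (b w) • hardyVec fun z => a z * szego w z := rfl

theorem unitDisc_mem_ball (w : Complex.UnitDisc) : (w : ℂ) ∈ ball (0 : ℂ) 1 := by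
  simpa using w.norm_lt_one

theorem inner_hardyVec_szego {F : ℂ → ℂ} (hF : F ∈ hardyTwo) {w : ℂ} (hw : w ∈ ball (0 : ℂ) 1) :
    inner ℂ (hardyVec F) (hardyVec (szego w)) = conj (F w) := by
  rw [← inner_conj_symm, inner_szego hF hw]

/-- The pair `F` of functions satisfies `T_{conj b} F₁ = T_{conj a} F₂`, in weak form. -/
def IsIntertwined (a b : ℂ → ℂ) (F : WithLp 2 (HardySeq × HardySeq)) : Prop :=
  ∀ q ∈ hardyInfty, inner ℂ (hardyVec fun z => b z * q z) F.fst =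
    inner ℂ (hardyVec fun z => a z * q z) F.snd

theorem IsIntertwined.inner_modelVec {a b : ℂ → ℂ} {F : WithLp 2 (HardySeq × HardySeq)}
    (hF : IsIntertwined a b F) (w : Complex.UnitDisc) :
    inner ℂ (modelVec a b w) F = inner ℂ (hardyVec (szego w)) F.fst := by
  have hsplit : inner ℂ (modelVec a b w) F =
      inner ℂ (modelVec a b w).fst F.fst + inner ℂ (modelVec a b w).snd F.snd :=
    WithLp.prod_inner_apply _ _
  rw [hsplit, modelVec_fst, modelVec_snd, inner_sub_left, inner_smul_left, inner_smul_left,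
    hF _ (szego_mem_hardyInfty (unitDisc_mem_ball w)), sub_add_cancel]

namespace IsOuterPair

variable {a b : ℂ → ℂ} {d : ℕ → ℂ}

theorem isIntertwined_modelVec (h : IsOuterPair a b) (w : Complex.UnitDisc) :
    IsIntertwined a b (modelVec a b w) := fun q hq => by
  have hw := unitDisc_mem_ball w
  have hadd := h.inner_add q hq _ (szego_mem_hardyInfty hw)
  rw [inner_hardyVec_szego (hardyInfty_subset_hardyTwo hq) hw] at hadd
  simp only [modelVec_fst, modelVec_snd, inner_sub_right, inner_smul_right]
  rw [inner_hardyVec_szego (hardyInfty_subset_hardyTwo (mul_mem_hardyInfty h.right_mem hq)) hw,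
    map_mul, ← hadd]
  ring

theorem isIntertwined_of_mem (h : IsOuterPair a b) {F : WithLp 2 (HardySeq × HardySeq)}
    (hF : F ∈ (Submodule.span ℂ (Set.range (modelVec a b))).topologicalClosure) :
    IsIntertwined a b F := fun q hq => by
  let ℓ : WithLp 2 (HardySeq × HardySeq) →L[ℂ] ℂ :=
    innerSL ℂ (WithLp.toLp 2 (hardyVec fun z => b z * q z, - hardyVec fun z => a z * q z))
  have hℓ : ∀ G, ℓ G = inner ℂ (hardyVec fun z => b z * q z) G.fst -
      inner ℂ (hardyVec fun z => a z * q z) G.snd := fun G => by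
    simp only [ℓ, innerSL_apply_apply, WithLp.prod_inner_apply, inner_neg_left]
    rfl
  have hle : (Submodule.span ℂ (Set.range (modelVec a b))).topologicalClosure ≤
      LinearMap.ker ℓ.toLinearMap := by
    refine Submodule.topologicalClosure_minimal _ (Submodule.span_le.2 ?_) ℓ.isClosed_ker
    rintro _ ⟨w, rfl⟩
    change ℓ _ = 0
    rw [hℓ, h.isIntertwined_modelVec w q hq, sub_self]
  rw [← sub_eq_zero, ← hℓ]
  exact hle hF

theorem isKernelModel (h : IsOuterPair a b) : IsKernelModel b (modelVec a b) := fun z w => by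
  have hz := unitDisc_mem_ball z
  have hw := unitDisc_mem_ball w
  rw [(h.isIntertwined_modelVec w).inner_modelVec, modelVec_fst, inner_sub_right,
    inner_smul_right, inner_szego (hardyInfty_subset_hardyTwo (szego_mem_hardyInfty hw)) hz,
    inner_szego (hardyInfty_subset_hardyTwo
      (mul_mem_hardyInfty h.right_mem (szego_mem_hardyInfty hw))) hz, szego, div_eq_mul_inv]
  ring

theorem hardyVec_mul_apply (h : IsOuterPair a b) (hd : HasTaylor (fun z => b z / a z) d)
    {q : ℂ → ℂ} (hq : q ∈ hardyInfty) (n : ℕ) : hardyVec (fun z => b z * q z) n =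
      ∑ j ∈ Finset.range (n + 1), d j * hardyVec (fun z => a z * q z) (n - j) := by
  have hb := hasTaylor_hardyVec (hardyInfty_subset_hardyTwo (mul_mem_hardyInfty h.right_mem hq))
  have ha := hasTaylor_hardyVec (hardyInfty_subset_hardyTwo (mul_mem_hardyInfty h.left_mem hq))
  refine congrFun (hb.unique ((hd.mul ha).congr fun z hz => ?_)) n
  have hne := h.ne_zero z hz
  simp only
  field_simp

theorem isIntertwined_coanalyticToeplitz (h : IsOuterPair a b)
    (hd : HasTaylor (fun z => b z / a z) d) (p : Polynomial ℂ) :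
    IsIntertwined a b (WithLp.toLp 2 (polyVec p, polyVec (coanalyticToeplitz d p))) := by
  intro q hq
  change inner ℂ (hardyVec fun z => b z * q z) (polyVec p) =
    inner ℂ (hardyVec fun z => a z * q z) (polyVec (coanalyticToeplitz d p))
  induction p using Polynomial.induction_on' with
  | add p q hp hq => simp only [map_add, inner_add_right, hp, hq]
  | monomial k c =>
    rw [coanalyticToeplitz_monomial, map_sum, inner_sum, inner_polyVec_monomial,
      h.hardyVec_mul_apply hd hq, map_sum, Finset.mul_sum]
    refine Finset.sum_congr rfl fun j _ => ?_
    rw [inner_polyVec_monomial, map_mul]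
    ring

theorem inner_modelVec_polyVec (h : IsOuterPair a b) (hd : HasTaylor (fun z => b z / a z) d)
    (p : Polynomial ℂ) (w : Complex.UnitDisc) :
    inner ℂ (modelVec a b w) (WithLp.toLp 2 (polyVec p, polyVec (coanalyticToeplitz d p))) =
      p.eval (w : ℂ) := by
  rw [(h.isIntertwined_coanalyticToeplitz hd p).inner_modelVec]
  exact inner_szego (hardyInfty_subset_hardyTwo (eval_mem_hardyInfty p)) (unitDisc_mem_ball w)

theorem eq_of_inner_modelVec_eq_eval (h : IsOuterPair a b)
    (hd : HasTaylor (fun z => b z / a z) d) {p : Polynomial ℂ}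
    {F : WithLp 2 (HardySeq × HardySeq)}
    (hF : F ∈ (Submodule.span ℂ (Set.range (modelVec a b))).topologicalClosure)
    (hFp : ∀ w : Complex.UnitDisc, inner ℂ (modelVec a b w) F = p.eval (w : ℂ)) :
    F = WithLp.toLp 2 (polyVec p, polyVec (coanalyticToeplitz d p)) := by
  have hint := h.isIntertwined_of_mem hF
  have hfst : F.fst = polyVec p := by
    have htaylor : HasTaylor (fun z => p.eval z) F.fst :=
      (hasTaylor_inner_szego F.fst).congr fun w hw => by
        have hw' := hFp (Complex.UnitDisc.mk w (by simpa using hw))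
        rwa [hint.inner_modelVec] at hw'
    ext m
    rw [polyVec_apply, htaylor.unique (hasTaylor_eval p)]
  have hsnd : F.snd = polyVec (coanalyticToeplitz d p) := by
    refine sub_eq_zero.1 (h.eq_zero _ fun q hq => ?_)
    rw [inner_sub_right, ← hint q hq, hfst]
    exact sub_eq_zero.2 (h.isIntertwined_coanalyticToeplitz hd p q hq)
  rw [← hfst, ← hsnd]
  rfl

end IsOuterPair

/-! ### The disk algebra and `H(b)` -/

theorem wiener_hasTaylor_mem_diskAlgebra (x : lp (fun _ : ℕ => ℂ) 1) :
    HasTaylor (fun z => ∑' n, x n * z ^ n) x ∧ (fun z => ∑' n, x n * z ^ n) ∈ diskAlgebra := by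
  have hx : Summable fun n => ‖x n‖ := by
    simpa using (memℓp_gen_iff (p := 1) (by norm_num)).1 (lp.memℓp x)
  have hbound : ∀ n, ∀ z ∈ closedBall (0 : ℂ) 1, ‖x n * z ^ n‖ ≤ ‖x n‖ := fun n z hz => by
    rw [norm_mul, norm_pow]
    exact mul_le_of_le_one_right (norm_nonneg _)
      (pow_le_one₀ (norm_nonneg _) (mem_closedBall_zero_iff.1 hz))
  have htaylor : HasTaylor (fun z => ∑' n, x n * z ^ n) x := fun z hz =>
    (hx.of_norm_bounded fun n => hbound n z (ball_subset_closedBall hz)).hasSum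
  refine ⟨htaylor, htaylor.differentiableOn, _, ?_, fun _ _ => rfl⟩
  exact continuousOn_tsum (fun n => by fun_prop) hx hbound

theorem norm_tsum_mul_pow_le (x : lp (fun _ : ℕ => ℂ) 1) {z : ℂ} (hz : z ∈ ball (0 : ℂ) 1) :
    ‖∑' n, x n * z ^ n‖ ≤ ‖x‖ := by
  have hx := lp.hasSum_norm (p := 1) (by norm_num) x
  simp only [ENNReal.toReal_one, Real.rpow_one] at hx
  refine tsum_of_norm_bounded hx fun n => ?_
  rw [norm_mul, norm_pow]
  exact mul_le_of_le_one_right (norm_nonneg _)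
    (pow_le_one₀ (norm_nonneg _) (mem_ball_zero_iff.1 hz).le)

/-- Evaluation at a point of the disk on the analytic Wiener algebra, which is identified with
the space `ℓ¹` of Taylor coefficients. -/
noncomputable def wienerEval (w : Complex.UnitDisc) : lp (fun _ : ℕ => ℂ) 1 →L[ℂ] ℂ :=
  LinearMap.mkContinuous
    { toFun := fun x => ∑' n, x n * (w : ℂ) ^ n
      map_add' := fun x y => (((wiener_hasTaylor_mem_diskAlgebra x).1.add
        (wiener_hasTaylor_mem_diskAlgebra y).1) w (unitDisc_mem_ball w)).tsum_eq
      map_smul' := fun c x => (((wiener_hasTaylor_mem_diskAlgebra x).1.const_mul c) w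
        (unitDisc_mem_ball w)).tsum_eq }
    1 fun x => (norm_tsum_mul_pow_le x (unitDisc_mem_ball w)).trans_eq (one_mul _).symm

theorem wienerEval_apply (w : Complex.UnitDisc) (x : lp (fun _ : ℕ => ℂ) 1) :
    wienerEval w x = ∑' n, x n * (w : ℂ) ^ n := rfl

theorem wienerEval_single (w : Complex.UnitDisc) (n : ℕ) :
    wienerEval w (lp.single 1 n 1) = (w : ℂ) ^ n := by
  rw [wienerEval_apply, tsum_eq_single n fun m hm => by simp [hm]]
  simp

/-- By the closed graph theorem, inclusion of the Wiener algebra in `H(b)` is automatically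
bounded, and the monomials are unit vectors of the Wiener algebra. -/
theorem IsKernelModel.exists_bound_of_diskAlgebra_subset {E : Type*} [NormedAddCommGroup E]
    [InnerProductSpace ℂ E] [CompleteSpace E] {b : ℂ → ℂ} {v : Complex.UnitDisc → E}
    (h : IsKernelModel b v) (hA : diskAlgebra ⊆ deBrangesRovnyak b) :
    ∃ C : ℝ, ∀ n : ℕ, ∃ F ∈ (Submodule.span ℂ (Set.range v)).topologicalClosure, ‖F‖ ≤ C ∧
      ∀ w : Complex.UnitDisc, inner ℂ (v w) F = (w : ℂ) ^ n := by
  obtain ⟨T, hTmem, hT⟩ := exists_continuousLinearMap_inner_eq wienerEval fun x =>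
    h.exists_inner_eq_of_mem (hA (wiener_hasTaylor_mem_diskAlgebra x).2)
  refine ⟨‖T‖, fun n => ⟨T (lp.single 1 n 1), hTmem _, ?_, fun w => ?_⟩⟩
  · simpa [lp.norm_single (p := 1) (E := fun _ : ℕ => ℂ) one_pos] using
      T.le_opNorm (lp.single 1 n 1)
  · rw [hT, wienerEval_single]

theorem IsOuterPair.mem_hardyTwo_of_diskAlgebra_subset {a b : ℂ → ℂ} (h : IsOuterPair a b)
    (hA : diskAlgebra ⊆ deBrangesRovnyak b) : (fun z => b z / a z) ∈ hardyTwo := by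
  obtain ⟨d, hd⟩ := exists_hasTaylor (h.right_mem.1.div h.left_mem.1 h.ne_zero)
  obtain ⟨C, hC⟩ := h.isKernelModel.exists_bound_of_diskAlgebra_subset hA
  refine hd.mem_hardyTwo_iff.2 <|
    summable_of_sum_range_le (c := C ^ 2) (fun n => by positivity) fun n => ?_
  obtain ⟨F, hF, hFC, hFw⟩ := hC n
  have hFeq : F = WithLp.toLp 2 (polyVec (Polynomial.monomial n 1),
      polyVec (coanalyticToeplitz d (Polynomial.monomial n 1))) :=
    h.eq_of_inner_modelVec_eq_eval hd hF fun w => by simpa using hFw w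
  calc ∑ j ∈ Finset.range n, ‖d j‖ ^ 2
      ≤ ‖polyVec (coanalyticToeplitz d (Polynomial.monomial n 1))‖ ^ 2 :=
        sum_norm_sq_le_norm_coanalyticToeplitz_sq d n
    _ ≤ ‖F‖ ^ 2 := by
        rw [WithLp.prod_norm_sq_eq_of_L2 F, hFeq]
        exact le_add_of_nonneg_left (sq_nonneg _)
    _ ≤ C ^ 2 := pow_le_pow_left₀ (norm_nonneg _) hFC 2

/-! ### Bounded Hankel forms -/

/-- The Hankel form `(g, h) ↦ ⟪p, g h⟫` with symbol `p` is bounded by `C` on pairs of polynomials,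
in the norm of `H²`. -/
def HankelBound (p : Polynomial ℂ) (C : ℝ) : Prop :=
  ∀ g h : Polynomial ℂ, ‖inner ℂ (polyVec p) (polyVec (g * h))‖ ≤ C * ‖polyVec g‖ * ‖polyVec h‖

theorem HankelBound.nonneg {p : Polynomial ℂ} {C : ℝ} (h : HankelBound p C) : 0 ≤ C := by
  simpa [norm_polyVec_one] using (norm_nonneg _).trans (h 1 1)

theorem norm_le_of_norm_inner_self_le {𝕜 E : Type*} [RCLike 𝕜] [NormedAddCommGroup E]
    [InnerProductSpace 𝕜 E] {x : E} {C : ℝ} (hC : 0 ≤ C) (h : ‖(inner 𝕜 x x : 𝕜)‖ ≤ C * ‖x‖) :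
    ‖x‖ ≤ C := by
  rw [inner_self_eq_norm_sq_to_K, norm_pow, RCLike.norm_ofReal, abs_norm] at h
  nlinarith [norm_nonneg x]

theorem HankelBound.norm_le {p : Polynomial ℂ} {C : ℝ} (h : HankelBound p C) :
    ‖polyVec p‖ ≤ C := by
  have hp := h p 1
  rw [mul_one, norm_polyVec_one, mul_one] at hp
  exact norm_le_of_norm_inner_self_le h.nonneg hp

/-- The partial sum of degree `N` of the power series with coefficients `d`. -/
noncomputable def truncPoly (d : ℕ → ℂ) (N : ℕ) : Polynomial ℂ :=
  ∑ j ∈ Finset.range (N + 1), Polynomial.monomial j (d j)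

theorem coeff_truncPoly (d : ℕ → ℂ) (N k : ℕ) :
    (truncPoly d N).coeff k = if k ≤ N then d k else 0 := by
  simp [truncPoly, Polynomial.coeff_monomial]

theorem inner_coanalyticToeplitz_monomial (d : ℕ → ℂ) {N k : ℕ} (hk : k ≤ N) (c : ℂ)
    (s : Polynomial ℂ) :
    inner ℂ (polyVec (coanalyticToeplitz d (Polynomial.monomial k c))) (polyVec s) =
      inner ℂ (polyVec (Polynomial.monomial k c)) (polyVec (truncPoly d N * s)) := by
  rw [coanalyticToeplitz_monomial, map_sum, sum_inner, inner_polyVec_monomial_left, polyVec_apply,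
    Polynomial.coeff_mul, Finset.Nat.sum_antidiagonal_eq_sum_range_succ_mk, Finset.mul_sum]
  refine Finset.sum_congr rfl fun j hj => ?_
  have hjN : j ≤ N := (Finset.mem_range_succ_iff.1 hj).trans hk
  rw [inner_polyVec_monomial_left, polyVec_apply, coeff_truncPoly, if_pos hjN, map_mul,
    Complex.conj_conj]
  ring

theorem inner_coanalyticToeplitz (d : ℕ → ℂ) (p s : Polynomial ℂ) :
    inner ℂ (polyVec (coanalyticToeplitz d p)) (polyVec s) =
      inner ℂ (polyVec p) (polyVec (truncPoly d p.natDegree * s)) := by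
  set N := p.natDegree
  have hp : p = ∑ k ∈ p.support, Polynomial.monomial k (p.coeff k) := p.as_sum_support
  rw [hp]
  simp only [map_sum, sum_inner]
  exact Finset.sum_congr rfl fun k hk =>
    inner_coanalyticToeplitz_monomial d (Polynomial.le_natDegree_of_mem_supp k hk) _ s

theorem norm_polyVec_truncPoly_le {d : ℕ → ℂ} (hd : Summable fun n => ‖d n‖ ^ 2) (N : ℕ) :
    ‖polyVec (truncPoly d N)‖ ≤ √(∑' n, ‖d n‖ ^ 2) := by
  refine Real.le_sqrt_of_sq_le ?_
  rw [norm_hardySeq_sq]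
  refine (memℓp_two_iff.1 (lp.memℓp _)).tsum_le_tsum (fun n => ?_) hd
  rw [polyVec_apply, coeff_truncPoly]
  split_ifs
  · rfl
  · simp

theorem HankelBound.norm_coanalyticToeplitz_le {p : Polynomial ℂ} {C : ℝ} (h : HankelBound p C)
    {d : ℕ → ℂ} (hd : Summable fun n => ‖d n‖ ^ 2) :
    ‖polyVec (coanalyticToeplitz d p)‖ ≤ C * √(∑' n, ‖d n‖ ^ 2) := by
  have hC := h.nonneg
  refine norm_le_of_norm_inner_self_le (𝕜 := ℂ) (by positivity) ?_
  calc ‖inner ℂ (polyVec (coanalyticToeplitz d p)) (polyVec (coanalyticToeplitz d p))‖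
      ≤ C * ‖polyVec (truncPoly d p.natDegree)‖ * ‖polyVec (coanalyticToeplitz d p)‖ := by
        rw [inner_coanalyticToeplitz]
        exact h _ _
    _ ≤ C * √(∑' n, ‖d n‖ ^ 2) * ‖polyVec (coanalyticToeplitz d p)‖ := by
        gcongr
        exact norm_polyVec_truncPoly_le hd _

theorem IsOuterPair.mem_of_hankelBound {a b : ℂ → ℂ} (h : IsOuterPair a b)
    (hφ : (fun z => b z / a z) ∈ hardyTwo) {f : ℂ → ℂ} {p : ℕ → Polynomial ℂ} {C : ℝ}
    (hp : ∀ n, HankelBound (p n) C)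
    (hf : ∀ z ∈ ball (0 : ℂ) 1, Tendsto (fun n => (p n).eval z) atTop (𝓝 (f z))) :
    f ∈ deBrangesRovnyak b := by
  obtain ⟨d, hd⟩ := exists_hasTaylor hφ.1
  have hs := hd.mem_hardyTwo_iff.1 hφ
  let F : ℕ → WithLp 2 (HardySeq × HardySeq) := fun n =>
    WithLp.toLp 2 (polyVec (p n), polyVec (coanalyticToeplitz d (p n)))
  have hbound : ∀ n, ‖F n‖ ≤ √(C ^ 2 + (C * √(∑' n, ‖d n‖ ^ 2)) ^ 2) := fun n => by
    refine Real.le_sqrt_of_sq_le ?_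
    rw [WithLp.prod_norm_sq_eq_of_L2]
    exact add_le_add (pow_le_pow_left₀ (norm_nonneg _) (hp n).norm_le 2)
      (pow_le_pow_left₀ (norm_nonneg _) ((hp n).norm_coanalyticToeplitz_le hs) 2)
  refine h.isKernelModel.mem_of_tendsto hbound fun z => ?_
  simp only [F, h.inner_modelVec_polyVec hd]
  exact hf z (unitDisc_mem_ball z)

/-! ### Subharmonicity through mean values over small circles -/

/-- A lower bound `c` for a quarter of the Laplacian of `v` at `z`, in the generalized sense of
mean values over small circles; `v` need not be differentiable. For smooth `v` the circular mean is
`v z + Δ v z / 4 * ρ ^ 2 + o(ρ ^ 2)`, and `Δ / 4 = ∂ ∂̄` makes `|h|²` have the bound `|h'|²`. -/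
def LaplacianGE (v : ℂ → ℝ) (z : ℂ) (c : ℝ) : Prop :=
  (∀ᶠ ρ in 𝓝[>] (0 : ℝ), CircleIntegrable v z ρ) ∧
    ∀ ε > 0, ∀ᶠ ρ in 𝓝[>] (0 : ℝ), v z + (c - ε) * ρ ^ 2 ≤ Real.circleAverage v z ρ

theorem eventually_sphere_subset {s : Set ℂ} {z : ℂ} (hs : s ∈ 𝓝 z) :
    ∀ᶠ ρ in 𝓝[>] (0 : ℝ), sphere z |ρ| ⊆ s := by
  obtain ⟨δ, hδ, hsub⟩ := Metric.mem_nhds_iff.1 hs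
  filter_upwards [Ioo_mem_nhdsGT hδ] with ρ hρ w hw
  refine hsub ?_
  rw [mem_ball, mem_sphere.1 hw, abs_of_pos hρ.1]
  exact hρ.2

theorem eventually_circleIntegrable {v : ℂ → ℝ} {s : Set ℂ} {z : ℂ} (hv : ContinuousOn v s)
    (hs : s ∈ 𝓝 z) : ∀ᶠ ρ in 𝓝[>] (0 : ℝ), CircleIntegrable v z ρ :=
  (eventually_sphere_subset hs).mono fun _ hρ => ContinuousOn.circleIntegrable' (hv.mono hρ)

namespace LaplacianGE

variable {v w : ℂ → ℝ} {z : ℂ} {c d : ℝ}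

theorem mono (h : LaplacianGE v z c) (hdc : d ≤ c) : LaplacianGE v z d :=
  ⟨h.1, fun ε hε => (h.2 ε hε).mono fun ρ hρ => le_trans (by gcongr) hρ⟩

theorem add (hv : LaplacianGE v z c) (hw : LaplacianGE w z d) :
    LaplacianGE (fun ζ => v ζ + w ζ) z (c + d) := by
  refine ⟨(hv.1.and hw.1).mono fun ρ h => h.1.add h.2, fun ε hε => ?_⟩
  filter_upwards [hv.1, hw.1, hv.2 (ε / 2) (by positivity), hw.2 (ε / 2) (by positivity)]
    with ρ hvi hwi hvρ hwρ
  rw [Real.circleAverage_fun_add hvi hwi]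
  linarith

theorem const_mul (h : LaplacianGE v z c) {k : ℝ} (hk : 0 ≤ k) :
    LaplacianGE (fun ζ => k * v ζ) z (k * c) := by
  refine ⟨h.1.mono fun ρ hρ => hρ.const_mul k, fun ε hε => ?_⟩
  filter_upwards [h.2 (ε / (k + 1)) (by positivity)] with ρ hρ
  have hεk : k * (ε / (k + 1)) ≤ ε := by
    rw [mul_div_left_comm]
    exact mul_le_of_le_one_right hε.le ((div_le_one (by positivity)).2 (by linarith))
  calc k * v z + (k * c - ε) * ρ ^ 2
      ≤ k * v z + (k * c - k * (ε / (k + 1))) * ρ ^ 2 := by gcongr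
    _ = k * (v z + (c - ε / (k + 1)) * ρ ^ 2) := by ring
    _ ≤ Real.circleAverage (fun ζ => k * v ζ) z ρ := by
        rw [circleAverage_const_mul]
        exact mul_le_mul_of_nonneg_left hρ hk

theorem of_le {s : Set ℂ} (h : LaplacianGE v z c) (hs : s ∈ 𝓝 z) (hw : ContinuousOn w s)
    (hvw : ∀ ζ ∈ s, v ζ ≤ w ζ) (hz : v z = w z) : LaplacianGE w z c := by
  have hwi := eventually_circleIntegrable hw hs
  refine ⟨hwi, fun ε hε => ?_⟩
  filter_upwards [h.1, hwi, h.2 ε hε, eventually_sphere_subset hs] with ρ hvρ hwρ hρ hsub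
  rw [← hz]
  exact hρ.trans (Real.circleAverage_mono hvρ hwρ fun ζ hζ => hvw ζ (hsub hζ))

theorem not_isMaxOn {s : Set ℂ} (h : LaplacianGE v z c) (hc : 0 < c) (hs : s ∈ 𝓝 z) :
    ¬ IsMaxOn v s z := by
  intro hmax
  obtain ⟨ρ, hvi, hρ, hsub, hpos⟩ := (h.1.and ((h.2 (c / 2) (by positivity)).and
    ((eventually_sphere_subset hs).and self_mem_nhdsWithin))).exists
  have hle := Real.circleAverage_mono_on_of_le_circle hvi fun ζ hζ => hmax (hsub hζ)
  have hρ2 : 0 < (c - c / 2) * ρ ^ 2 := mul_pos (by linarith) (pow_pos hpos 2)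
  linarith

end LaplacianGE

theorem circleAverage_re_of_differentiable {F : ℂ → ℂ} (hF : Differentiable ℂ F) {z : ℂ} {ρ : ℝ} :
    Real.circleAverage (fun w => (F w).re) z ρ = (F z).re := by
  rw [circleAverage_re (circleIntegrable_of_continuous hF.continuous),
    hF.diffContOnCl.circleAverage]

theorem re_conj_mul_self (w : ℂ) : (conj w * w).re = ‖w‖ ^ 2 := by
  rw [Complex.conj_mul', ← Complex.ofReal_pow, Complex.ofReal_re]

theorem continuous_dslope {F : ℂ → ℂ} (hF : Differentiable ℂ F) (z : ℂ) :
    Continuous (dslope F z) :=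
  continuousOn_univ.1 ((continuousOn_dslope univ_mem).2 ⟨hF.continuous.continuousOn, hF z⟩)

theorem circleAverage_re_conj_mul {P F : ℂ → ℂ} (hP : Differentiable ℂ P)
    (hF : Differentiable ℂ F) (z : ℂ) (ρ : ℝ) :
    Real.circleAverage (fun w => (conj (P w) * F w).re) z ρ = (conj (P z) * F z).re +
      ρ ^ 2 * Real.circleAverage (fun w => (conj (dslope P z w) * dslope F z w).re) z ρ := by
  have hPslope := continuous_dslope hP z
  have hFslope := continuous_dslope hF z
  have hPcont := hP.continuous
  have hFcont := hF.continuous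
  have hharm : Differentiable ℂ fun w =>
      conj (P z) * F w + conj (F z) * P w - conj (P z) * F z := by fun_prop
  have hsplit : ∀ w ∈ sphere z |ρ|, (conj (P w) * F w).re =
      (conj (P z) * F w + conj (F z) * P w - conj (P z) * F z).re +
        ρ ^ 2 * (conj (dslope P z w) * dslope F z w).re := fun w hw => by
    have hwz : conj (w - z) * (w - z) = ((ρ ^ 2 : ℝ) : ℂ) := by
      rw [Complex.conj_mul', mem_sphere_iff_norm.1 hw, ← Complex.ofReal_pow, sq_abs]
    have hprod : conj (P w - P z) * (F w - F z) =
        ((ρ ^ 2 : ℝ) : ℂ) * (conj (dslope P z w) * dslope F z w) := by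
      rw [← sub_smul_dslope P z w, ← sub_smul_dslope F z w, ← hwz, smul_eq_mul, smul_eq_mul,
        map_mul]
      ring
    rw [← Complex.re_ofReal_mul, ← hprod]
    simp only [map_sub, Complex.add_re, Complex.sub_re, Complex.mul_re, Complex.sub_im,
      Complex.conj_re, Complex.conj_im]
    ring
  rw [Real.circleAverage_congr_sphere hsplit, Real.circleAverage_fun_add
    (circleIntegrable_of_continuous (by fun_prop)) (circleIntegrable_of_continuous (by fun_prop)),
    circleAverage_re_of_differentiable hharm, circleAverage_const_mul]
  congr 1
  simp only [Complex.add_re, Complex.sub_re, Complex.mul_re, Complex.conj_re, Complex.conj_im]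
  ring

theorem laplacianGE_re_conj_mul {P F : ℂ → ℂ} (hP : Differentiable ℂ P) (hF : Differentiable ℂ F)
    (z : ℂ) :
    LaplacianGE (fun w => (conj (P w) * F w).re) z (conj (deriv P z) * deriv F z).re := by
  have hPF : Continuous fun w => (conj (P w) * F w).re :=
    Complex.continuous_re.comp
      ((Complex.continuous_conj.comp hP.continuous).mul hF.continuous)
  have hslope : Continuous fun w => (conj (dslope P z w) * dslope F z w).re :=
    Complex.continuous_re.comp ((Complex.continuous_conj.comp (continuous_dslope hP z)).mul
      (continuous_dslope hF z))
  refine ⟨Eventually.of_forall fun ρ => circleIntegrable_of_continuous hPF, fun ε hε => ?_⟩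
  have hlim := (Real.Continuous.circleAverage (c := z) hslope).tendsto 0
  rw [Real.circleAverage_zero, dslope_same, dslope_same] at hlim
  filter_upwards [(hlim.mono_left nhdsWithin_le_nhds).eventually_const_lt (sub_lt_self _ hε)]
    with ρ hρ
  rw [circleAverage_re_conj_mul hP hF, mul_comm (ρ ^ 2)]
  gcongr

theorem laplacianGE_re {F : ℂ → ℂ} (hF : Differentiable ℂ F) (z : ℂ) :
    LaplacianGE (fun w => (F w).re) z 0 := by
  simpa using laplacianGE_re_conj_mul (differentiable_const (1 : ℂ)) hF z

theorem laplacianGE_norm_sq {h : ℂ → ℂ} (hh : Differentiable ℂ h) (z : ℂ) :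
    LaplacianGE (fun w => ‖h w‖ ^ 2) z (‖deriv h z‖ ^ 2) := by
  simpa only [re_conj_mul_self] using laplacianGE_re_conj_mul hh hh z

theorem laplacianGE_neg_norm_pow_four {g : ℂ → ℂ} (hg : Differentiable ℂ g) (z : ℂ) :
    LaplacianGE (fun w => -‖g w‖ ^ 4) z (-(4 * ‖g z‖ ^ 2 * ‖deriv g z‖ ^ 2)) := by
  convert laplacianGE_re_conj_mul (hg.pow 2).neg (hg.pow 2) z using 1
  · ext w
    simp only [Pi.neg_apply, Pi.pow_apply, map_neg, neg_mul, Complex.neg_re, re_conj_mul_self,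
      norm_pow]
    ring
  · rw [deriv.neg, deriv_pow (hg z)]
    simp only [map_neg, neg_mul, Complex.neg_re, re_conj_mul_self, norm_mul, norm_pow,
      Complex.norm_natCast]
    push_cast
    ring

/-! ### A maximum principle for Poisson integrals -/

theorem exists_polynomial_eq_of_mem_span_fourier {T : ℝ} {f : C(AddCircle T, ℂ)}
    (hf : f ∈ Submodule.span ℂ (Set.range (@fourier T))) :
    ∃ q r : Polynomial ℂ, ∀ x : AddCircle T,
      f x = q.eval (x.toCircle : ℂ) + conj (r.eval (x.toCircle : ℂ)) := by
  induction hf using Submodule.span_induction with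
  | mem f hf =>
    obtain ⟨n, rfl⟩ := hf
    rcases Int.eq_nat_or_neg n with ⟨m, rfl | rfl⟩
    · exact ⟨Polynomial.X ^ m, 0, fun x => by simp [fourier_apply, AddCircle.toCircle_nsmul]⟩
    · refine ⟨0, Polynomial.X ^ m, fun x => ?_⟩
      rw [fourier_neg, fourier_apply]
      simp [AddCircle.toCircle_nsmul]
  | zero => exact ⟨0, 0, by simp⟩
  | add f g _ _ hf hg =>
    obtain ⟨q₁, r₁, hf⟩ := hf
    obtain ⟨q₂, r₂, hg⟩ := hg
    refine ⟨q₁ + q₂, r₁ + r₂, fun x => ?_⟩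
    simp only [ContinuousMap.add_apply, hf, hg, Polynomial.eval_add, map_add]
    ring
  | smul c f _ hf =>
    obtain ⟨q, r, hf⟩ := hf
    refine ⟨c • q, conj c • r, fun x => ?_⟩
    simp only [ContinuousMap.smul_apply, hf, Polynomial.eval_smul, smul_eq_mul, map_mul,
      Complex.conj_conj]
    ring

theorem exists_polynomial_abs_sub_re_eval_lt {v : ℂ → ℝ} (hv : ContinuousOn v (sphere 0 1))
    {ε : ℝ} (hε : 0 < ε) :
    ∃ q : Polynomial ℂ, ∀ ζ ∈ sphere (0 : ℂ) 1, |v ζ - (q.eval ζ).re| < ε := by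
  have : Fact (0 < 2 * Real.pi) := ⟨Real.two_pi_pos⟩
  let V : C(AddCircle (2 * Real.pi), ℂ) := ⟨fun x => (v (x.toCircle : ℂ) : ℂ),
    Complex.continuous_ofReal.comp (hv.comp_continuous
      (continuous_subtype_val.comp AddCircle.continuous_toCircle) fun x =>
        mem_sphere_zero_iff_norm.2 (Circle.norm_coe _))⟩
  have hV : V ∈ (Submodule.span ℂ (Set.range (@fourier (2 * Real.pi)))).topologicalClosure := by
    rw [span_fourier_closure_eq_top]
    trivial
  obtain ⟨g, hg, hVg⟩ := Metric.mem_closure_iff.1 hV ε hε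
  obtain ⟨q, r, hqr⟩ := exists_polynomial_eq_of_mem_span_fourier hg
  refine ⟨q + r, fun ζ hζ => ?_⟩
  obtain ⟨x, hx⟩ := (AddCircle.homeomorphCircle Real.two_pi_pos.ne').surjective
    ⟨ζ, mem_sphere_zero_iff_norm.2 (by simpa using hζ)⟩
  rw [AddCircle.homeomorphCircle_apply] at hx
  have hxζ : (x.toCircle : ℂ) = ζ := congrArg Subtype.val hx
  have hre : v ζ - ((q + r).eval ζ).re = (V x - g x).re := by
    simp [V, hqr, hxζ]
  calc |v ζ - ((q + r).eval ζ).re| ≤ ‖V x - g x‖ := hre ▸ Complex.abs_re_le_norm _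
    _ ≤ dist V g := (dist_eq_norm (V x) (g x)).symm.trans_le (ContinuousMap.dist_apply_le_dist x)
    _ < ε := hVg

theorem exists_isMaxOn_closedBall_mem_sphere {v : ℂ → ℝ} (hv : ContinuousOn v (closedBall 0 1))
    {c : ℝ} (hc : 0 < c) (hpos : ∀ z ∈ ball (0 : ℂ) 1, LaplacianGE v z c) :
    ∃ z ∈ sphere (0 : ℂ) 1, IsMaxOn v (closedBall 0 1) z := by
  obtain ⟨z, hz, hmax⟩ := (isCompact_closedBall (0 : ℂ) 1).exists_isMaxOn ⟨0, by simp⟩ hv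
  rw [← ball_union_sphere] at hz
  refine ⟨z, hz.resolve_left fun hzb => ?_, hmax⟩
  exact (hpos z hzb).not_isMaxOn hc (closedBall_mem_nhds_of_mem hzb) hmax

theorem le_poissonMean {v : ℂ → ℝ} (hv : ContinuousOn v (closedBall 0 1))
    (hsub : ∀ z ∈ ball (0 : ℂ) 1, LaplacianGE v z 0) {lam : ℂ} (hl : lam ∈ ball (0 : ℂ) 1) :
    v lam ≤ poissonMean lam v := by
  have hvs : ContinuousOn v (sphere 0 1) := hv.mono sphere_subset_closedBall
  have hvi : CircleIntegrable v 0 1 := ContinuousOn.circleIntegrable' (by simpa using hvs)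
  refine le_of_forall_pos_le_add fun ε hε => ?_
  obtain ⟨η, hη, rfl⟩ : ∃ η, 0 < η ∧ ε = 3 * η := ⟨ε / 3, by positivity, by ring⟩
  obtain ⟨q, hq⟩ := exists_polynomial_abs_sub_re_eval_lt hvs hη
  -- Subtracting a harmonic function close to `v` on the circle leaves a function that is small
  -- there; the quadratic term makes its Laplacian positive, so the maximum is on the circle.
  have hqc : ContinuousOn (fun z => (-q.eval z).re) (closedBall 0 1) := by fun_prop
  have hnorm : ContinuousOn (fun z : ℂ => η * ‖z‖ ^ 2) (closedBall 0 1) := by fun_prop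
  obtain ⟨z₀, hz₀, hmax⟩ := exists_isMaxOn_closedBall_mem_sphere
    (v := fun z => v z + (-q.eval z).re + η * ‖z‖ ^ 2) ((hv.add hqc).add hnorm) hη fun z hz => by
      simpa using ((hsub z hz).add (laplacianGE_re q.differentiable.neg z)).add
        ((laplacianGE_norm_sq differentiable_id z).const_mul hη.le)
  have hbound : v lam - (q.eval lam).re ≤ 2 * η := by
    have hmaxl := hmax (ball_subset_closedBall hl)
    simp only [Set.mem_ofPred_eq, mem_sphere_zero_iff_norm.1 hz₀, Complex.neg_re] at hmaxl
    nlinarith [(abs_lt.1 (hq z₀ hz₀)).2, mul_nonneg hη.le (sq_nonneg ‖lam‖)]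
  have hpoisson : (q.eval lam).re ≤ poissonMean lam v + η := by
    rw [← poissonMean_re hl q.differentiable, ← poissonMean_const hl η,
      ← poissonMean_add hl hvi (circleIntegrable_const _ _ _)]
    refine poissonMean_mono hl
      (circleIntegrable_of_continuous (Complex.continuous_re.comp q.continuous))
      (hvi.add (circleIntegrable_const _ _ _)) fun ζ hζ => ?_
    linarith [(abs_lt.1 (hq ζ hζ)).1]
  linarith

/-! ### The harmonic majorant of the squared modulus of a polynomial -/

theorem exists_polynomial_re_eq_norm_sq (p : Polynomial ℂ) :
    ∃ U : Polynomial ℂ, ∀ ζ ∈ sphere (0 : ℂ) 1, (U.eval ζ).re = ‖p.eval ζ‖ ^ 2 := by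
  classical
  refine ⟨∑ j ∈ p.support, ∑ k ∈ p.support, if k ≤ j then
    Polynomial.monomial (j - k) (p.coeff j * conj (p.coeff k)) else
    Polynomial.monomial (k - j) (p.coeff k * conj (p.coeff j)), fun ζ hζ => ?_⟩
  have hunit : ζ * conj ζ = 1 := by
    rw [Complex.mul_conj', mem_sphere_zero_iff_norm.1 hζ]
    simp
  have hpow_sub : ∀ j k : ℕ, k ≤ j → ζ ^ (j - k) = ζ ^ j * conj ζ ^ k := fun j k hkj => by
    obtain ⟨i, rfl⟩ := Nat.exists_eq_add_of_le hkj
    rw [Nat.add_sub_cancel_left, pow_add, mul_right_comm, ← mul_pow, hunit]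
    simp
  rw [← re_conj_mul_self, show p.eval ζ = ∑ j ∈ p.support, p.coeff j * ζ ^ j from
    Polynomial.eval_eq_sum, map_sum, Finset.sum_mul_sum]
  simp only [Polynomial.eval_finsetSum, Complex.re_sum]
  refine Finset.sum_congr rfl fun j _ => Finset.sum_congr rfl fun k _ => ?_
  split_ifs with h
  · rw [Polynomial.eval_monomial, hpow_sub j k h,
      ← Complex.conj_re (conj (p.coeff j * ζ ^ j) * _)]
    simp only [map_mul, map_pow, Complex.conj_conj]
    ring_nf
  · rw [Polynomial.eval_monomial, hpow_sub k j (not_le.1 h).le]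
    simp only [map_mul, map_pow]
    ring_nf

/-- The difference between the harmonic function `Re U` and the subharmonic function `|p|²`. When
the two agree on the unit circle, its value at `z` is the variance of `p` with respect to the
Poisson kernel at `z`. -/
noncomputable def subharmonicDefect (U p : Polynomial ℂ) (z : ℂ) : ℝ :=
  (U.eval z).re - ‖p.eval z‖ ^ 2

section Defect

variable {U p : Polynomial ℂ} {z : ℂ}

theorem continuous_subharmonicDefect (U p : Polynomial ℂ) :
    Continuous (subharmonicDefect U p) :=
  (Complex.continuous_re.comp U.continuous).sub (p.continuous.norm.pow 2)

theorem subharmonicDefect_of_mem_sphere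
    (hU : ∀ ζ ∈ sphere (0 : ℂ) 1, (U.eval ζ).re = ‖p.eval ζ‖ ^ 2) (hz : z ∈ sphere (0 : ℂ) 1) :
    subharmonicDefect U p z = 0 := by
  rw [subharmonicDefect, hU z hz, sub_self]

theorem subharmonicDefect_eq_poissonMean
    (hU : ∀ ζ ∈ sphere (0 : ℂ) 1, (U.eval ζ).re = ‖p.eval ζ‖ ^ 2) (hz : z ∈ ball (0 : ℂ) 1) :
    subharmonicDefect U p z = poissonMean z fun ζ => ‖p.eval ζ - p.eval z‖ ^ 2 := by
  have hexpand : ∀ ζ ∈ sphere (0 : ℂ) 1, ‖p.eval ζ - p.eval z‖ ^ 2 =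
      (U.eval ζ - 2 * conj (p.eval z) * p.eval ζ + conj (p.eval z) * p.eval z).re := fun ζ hζ => by
    rw [Complex.add_re, Complex.sub_re, hU ζ hζ]
    simp only [← re_conj_mul_self, Complex.mul_re, Complex.sub_re, Complex.sub_im, Complex.conj_re,
      Complex.conj_im, Complex.mul_im, map_sub, Complex.re_ofNat, Complex.im_ofNat]
    ring
  have hd : Differentiable ℂ fun ζ =>
      U.eval ζ - 2 * conj (p.eval z) * p.eval ζ + conj (p.eval z) * p.eval z :=
    (U.differentiable.sub (p.differentiable.const_mul _)).add_const _
  rw [poissonMean_congr hexpand, poissonMean_re hz hd, subharmonicDefect, ← re_conj_mul_self]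
  simp only [Complex.mul_re, Complex.sub_re, Complex.add_re, Complex.conj_re, Complex.conj_im,
    Complex.mul_im, Complex.re_ofNat, Complex.im_ofNat]
  ring

theorem subharmonicDefect_nonneg
    (hU : ∀ ζ ∈ sphere (0 : ℂ) 1, (U.eval ζ).re = ‖p.eval ζ‖ ^ 2)
    (hz : z ∈ closedBall (0 : ℂ) 1) : 0 ≤ subharmonicDefect U p z := by
  rw [← ball_union_sphere] at hz
  rcases hz with hz | hz
  · rw [subharmonicDefect_eq_poissonMean hU hz]
    exact poissonMean_nonneg hz fun _ _ => by positivity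
  · rw [subharmonicDefect_of_mem_sphere hU hz]

theorem laplacianGE_neg_subharmonicDefect (U p : Polynomial ℂ) (z : ℂ) :
    LaplacianGE (fun w => -subharmonicDefect U p w) z (‖p.derivative.eval z‖ ^ 2) := by
  simpa [subharmonicDefect, sub_eq_add_neg, add_comm] using
    (laplacianGE_re U.differentiable.neg z).add (laplacianGE_norm_sq p.differentiable z)

variable {s : ℝ}

theorem sq_add_subharmonicDefect_pos (hs : 0 < s)
    (hU : ∀ ζ ∈ sphere (0 : ℂ) 1, (U.eval ζ).re = ‖p.eval ζ‖ ^ 2)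
    (hz : z ∈ closedBall (0 : ℂ) 1) : 0 < s ^ 2 + subharmonicDefect U p z :=
  add_pos_of_pos_of_nonneg (by positivity) (subharmonicDefect_nonneg hU hz)

theorem continuousOn_norm_sq_div (hs : 0 < s)
    (hU : ∀ ζ ∈ sphere (0 : ℂ) 1, (U.eval ζ).re = ‖p.eval ζ‖ ^ 2) {h : ℂ → ℂ}
    (hh : Continuous h) :
    ContinuousOn (fun w => ‖h w‖ ^ 2 / (s ^ 2 + subharmonicDefect U p w)) (closedBall 0 1) :=
  ContinuousOn.div (hh.norm.pow 2).continuousOn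
    (continuous_const.add (continuous_subharmonicDefect U p)).continuousOn
    fun _ hz => (sq_add_subharmonicDefect_pos hs hU hz).ne'

theorem sub_le_norm_sq_div (x y : ℂ) {s t : ℝ} (hs : 0 < s) (ht : 0 < t) :
    2 / s * (conj x * y).re - ‖x‖ ^ 2 / s ^ 2 * t ≤ ‖y‖ ^ 2 / t := by
  have hre : (conj x * y).re ≤ ‖x‖ * ‖y‖ := by
    simpa using Complex.re_le_norm (conj x * y)
  have hsq : t * (‖y‖ / t - ‖x‖ / s) ^ 2 =
      ‖y‖ ^ 2 / t - 2 / s * (‖x‖ * ‖y‖) + ‖x‖ ^ 2 / s ^ 2 * t := by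
    field_simp
    ring
  have hnonneg : 0 ≤ t * (‖y‖ / t - ‖x‖ / s) ^ 2 := by positivity
  have hmul := mul_le_mul_of_nonneg_left hre (show 0 ≤ 2 / s by positivity)
  linarith

theorem laplacianGE_norm_sq_div (hs : 0 < s)
    (hU : ∀ ζ ∈ sphere (0 : ℂ) 1, (U.eval ζ).re = ‖p.eval ζ‖ ^ 2)
    (hds : ∀ w ∈ closedBall (0 : ℂ) 1, subharmonicDefect U p w ≤ s ^ 2) {h : ℂ → ℂ}
    (hh : Differentiable ℂ h) (hz : z ∈ ball (0 : ℂ) 1) :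
    LaplacianGE (fun w => ‖h w‖ ^ 2 / (s ^ 2 + subharmonicDefect U p w)) z
      (‖h z‖ ^ 2 * ‖p.derivative.eval z‖ ^ 2 / (4 * s ^ 4)) := by
  have hz' := ball_subset_closedBall hz
  have ht := sq_add_subharmonicDefect_pos hs hU hz'
  have hts : s ^ 2 + subharmonicDefect U p z ≤ 2 * s ^ 2 := by linarith [hds z hz']
  set t := s ^ 2 + subharmonicDefect U p z with ht_def
  set k := ‖h z‖ ^ 2 / t ^ 2 with hk
  have hbound : ‖h z‖ ^ 2 * ‖p.derivative.eval z‖ ^ 2 / (4 * s ^ 4) ≤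
      k * ‖p.derivative.eval z‖ ^ 2 := by
    rw [hk, div_mul_eq_mul_div]
    gcongr
    calc t ^ 2 ≤ (2 * s ^ 2) ^ 2 := by gcongr
      _ = 4 * s ^ 4 := by ring
  -- Convexity of `(x, t) ↦ |x|² / t` supplies a minorant touching at `z`.
  have hminorant := (laplacianGE_re ((hh.const_mul (2 / t * conj (h z))).sub_const (k * s ^ 2))
    z).add ((laplacianGE_neg_subharmonicDefect U p z).const_mul (k := k) (by positivity))
  rw [zero_add] at hminorant
  have heq : ∀ w, (2 / (t : ℂ) * conj (h z) * h w - k * s ^ 2).re +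
      k * -subharmonicDefect U p w =
        2 / t * (conj (h z) * h w).re - k * (s ^ 2 + subharmonicDefect U p w) := fun w => by
    rw [show 2 / (t : ℂ) * conj (h z) * h w = ((2 / t : ℝ) : ℂ) * (conj (h z) * h w) by
      push_cast; ring, Complex.sub_re, Complex.re_ofReal_mul, ← Complex.ofReal_pow,
      ← Complex.ofReal_mul, Complex.ofReal_re]
    ring
  simp only [heq] at hminorant
  refine (hminorant.of_le (closedBall_mem_nhds_of_mem hz) (continuousOn_norm_sq_div hs hU
    hh.continuous) (fun w hw => ?_) ?_).mono hbound
  · exact sub_le_norm_sq_div _ _ ht (sq_add_subharmonicDefect_pos hs hU hw)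
  · rw [← ht_def, re_conj_mul_self, hk]
    field_simp
    ring

/-! ### Polynomials with bounded mean oscillation define bounded Hankel forms -/

theorem poissonMean_norm_pow_four_le (hs : 0 < s)
    (hU : ∀ ζ ∈ sphere (0 : ℂ) 1, (U.eval ζ).re = ‖p.eval ζ‖ ^ 2)
    (hds : ∀ w ∈ closedBall (0 : ℂ) 1, subharmonicDefect U p w ≤ s ^ 2)
    (hz : z ∈ ball (0 : ℂ) 1) :
    poissonMean z (fun ζ => ‖p.eval ζ - p.eval z‖ ^ 4) ≤
      16 * s ^ 2 * poissonMean z fun ζ => ‖p.eval ζ - p.eval z‖ ^ 2 := by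
  have hg : Differentiable ℂ fun w => p.eval w - p.eval z := p.differentiable.sub_const _
  have hderiv : ∀ w, deriv (fun w => p.eval w - p.eval z) w = p.derivative.eval w := by simp
  have hnorm : Continuous fun w => ‖p.eval w - p.eval z‖ := hg.continuous.norm
  have hle := le_poissonMean (v := fun w => 16 * s ^ 4 * (‖p.eval w - p.eval z‖ ^ 2 /
      (s ^ 2 + subharmonicDefect U p w)) + -‖p.eval w - p.eval z‖ ^ 4)
    ((continuousOn_const.mul (continuousOn_norm_sq_div hs hU hg.continuous)).add
      (hnorm.pow 4).neg.continuousOn) (fun w hw => by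
        refine (((laplacianGE_norm_sq_div hs hU hds hg hw).const_mul
          (k := 16 * s ^ 4) (by positivity)).add (laplacianGE_neg_norm_pow_four hg w)).mono ?_
        rw [hderiv]
        refine le_of_eq ?_
        field_simp
        ring) hz
  have hcircle : ∀ ζ ∈ sphere (0 : ℂ) 1, 16 * s ^ 4 * (‖p.eval ζ - p.eval z‖ ^ 2 /
      (s ^ 2 + subharmonicDefect U p ζ)) + -‖p.eval ζ - p.eval z‖ ^ 4 =
        16 * s ^ 2 * ‖p.eval ζ - p.eval z‖ ^ 2 + -1 * ‖p.eval ζ - p.eval z‖ ^ 4 := fun ζ hζ => by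
    rw [subharmonicDefect_of_mem_sphere hU hζ]
    field_simp
    ring
  have hsq : Continuous fun w => 16 * s ^ 2 * ‖p.eval w - p.eval z‖ ^ 2 :=
    continuous_const.mul (hnorm.pow 2)
  have hquart : Continuous fun w => -1 * ‖p.eval w - p.eval z‖ ^ 4 :=
    continuous_const.mul (hnorm.pow 4)
  rw [poissonMean_congr hcircle, poissonMean_add hz (circleIntegrable_of_continuous hsq)
    (circleIntegrable_of_continuous hquart), poissonMean_const_mul, poissonMean_const_mul,
    sub_self] at hle
  norm_num at hle
  linarith

theorem sq_le_mul_add_pow_four {s t : ℝ} (hs : 0 < s) (ht : 0 ≤ t) :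
    t ^ 2 ≤ 8 * s * t + 1 / (64 * s ^ 2) * t ^ 4 := by
  have hpow : 1 / (64 * s ^ 2) * t ^ 4 = t ^ 2 * (t / (8 * s)) ^ 2 := by
    field_simp
    ring
  rw [hpow]
  rcases le_total t (8 * s) with h | h
  · have hnonneg : 0 ≤ t ^ 2 * (t / (8 * s)) ^ 2 := by positivity
    nlinarith
  · have hone : 1 ≤ (t / (8 * s)) ^ 2 := one_le_pow₀ ((one_le_div (by positivity)).2 h)
    have hnonneg : 0 ≤ 8 * s * t := by positivity
    nlinarith [mul_le_mul_of_nonneg_left hone (sq_nonneg t)]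

variable {N : ℝ}

theorem subharmonicDefect_le_mul (hs : 0 < s)
    (hU : ∀ ζ ∈ sphere (0 : ℂ) 1, (U.eval ζ).re = ‖p.eval ζ‖ ^ 2)
    (hds : ∀ w ∈ closedBall (0 : ℂ) 1, subharmonicDefect U p w ≤ s ^ 2)
    (hz : z ∈ ball (0 : ℂ) 1) (hN : poissonMean z (fun ζ => ‖p.eval ζ - p.eval z‖) ≤ N) :
    subharmonicDefect U p z ≤ 12 * s * N := by
  have hnorm : Continuous fun ζ => ‖p.eval ζ - p.eval z‖ :=
    (p.continuous.sub continuous_const).norm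
  have hsplit : poissonMean z (fun ζ => ‖p.eval ζ - p.eval z‖ ^ 2) ≤
      8 * s * poissonMean z (fun ζ => ‖p.eval ζ - p.eval z‖) +
        1 / (64 * s ^ 2) * poissonMean z fun ζ => ‖p.eval ζ - p.eval z‖ ^ 4 := by
    have hlin : Continuous fun ζ => 8 * s * ‖p.eval ζ - p.eval z‖ := continuous_const.mul hnorm
    have hquart : Continuous fun ζ => 1 / (64 * s ^ 2) * ‖p.eval ζ - p.eval z‖ ^ 4 :=
      continuous_const.mul (hnorm.pow 4)
    rw [← poissonMean_const_mul, ← poissonMean_const_mul, ← poissonMean_add hz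
      (circleIntegrable_of_continuous hlin) (circleIntegrable_of_continuous hquart)]
    exact poissonMean_mono hz (circleIntegrable_of_continuous (hnorm.pow 2))
      (circleIntegrable_of_continuous (hlin.add hquart))
      fun _ _ => sq_le_mul_add_pow_four hs (norm_nonneg _)
  have hquart := mul_le_mul_of_nonneg_left (poissonMean_norm_pow_four_le hs hU hds hz)
    (show 0 ≤ 1 / (64 * s ^ 2) by positivity)
  have hcancel : 1 / (64 * s ^ 2) * (16 * s ^ 2 * subharmonicDefect U p z) =
      1 / 4 * subharmonicDefect U p z := by
    field_simp
    ring
  have hlin := mul_le_mul_of_nonneg_left hN (show 0 ≤ 8 * s by positivity)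
  have hnonneg : 0 ≤ s * N := mul_nonneg hs.le
    ((poissonMean_nonneg hz fun _ _ => norm_nonneg _).trans hN)
  rw [← subharmonicDefect_eq_poissonMean hU hz] at hquart hsplit
  linarith

theorem subharmonicDefect_le_of_poissonMean_le
    (hU : ∀ ζ ∈ sphere (0 : ℂ) 1, (U.eval ζ).re = ‖p.eval ζ‖ ^ 2)
    (hN : ∀ w ∈ ball (0 : ℂ) 1, poissonMean w (fun ζ => ‖p.eval ζ - p.eval w‖) ≤ N)
    (hz : z ∈ closedBall (0 : ℂ) 1) : subharmonicDefect U p z ≤ (12 * N) ^ 2 := by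
  obtain ⟨z₀, hz₀, hmax⟩ := (isCompact_closedBall (0 : ℂ) 1).exists_isMaxOn ⟨0, by simp⟩
    (continuous_subharmonicDefect U p).continuousOn
  refine (hmax hz).trans ?_
  rcases le_or_gt (subharmonicDefect U p z₀) 0 with h | h
  · exact h.trans (by positivity)
  have hb : z₀ ∈ ball (0 : ℂ) 1 := by
    rw [← ball_union_sphere] at hz₀
    exact hz₀.resolve_right fun hs => h.ne' (subharmonicDefect_of_mem_sphere hU hs)
  have hs : 0 < √(subharmonicDefect U p z₀) := Real.sqrt_pos.2 h
  have hsq := Real.sq_sqrt h.le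
  have hmul := subharmonicDefect_le_mul hs hU (fun w hw => (hmax hw).trans_eq hsq.symm) hb
    (hN z₀ hb)
  have hle : √(subharmonicDefect U p z₀) ≤ 12 * N :=
    le_of_mul_le_mul_left (by linarith) hs
  rw [← hsq]
  gcongr

theorem poissonMean_zero (v : ℂ → ℝ) : poissonMean 0 v = Real.circleAverage v 0 1 :=
  Real.circleAverage_congr_sphere fun ζ hζ => by
    have hnorm : ‖ζ‖ = 1 := by simpa using hζ
    simp [poissonKernel, hnorm]

/-- The majorant of a Hankel form: with `s ^ 2` a bound for the defect of `p`, its Laplacian at `z`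
dominates `s |q'|² + |q|² |p'|² / (4 s)`. -/
noncomputable def hankelMajorant (U p : Polynomial ℂ) (s : ℝ) (q : Polynomial ℂ) (w : ℂ) : ℝ :=
  s * ‖q.eval w‖ ^ 2 + s ^ 3 * (‖q.eval w‖ ^ 2 / (s ^ 2 + subharmonicDefect U p w))

theorem continuousOn_hankelMajorant (hs : 0 < s)
    (hU : ∀ ζ ∈ sphere (0 : ℂ) 1, (U.eval ζ).re = ‖p.eval ζ‖ ^ 2) (q : Polynomial ℂ) :
    ContinuousOn (hankelMajorant U p s q) (closedBall 0 1) :=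
  (continuous_const.mul (q.continuous.norm.pow 2)).continuousOn.add
    (continuousOn_const.mul (continuousOn_norm_sq_div hs hU q.continuous))

theorem laplacianGE_hankelMajorant (hs : 0 < s)
    (hU : ∀ ζ ∈ sphere (0 : ℂ) 1, (U.eval ζ).re = ‖p.eval ζ‖ ^ 2)
    (hds : ∀ w ∈ closedBall (0 : ℂ) 1, subharmonicDefect U p w ≤ s ^ 2) (q : Polynomial ℂ)
    (hz : z ∈ ball (0 : ℂ) 1) :
    LaplacianGE (hankelMajorant U p s q) z
      (s * ‖q.derivative.eval z‖ ^ 2 + ‖q.eval z‖ ^ 2 * ‖p.derivative.eval z‖ ^ 2 / (4 * s)) := by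
  refine (((laplacianGE_norm_sq q.differentiable z).const_mul hs.le).add
    ((laplacianGE_norm_sq_div hs hU hds q.differentiable hz).const_mul
      (k := s ^ 3) (by positivity))).mono (le_of_eq ?_)
  rw [Polynomial.deriv]
  field_simp

theorem hankelMajorant_nonneg (hs : 0 < s)
    (hU : ∀ ζ ∈ sphere (0 : ℂ) 1, (U.eval ζ).re = ‖p.eval ζ‖ ^ 2) (q : Polynomial ℂ)
    (hz : z ∈ closedBall (0 : ℂ) 1) : 0 ≤ hankelMajorant U p s q z := by
  have hpos := sq_add_subharmonicDefect_pos hs hU hz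
  unfold hankelMajorant
  positivity

theorem circleAverage_hankelMajorant (hs : 0 < s)
    (hU : ∀ ζ ∈ sphere (0 : ℂ) 1, (U.eval ζ).re = ‖p.eval ζ‖ ^ 2) (q : Polynomial ℂ) :
    Real.circleAverage (hankelMajorant U p s q) 0 1 = 2 * s * ‖polyVec q‖ ^ 2 := by
  rw [norm_polyVec_sq, ← circleAverage_const_mul]
  refine Real.circleAverage_congr_sphere fun ζ hζ => ?_
  rw [hankelMajorant, subharmonicDefect_of_mem_sphere hU (by simpa using hζ)]
  field_simp
  ring

theorem neg_re_conj_mul_add_le (x u v y w : ℂ) (hs : 0 < s) :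
    -(conj x * (u * y + v * w)).re ≤ s * ‖u‖ ^ 2 + ‖v‖ ^ 2 * ‖x‖ ^ 2 / (4 * s) +
      (s * ‖w‖ ^ 2 + ‖y‖ ^ 2 * ‖x‖ ^ 2 / (4 * s)) := by
  have hamgm : ∀ a b : ℝ, a * b ≤ s * a ^ 2 + b ^ 2 / (4 * s) := fun a b => by
    have hsq : s * a ^ 2 + b ^ 2 / (4 * s) - a * b = (2 * s * a - b) ^ 2 / (4 * s) := by
      field_simp
      ring
    have hnonneg : 0 ≤ (2 * s * a - b) ^ 2 / (4 * s) := by positivity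
    linarith
  calc -(conj x * (u * y + v * w)).re ≤ ‖conj x * (u * y + v * w)‖ :=
        (neg_le_abs _).trans (Complex.abs_re_le_norm _)
    _ ≤ ‖x‖ * (‖u‖ * ‖y‖ + ‖v‖ * ‖w‖) := by
        rw [norm_mul, Complex.norm_conj]
        gcongr
        simpa only [norm_mul] using norm_add_le (u * y) (v * w)
    _ = ‖u‖ * (‖y‖ * ‖x‖) + ‖w‖ * (‖v‖ * ‖x‖) := by ring
    _ ≤ _ := by
        rw [← mul_pow, ← mul_pow]
        linarith [hamgm (‖u‖) (‖y‖ * ‖x‖), hamgm (‖w‖) (‖v‖ * ‖x‖)]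

theorem laplacianGE_re_conj_mul_mul (p g h : Polynomial ℂ) (z : ℂ) (hs : 0 < s) :
    LaplacianGE (fun w => (conj (p.eval w) * (g * h).eval w).re) z
      (-(s * ‖g.derivative.eval z‖ ^ 2 +
          ‖g.eval z‖ ^ 2 * ‖p.derivative.eval z‖ ^ 2 / (4 * s) +
        (s * ‖h.derivative.eval z‖ ^ 2 +
          ‖h.eval z‖ ^ 2 * ‖p.derivative.eval z‖ ^ 2 / (4 * s)))) := by
  refine (laplacianGE_re_conj_mul p.differentiable (g * h).differentiable z).mono (neg_le.1 ?_)
  rw [Polynomial.deriv, Polynomial.deriv, Polynomial.derivative_mul, Polynomial.eval_add,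
    Polynomial.eval_mul, Polynomial.eval_mul]
  exact neg_re_conj_mul_add_le _ _ _ _ _ hs

theorem neg_re_inner_polyVec_mul_le (hs : 0 < s)
    (hU : ∀ ζ ∈ sphere (0 : ℂ) 1, (U.eval ζ).re = ‖p.eval ζ‖ ^ 2)
    (hds : ∀ w ∈ closedBall (0 : ℂ) 1, subharmonicDefect U p w ≤ s ^ 2) (hp : p.eval 0 = 0)
    (g h : Polynomial ℂ) :
    -(inner ℂ (polyVec p) (polyVec (g * h))).re ≤
      2 * s * (‖polyVec g‖ ^ 2 + ‖polyVec h‖ ^ 2) := by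
  have hform : Continuous fun w => conj (p.eval w) * (g * h).eval w :=
    (Complex.continuous_conj.comp p.continuous).mul (g * h).continuous
  have hmaj := continuousOn_hankelMajorant hs hU
  have hint : ∀ q, CircleIntegrable (hankelMajorant U p s q) 0 1 := fun q =>
    ContinuousOn.circleIntegrable' ((hmaj q).mono (by simpa using sphere_subset_closedBall))
  have hre : Continuous fun w => (conj (p.eval w) * (g * h).eval w).re :=
    Complex.continuous_re.comp hform
  have hsum : CircleIntegrable
      (fun w => hankelMajorant U p s g w + hankelMajorant U p s h w) 0 1 := (hint g).add (hint h)
  have hle := le_poissonMean (v := fun w => (conj (p.eval w) * (g * h).eval w).re +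
      (hankelMajorant U p s g w + hankelMajorant U p s h w))
    (hre.continuousOn.add ((hmaj g).add (hmaj h))) (fun z hz => by
      refine ((laplacianGE_re_conj_mul_mul p g h z hs).add
        ((laplacianGE_hankelMajorant hs hU hds g hz).add
          (laplacianGE_hankelMajorant hs hU hds h hz))).mono (le_of_eq ?_)
      ring) (mem_ball_self one_pos)
  have hzero : (0 : ℂ) ∈ closedBall (0 : ℂ) 1 := mem_closedBall_self zero_le_one
  rw [poissonMean_zero, Real.circleAverage_fun_add (circleIntegrable_of_continuous hre) hsum,
    Real.circleAverage_fun_add (hint g) (hint h), circleAverage_hankelMajorant hs hU,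
    circleAverage_hankelMajorant hs hU] at hle
  simp only [hp, map_zero, zero_mul, Complex.zero_re] at hle
  rw [inner_polyVec, ← circleAverage_re (circleIntegrable_of_continuous hform)]
  linarith [hankelMajorant_nonneg hs hU g hzero, hankelMajorant_nonneg hs hU h hzero]

end Defect

theorem hankelBound_of_neg_re_inner_le {p : Polynomial ℂ} {K : ℝ}
    (hK : ∀ g h : Polynomial ℂ, -(inner ℂ (polyVec p) (polyVec (g * h))).re ≤
      K * (‖polyVec g‖ ^ 2 + ‖polyVec h‖ ^ 2)) :
    HankelBound p (2 * K) := by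
  have hK0 : 0 ≤ K := by simpa [norm_polyVec_one] using hK 1 0
  intro g h
  set B := inner ℂ (polyVec p) (polyVec (g * h)) with hB
  rcases eq_or_ne B 0 with h0 | h0
  · rw [h0, norm_zero]
    positivity
  have hquad : ∀ t : ℝ, 0 ≤ K * (‖B‖ ^ 2 * ‖polyVec g‖ ^ 2) * (t * t) + -‖B‖ ^ 2 * t +
      K * ‖polyVec h‖ ^ 2 := fun t => by
    have hrot := hK ((-(t : ℂ) * conj B) • g) h
    rw [smul_mul_assoc, map_smul, map_smul, inner_smul_right, ← hB, norm_smul, norm_mul,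
      norm_neg, Complex.norm_conj, Complex.norm_real, mul_assoc, ← Complex.ofReal_neg,
      Complex.re_ofReal_mul, re_conj_mul_self, mul_pow, mul_pow, Real.norm_eq_abs, sq_abs] at hrot
    linarith
  have hdiscrim := discrim_le_zero hquad
  rw [discrim] at hdiscrim
  refine le_of_sq_le_sq ?_ (by positivity)
  have hB2 : 0 < ‖B‖ ^ 2 := by positivity
  exact le_of_mul_le_mul_left (by linarith) hB2

theorem HankelBound.add {p q : Polynomial ℂ} {C D : ℝ} (hp : HankelBound p C)
    (hq : HankelBound q D) : HankelBound (p + q) (C + D) := fun g h => by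
  rw [map_add, inner_add_left, add_mul, add_mul]
  exact (norm_add_le _ _).trans (add_le_add (hp g h) (hq g h))

theorem norm_eval_zero_le_norm_polyVec (p : Polynomial ℂ) : ‖p.eval 0‖ ≤ ‖polyVec p‖ := by
  rw [← Polynomial.coeff_zero_eq_eval_zero, ← polyVec_apply]
  exact lp.norm_apply_le_norm two_ne_zero _ 0

theorem hankelBound_C (c : ℂ) : HankelBound (Polynomial.C c) ‖c‖ := fun g h => by
  rw [← Polynomial.monomial_zero_left, inner_polyVec_monomial_left, polyVec_apply,
    Polynomial.coeff_zero_eq_eval_zero, Polynomial.eval_mul, norm_mul, norm_mul, Complex.norm_conj,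
    mul_assoc]
  gcongr <;> exact norm_eval_zero_le_norm_polyVec _

theorem hankelBound_of_poissonMean_le {p : Polynomial ℂ} {N : ℝ} (hN0 : 0 < N)
    (hN : ∀ z ∈ ball (0 : ℂ) 1, poissonMean z (fun ζ => ‖p.eval ζ - p.eval z‖) ≤ N) :
    HankelBound p (48 * N + ‖p.eval 0‖) := by
  set q := p - Polynomial.C (p.eval 0) with hq
  have hqN : ∀ z ∈ ball (0 : ℂ) 1, poissonMean z (fun ζ => ‖q.eval ζ - q.eval z‖) ≤ N := by
    simpa [hq] using hN
  obtain ⟨U, hU⟩ := exists_polynomial_re_eq_norm_sq q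
  have hqb : HankelBound q (2 * (2 * (12 * N))) :=
    hankelBound_of_neg_re_inner_le (neg_re_inner_polyVec_mul_le (by positivity) hU
      (fun _ hw => subharmonicDefect_le_of_poissonMean_le hU hqN hw) (by simp [hq]))
  convert hqb.add (hankelBound_C (p.eval 0)) using 1
  · rw [hq, sub_add_cancel]
  · ring
/-! ### Mean oscillation over arcs dominates mean oscillation against the Poisson kernel -/

section IntervalAverage

variable {E : Type*} [NormedAddCommGroup E] [NormedSpace ℝ E] {f g : ℝ → E} {v w : ℝ → ℝ}
  {α β h : ℝ}

theorem interval_average_const [CompleteSpace E] (hαβ : α ≠ β) (c : E) : (⨍ _ in α..β, c) = c := by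
  rw [interval_average_eq, intervalIntegral.integral_const, smul_smul,
    inv_mul_cancel₀ (sub_ne_zero.2 hαβ.symm), one_smul]

theorem interval_average_add (hf : IntervalIntegrable f volume α β)
    (hg : IntervalIntegrable g volume α β) :
    (⨍ t in α..β, (f t + g t)) = (⨍ t in α..β, f t) + ⨍ t in α..β, g t := by
  simp only [interval_average_eq, intervalIntegral.integral_add hf hg, smul_add]

theorem interval_average_sub (hf : IntervalIntegrable f volume α β)
    (hg : IntervalIntegrable g volume α β) :
    (⨍ t in α..β, (f t - g t)) = (⨍ t in α..β, f t) - ⨍ t in α..β, g t := by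
  simp only [interval_average_eq, intervalIntegral.integral_sub hf hg, smul_sub]

theorem interval_average_mono (hαβ : α ≤ β) (hv : IntervalIntegrable v volume α β)
    (hw : IntervalIntegrable w volume α β) (hvw : ∀ t ∈ Set.Icc α β, v t ≤ w t) :
    (⨍ t in α..β, v t) ≤ ⨍ t in α..β, w t := by
  rw [interval_average_eq, interval_average_eq]
  exact smul_le_smul_of_nonneg_left (intervalIntegral.integral_mono_on hαβ hv hw hvw)
    (inv_nonneg.2 (sub_nonneg.2 hαβ))

theorem interval_average_nonneg (hv : 0 ≤ v) : 0 ≤ ⨍ t in α..β, v t :=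
  integral_nonneg hv

theorem interval_average_half_le (hh : 0 < h) (hv : IntervalIntegrable v volume (-h) h)
    (hv0 : 0 ≤ v) : (⨍ s in -(h / 2)..h / 2, v s) ≤ 2 * ⨍ s in -h..h, v s := by
  have hle : ∫ s in -(h / 2)..h / 2, v s ≤ ∫ s in -h..h, v s :=
    intervalIntegral.integral_mono_interval (by linarith) (by linarith) (by linarith)
      (Eventually.of_forall hv0) hv
  have hinv : (h / 2 - -(h / 2))⁻¹ = 2 * (h - -h)⁻¹ := by field_simp
  rw [interval_average_eq, interval_average_eq, smul_eq_mul, smul_eq_mul, hinv, mul_assoc]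
  gcongr
  exact inv_nonneg.2 (by linarith)

theorem norm_sub_interval_average_le [CompleteSpace E] (hαβ : α ≠ β)
    (hf : IntervalIntegrable f volume α β) (c : E) :
    ‖c - ⨍ t in α..β, f t‖ ≤ ⨍ t in α..β, ‖f t - c‖ := by
  rw [norm_sub_rev]
  nth_rewrite 1 [← interval_average_const hαβ c]
  rw [← interval_average_sub hf intervalIntegrable_const]
  exact norm_integral_le_integral_norm _

end IntervalAverage

section DyadicMean

variable {v w : ℝ → ℝ}

/-- The combination `∑ 2 ^ (k - n) A_k` over `k ≤ n`, where `A_k` is the mean over the interval of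
radius `π / 2 ^ k`. Up to a constant it dominates the Poisson mean at distance about `2 ^ (-n)`
from the circle. -/
noncomputable def dyadicMean (w : ℝ → ℝ) : ℕ → ℝ
  | 0 => ⨍ s in -Real.pi..Real.pi, w s
  | n + 1 => (⨍ s in -(Real.pi / 2 ^ (n + 1))..Real.pi / 2 ^ (n + 1), w s) + dyadicMean w n / 2

theorem dyadicMean_mono (hv : Continuous v) (hw : Continuous w) (hvw : v ≤ w) (n : ℕ) :
    dyadicMean v n ≤ dyadicMean w n := by
  have havg {h : ℝ} (hh : 0 ≤ h) : (⨍ s in -h..h, v s) ≤ ⨍ s in -h..h, w s :=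
    interval_average_mono (by linarith) (hv.intervalIntegrable _ _) (hw.intervalIntegrable _ _)
      fun s _ => hvw s
  induction n with
  | zero => exact havg Real.pi_pos.le
  | succ n ih =>
    rw [dyadicMean, dyadicMean]
    gcongr
    exact havg (by positivity)

theorem dyadicMean_add_const_le (hv : Continuous v) {c : ℝ} (hc : 0 ≤ c) (n : ℕ) :
    dyadicMean (fun s => v s + c) n ≤ dyadicMean v n + 2 * c := by
  have havg {h : ℝ} (hh : 0 < h) : (⨍ s in -h..h, (v s + c)) = (⨍ s in -h..h, v s) + c := by
    rw [interval_average_add (hv.intervalIntegrable _ _) intervalIntegrable_const,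
      interval_average_const (by linarith)]
  induction n with
  | zero =>
    rw [dyadicMean, dyadicMean, havg Real.pi_pos]
    linarith
  | succ n ih =>
    rw [dyadicMean, dyadicMean, havg (by positivity)]
    linarith

/-- The density of `dyadicMean` with respect to normalized Lebesgue measure on `[-π, π]`. -/
noncomputable def dyadicKernel (s : ℝ) : ℕ → ℝ
  | 0 => 1
  | n + 1 => (Set.Ioc (-(Real.pi / 2 ^ (n + 1))) (Real.pi / 2 ^ (n + 1))).indicator
      (fun _ => 2 ^ (n + 1)) s + dyadicKernel s n / 2

theorem dyadicKernel_nonneg (s : ℝ) (n : ℕ) : 0 ≤ dyadicKernel s n := by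
  induction n with
  | zero => exact zero_le_one
  | succ n ih =>
    exact add_nonneg (Set.indicator_nonneg (fun _ _ => by positivity) _) (by positivity)

theorem two_pow_le_dyadicKernel_or (s : ℝ) (n : ℕ) :
    2 ^ n ≤ dyadicKernel s n ∨ Real.pi ^ 2 / 2 ^ n ≤ 4 * s ^ 2 * dyadicKernel s n := by
  induction n with
  | zero => left; rw [pow_zero, dyadicKernel]
  | succ n ih =>
    rw [dyadicKernel]
    by_cases hs : s ∈ Set.Ioc (-(Real.pi / 2 ^ (n + 1))) (Real.pi / 2 ^ (n + 1))
    · left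
      rw [Set.indicator_of_mem hs]
      linarith [dyadicKernel_nonneg s n]
    right
    rw [Set.indicator_of_notMem hs, zero_add]
    rcases ih with ih | ih
    · have hle : Real.pi / 2 ^ (n + 1) ≤ |s| := by
        by_contra! hlt
        exact hs ⟨(abs_lt.1 hlt).1, (abs_lt.1 hlt).2.le⟩
      calc Real.pi ^ 2 / 2 ^ (n + 1) = 4 * (Real.pi / 2 ^ (n + 1)) ^ 2 * (2 ^ n / 2) := by
            rw [div_pow, pow_succ]
            field_simp
            ring
        _ ≤ 4 * |s| ^ 2 * (dyadicKernel s n / 2) := by gcongr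
        _ = 4 * s ^ 2 * (dyadicKernel s n / 2) := by rw [sq_abs]
    · rw [pow_succ 2 n, ← div_div]
      linarith

theorem le_dyadicKernel_mul_sq {δ d s : ℝ} {n : ℕ} (hn : 1 / 2 ^ (n + 1) ≤ δ)
    (hn' : δ ≤ 1 / 2 ^ n) (hδ : δ ≤ d) (hs : |s| ≤ Real.pi * d) :
    δ ≤ 4 * dyadicKernel s n * d ^ 2 := by
  have hδ0 : 0 < δ := lt_of_lt_of_le (by positivity) hn
  have hK := dyadicKernel_nonneg s n
  rcases two_pow_le_dyadicKernel_or s n with hnear | hfar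
  · calc δ = δ * 1 := (mul_one δ).symm
      _ ≤ δ * (δ * 2 ^ (n + 1)) := by
        gcongr
        exact (div_le_iff₀ (by positivity)).1 hn
      _ = 2 * 2 ^ n * δ ^ 2 := by ring
      _ ≤ 4 * dyadicKernel s n * d ^ 2 := by gcongr; norm_num
  · have hs2 : s ^ 2 ≤ (Real.pi * d) ^ 2 := by
      rw [← sq_abs s]
      gcongr
    refine le_of_mul_le_mul_left (a := Real.pi ^ 2) ?_ (by positivity)
    calc Real.pi ^ 2 * δ ≤ Real.pi ^ 2 * (1 / 2 ^ n) := by gcongr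
      _ = Real.pi ^ 2 / 2 ^ n := by rw [mul_one_div]
      _ ≤ 4 * s ^ 2 * dyadicKernel s n := hfar
      _ ≤ 4 * (Real.pi * d) ^ 2 * dyadicKernel s n := by gcongr
      _ = Real.pi ^ 2 * (4 * dyadicKernel s n * d ^ 2) := by ring

theorem dyadicKernel_succ_mul (w : ℝ → ℝ) (n : ℕ) :
    (fun s => dyadicKernel s (n + 1) * w s) = fun s =>
      (Set.Ioc (-(Real.pi / 2 ^ (n + 1))) (Real.pi / 2 ^ (n + 1))).indicator
        (fun s => 2 ^ (n + 1) * w s) s + 2⁻¹ * (dyadicKernel s n * w s) := by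
  ext s
  simp only [dyadicKernel, Set.indicator_apply]
  split_ifs <;> ring

theorem integrableOn_dyadicKernel_mul (hw : IntegrableOn w (Set.Ioc (-Real.pi) Real.pi)) (n : ℕ) :
    IntegrableOn (fun s => dyadicKernel s n * w s) (Set.Ioc (-Real.pi) Real.pi) := by
  induction n with
  | zero => simpa only [dyadicKernel, one_mul] using hw
  | succ n ih =>
    rw [dyadicKernel_succ_mul]
    exact ((hw.const_mul _).indicator measurableSet_Ioc).add (ih.const_mul _)

theorem integral_dyadicKernel_mul (hw : IntegrableOn w (Set.Ioc (-Real.pi) Real.pi)) (n : ℕ) :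
    (2 * Real.pi)⁻¹ * ∫ s in -Real.pi..Real.pi, dyadicKernel s n * w s = dyadicMean w n := by
  induction n with
  | zero =>
    simp only [dyadicKernel, dyadicMean, one_mul]
    rw [interval_average_eq, smul_eq_mul, sub_neg_eq_add, ← two_mul]
  | succ n ih =>
    have hpos : 0 < Real.pi / 2 ^ (n + 1) := by positivity
    have hle : Real.pi / 2 ^ (n + 1) ≤ Real.pi :=
      div_le_self Real.pi_pos.le (one_le_pow₀ one_le_two)
    have hsub : Set.Ioc (-(Real.pi / 2 ^ (n + 1))) (Real.pi / 2 ^ (n + 1)) ⊆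
        Set.Ioc (-Real.pi) Real.pi := Set.Ioc_subset_Ioc (neg_le_neg hle) hle
    rw [intervalIntegral.integral_of_le (by linarith [Real.pi_pos])] at ih ⊢
    rw [dyadicKernel_succ_mul, integral_add ((hw.const_mul _).indicator measurableSet_Ioc)
      ((integrableOn_dyadicKernel_mul hw n).const_mul _), setIntegral_indicator measurableSet_Ioc,
      Set.inter_eq_right.2 hsub, integral_const_mul, integral_const_mul, dyadicMean, ← ih,
      interval_average_eq, intervalIntegral.integral_of_le (by linarith), sub_neg_eq_add, ← two_mul,
      smul_eq_mul]
    field_simp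

end DyadicMean

section PoissonKernel

variable {r θ s : ℝ}

theorem one_sub_le_norm_circleMap_sub (hr0 : 0 ≤ r) (θ t : ℝ) :
    1 - r ≤ ‖circleMap 0 1 t - circleMap 0 r θ‖ := by
  simpa [abs_of_nonneg hr0] using norm_sub_norm_le (circleMap 0 1 t) (circleMap 0 r θ)

theorem two_mul_abs_le_pi_mul_norm_circleMap_sub (θ : ℝ) (hs : |s| ≤ Real.pi) :
    2 * |s| ≤ Real.pi * ‖circleMap 0 1 (s + θ) - circleMap 0 1 θ‖ := by
  have hfactor : circleMap 0 1 (s + θ) - circleMap 0 1 θ =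
      (Complex.exp (Complex.I * s) - 1) * circleMap 0 1 θ := by
    simp only [circleMap, zero_add, Complex.ofReal_one, one_mul, Complex.ofReal_add]
    rw [add_mul, Complex.exp_add, mul_comm Complex.I]
    ring
  have hsin : 2 / Real.pi * |s / 2| ≤ |Real.sin (s / 2)| :=
    Real.mul_abs_le_abs_sin (by rw [abs_div, abs_two]; linarith)
  rw [hfactor, norm_mul, norm_circleMap_zero, abs_one, mul_one,
    Complex.norm_exp_I_mul_ofReal_sub_one, norm_mul, Real.norm_two, Real.norm_eq_abs]
  rw [abs_div, abs_two, div_mul_div_comm, mul_comm 2 |s|, mul_div_mul_right _ _ two_ne_zero,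
    div_le_iff₀ Real.pi_pos] at hsin
  linarith

theorem abs_le_pi_mul_norm_circleMap_sub (hr0 : 0 ≤ r) (hr1 : r ≤ 1) (θ : ℝ)
    (hs : |s| ≤ Real.pi) : |s| ≤ Real.pi * ‖circleMap 0 1 (s + θ) - circleMap 0 r θ‖ := by
  have hradial : ‖circleMap 0 r θ - circleMap 0 1 θ‖ = 1 - r := by
    rw [← dist_eq_norm, dist_comm]
    have hsub : circleMap 0 1 θ - circleMap 0 r θ = circleMap 0 (1 - r) θ := by
      simp only [circleMap, zero_add, Complex.ofReal_sub]
      ring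
    rw [dist_eq_norm, hsub, norm_circleMap_zero, abs_of_nonneg (sub_nonneg.2 hr1)]
  have htri := norm_sub_le_norm_sub_add_norm_sub (circleMap 0 1 (s + θ)) (circleMap 0 r θ)
    (circleMap 0 1 θ)
  have hle : ‖circleMap 0 1 (s + θ) - circleMap 0 1 θ‖ ≤
      2 * ‖circleMap 0 1 (s + θ) - circleMap 0 r θ‖ := by
    linarith [one_sub_le_norm_circleMap_sub hr0 θ (s + θ)]
  have hchord := two_mul_abs_le_pi_mul_norm_circleMap_sub θ hs
  linarith [mul_le_mul_of_nonneg_left hle Real.pi_pos.le]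

theorem poissonKernel_le_dyadicKernel (hr0 : 0 ≤ r) {n : ℕ} (hn : 1 / 2 ^ (n + 1) < 1 - r)
    (hn' : 1 - r ≤ 1 / 2 ^ n) (hs : |s| ≤ Real.pi) :
    poissonKernel 0 (circleMap 0 r θ) (circleMap 0 1 (s + θ)) ≤ 8 * dyadicKernel s n := by
  have hr1 : r < 1 := sub_pos.1 (lt_trans (by positivity) hn)
  have hd := one_sub_le_norm_circleMap_sub hr0 θ (s + θ)
  have hK := le_dyadicKernel_mul_sq hn.le hn' hd
    (abs_le_pi_mul_norm_circleMap_sub hr0 hr1.le θ hs)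
  have hd0 : 0 < ‖circleMap 0 1 (s + θ) - circleMap 0 r θ‖ := (sub_pos.2 hr1).trans_le hd
  simp only [poissonKernel, sub_zero, norm_circleMap_zero, abs_one, sq_abs]
  rw [div_le_iff₀ (by positivity)]
  nlinarith [sq_nonneg (1 - r)]

theorem poissonMean_le_dyadicMean {w : ℂ → ℝ} (hw : Continuous w) (hw0 : ∀ z, 0 ≤ w z)
    (hr0 : 0 ≤ r) {n : ℕ} (hn : 1 / 2 ^ (n + 1) < 1 - r) (hn' : 1 - r ≤ 1 / 2 ^ n) :
    poissonMean (circleMap 0 r θ) w ≤ 8 * dyadicMean (fun s => w (circleMap 0 1 (s + θ))) n := by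
  have hr1 : r < 1 := sub_pos.1 (lt_trans (by positivity) hn)
  have hl := circleMap_mem_unitBall (by rwa [abs_of_nonneg hr0]) θ
  have hcircle : Continuous fun s : ℝ => circleMap 0 1 (s + θ) :=
    (continuous_circleMap 0 1).comp (continuous_id.add continuous_const)
  have hint : IntegrableOn (fun s => w (circleMap 0 1 (s + θ))) (Set.Ioc (-Real.pi) Real.pi) :=
    (hw.comp hcircle).integrableOn_Ioc
  set F : ℝ → ℝ := fun s => poissonKernel 0 (circleMap 0 r θ) (circleMap 0 1 (s + θ)) *
    w (circleMap 0 1 (s + θ))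
  have hF : Continuous F :=
    ((continuousOn_poissonKernel_sphere hl).comp_continuous hcircle fun s => by simp).mul
      (hw.comp hcircle)
  have hperiodic : Function.Periodic F (2 * Real.pi) := fun s => by
    simp only [F]
    rw [add_right_comm, periodic_circleMap 0 1 (s + θ)]
  have hshift := hperiodic.intervalIntegral_add_eq 0 (-Real.pi)
  rw [zero_add, show -Real.pi + 2 * Real.pi = Real.pi by ring] at hshift
  rw [poissonMean, Real.circleAverage_eq_integral_add θ, smul_eq_mul, hshift,
    ← integral_dyadicKernel_mul hint, mul_left_comm]
  refine mul_le_mul_of_nonneg_left ?_ (by positivity)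
  rw [← intervalIntegral.integral_const_mul]
  have hpi : -Real.pi ≤ Real.pi := by linarith [Real.pi_pos]
  refine intervalIntegral.integral_mono_on hpi (hF.intervalIntegrable _ _)
    (((intervalIntegrable_iff_integrableOn_Ioc_of_le hpi).2
      (integrableOn_dyadicKernel_mul hint n)).const_mul 8) fun s hs => ?_
  rw [← mul_assoc]
  exact mul_le_mul_of_nonneg_right (poissonKernel_le_dyadicKernel hr0 hn hn' (abs_le.2 hs)) (hw0 _)

end PoissonKernel

section DyadicOscillation

variable {v : ℝ → ℂ} {h N : ℝ}

theorem norm_average_sub_average_half_le (hv : Continuous v) (hh : 0 < h) :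
    ‖(⨍ t in -h..h, v t) - ⨍ t in -(h / 2)..h / 2, v t‖ ≤ 2 * meanOscillation v (-h) h :=
  (norm_sub_interval_average_le (by linarith) (hv.intervalIntegrable _ _) _).trans
    (interval_average_half_le hh ((hv.sub continuous_const).norm.intervalIntegrable _ _)
      fun _ => norm_nonneg _)

theorem dyadicMean_norm_sub_average_le (hv : Continuous v)
    (hN : ∀ h, 0 < h → h ≤ Real.pi → meanOscillation v (-h) h ≤ N) (n : ℕ) :
    dyadicMean (fun s => ‖v s - ⨍ t in -(Real.pi / 2 ^ n)..Real.pi / 2 ^ n, v t‖) n ≤ 6 * N := by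
  set c : ℕ → ℂ := fun n => ⨍ t in -(Real.pi / 2 ^ n)..Real.pi / 2 ^ n, v t with hc
  have hosc (n : ℕ) : meanOscillation v (-(Real.pi / 2 ^ n)) (Real.pi / 2 ^ n) ≤ N :=
    hN _ (by positivity) (div_le_self Real.pi_pos.le (one_le_pow₀ one_le_two))
  have hmean (n : ℕ) :
      (⨍ s in -(Real.pi / 2 ^ n)..Real.pi / 2 ^ n, ‖v s - c n‖) ≤ N := hosc n
  have hN0 : 0 ≤ N := (interval_average_nonneg fun _ => norm_nonneg _).trans (hmean 0)
  have hcont (d : ℂ) : Continuous fun s => ‖v s - d‖ := (hv.sub continuous_const).norm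
  have hstep (n : ℕ) : ‖c n - c (n + 1)‖ ≤ 2 * N := by
    simp only [hc, pow_succ, ← div_div]
    exact (norm_average_sub_average_half_le hv (by positivity)).trans (by linarith [hosc n])
  change dyadicMean (fun s => ‖v s - c n‖) n ≤ 6 * N
  induction n with
  | zero =>
    have hzero := hmean 0
    rw [pow_zero, div_one] at hzero
    exact hzero.trans (by linarith)
  | succ n ih =>
    have hcenter : dyadicMean (fun s => ‖v s - c (n + 1)‖) n ≤
        dyadicMean (fun s => ‖v s - c n‖ + 2 * N) n :=
      dyadicMean_mono (hcont _) ((hcont _).add continuous_const) (fun s =>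
        (norm_sub_le_norm_sub_add_norm_sub (v s) (c n) (c (n + 1))).trans
          (add_le_add le_rfl (hstep n))) n
    have hshift := dyadicMean_add_const_le (hcont (c n)) (c := 2 * N) (by positivity) n
    rw [dyadicMean]
    linarith [hmean (n + 1)]

theorem meanOscillation_comp_add_right (u : ℝ → ℂ) (θ α β : ℝ) :
    meanOscillation (fun s => u (s + θ)) α β = meanOscillation u (α + θ) (β + θ) := by
  simp only [meanOscillation, interval_average_eq, add_sub_add_right_eq_sub]
  rw [intervalIntegral.integral_comp_add_right u θ, intervalIntegral.integral_comp_add_right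
    (fun s => ‖u s - (β - α)⁻¹ • ∫ t in α + θ..β + θ, u t‖) θ]

theorem norm_le_poissonMean {F : ℂ → ℂ} (hF : Differentiable ℂ F) {lam : ℂ}
    (hl : lam ∈ ball (0 : ℂ) 1) : ‖F lam‖ ≤ poissonMean lam fun ζ => ‖F ζ‖ := by
  have hrot : Differentiable ℂ fun z => conj (F lam) * F z := hF.const_mul _
  have hsq : ‖F lam‖ * ‖F lam‖ ≤ ‖F lam‖ * poissonMean lam fun ζ => ‖F ζ‖ :=
    calc ‖F lam‖ * ‖F lam‖ = poissonMean lam fun z => (conj (F lam) * F z).re := by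
          rw [poissonMean_re hl hrot, re_conj_mul_self, sq]
      _ ≤ poissonMean lam fun z => ‖F lam‖ * ‖F z‖ := by
          refine poissonMean_mono hl
            (circleIntegrable_of_continuous (Complex.continuous_re.comp hrot.continuous))
            (circleIntegrable_of_continuous (continuous_const.mul hF.continuous.norm)) fun ζ _ => ?_
          exact (Complex.re_le_norm _).trans_eq (by rw [norm_mul, Complex.norm_conj])
      _ = ‖F lam‖ * poissonMean lam fun ζ => ‖F ζ‖ := poissonMean_const_mul _
  rcases (norm_nonneg (F lam)).eq_or_lt with hzero | hpos
  · rw [← hzero]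
    exact poissonMean_nonneg hl fun _ _ => norm_nonneg _
  · exact le_of_mul_le_mul_left hsq hpos

theorem poissonMean_norm_sub_self_le {F : ℂ → ℂ} (hF : Differentiable ℂ F) {lam : ℂ}
    (hl : lam ∈ ball (0 : ℂ) 1) (c : ℂ) :
    poissonMean lam (fun ζ => ‖F ζ - F lam‖) ≤ 2 * poissonMean lam fun ζ => ‖F ζ - c‖ := by
  have hint (d : ℂ) : CircleIntegrable (fun ζ => ‖F ζ - d‖) 0 1 :=
    circleIntegrable_of_continuous (hF.continuous.sub continuous_const).norm
  calc poissonMean lam (fun ζ => ‖F ζ - F lam‖)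
      ≤ poissonMean lam fun ζ => ‖F ζ - c‖ + ‖F lam - c‖ := by
        refine poissonMean_mono hl (hint _) ((hint c).add (circleIntegrable_const _ _ _))
          fun ζ _ => ?_
        rw [norm_sub_rev (F lam) c]
        exact norm_sub_le_norm_sub_add_norm_sub _ _ _
    _ = poissonMean lam (fun ζ => ‖F ζ - c‖) + ‖F lam - c‖ := by
        rw [poissonMean_add hl (hint c) (circleIntegrable_const _ _ _), poissonMean_const hl]
    _ ≤ 2 * poissonMean lam fun ζ => ‖F ζ - c‖ := by
        linarith [norm_le_poissonMean (hF.sub_const c) hl]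

theorem poissonMean_norm_sub_self_le_of_meanOscillation_le {F : ℂ → ℂ} (hF : Differentiable ℂ F)
    (hN : ∀ α β : ℝ, α < β → β ≤ α + 2 * Real.pi →
      meanOscillation (fun t => F (circleMap 0 1 t)) α β ≤ N)
    {lam : ℂ} (hl : lam ∈ ball (0 : ℂ) 1) :
    poissonMean lam (fun ζ => ‖F ζ - F lam‖) ≤ 96 * N := by
  obtain ⟨r, θ, hr0, hr1, rfl⟩ : ∃ r θ : ℝ, 0 ≤ r ∧ r < 1 ∧ lam = circleMap 0 r θ :=
    ⟨‖lam‖, lam.arg, norm_nonneg _, mem_ball_zero_iff.1 hl, by simp [circleMap]⟩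
  obtain ⟨n, hn, hn'⟩ := exists_nat_pow_near_of_lt_one (sub_pos.2 hr1) (sub_le_self 1 hr0)
    (one_half_pos (α := ℝ)) one_half_lt_one
  rw [one_div_pow] at hn hn'
  have hcont : Continuous fun s : ℝ => F (circleMap 0 1 (s + θ)) :=
    hF.continuous.comp ((continuous_circleMap 0 1).comp (continuous_id.add continuous_const))
  have hdyadic := dyadicMean_norm_sub_average_le hcont (N := N) (fun h h0 hπ => by
    rw [meanOscillation_comp_add_right (fun t => F (circleMap 0 1 t))]
    exact hN _ _ (by linarith) (by linarith)) n
  set c := ⨍ t in -(Real.pi / 2 ^ n)..Real.pi / 2 ^ n, F (circleMap 0 1 (t + θ))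
  have hpoisson := poissonMean_le_dyadicMean (θ := θ) (w := fun z => ‖F z - c‖)
    (hF.continuous.sub continuous_const).norm (fun _ => norm_nonneg _) hr0 hn hn'
  linarith [poissonMean_norm_sub_self_le hF hl c]

theorem hankelBound_of_meanOscillation_le {p : Polynomial ℂ} (hN0 : 0 < N)
    (hN : ∀ α β : ℝ, α < β → β ≤ α + 2 * Real.pi →
      meanOscillation (fun t => p.eval (circleMap 0 1 t)) α β ≤ N) :
    HankelBound p (48 * (96 * N) + ‖p.eval 0‖) :=
  hankelBound_of_poissonMean_le (by positivity) fun _ hl =>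
    poissonMean_norm_sub_self_le_of_meanOscillation_le p.differentiable hN hl

end DyadicOscillation

/-! ### Mean oscillation of dilates -/

section Oscillation

variable {E : Type*} [NormedAddCommGroup E] [NormedSpace ℝ E] {u v : ℝ → ℂ} {α β : ℝ}

theorem continuous_interval_average {F : ℝ → ℝ → E} (hF : Continuous F.uncurry) (α β : ℝ) :
    Continuous fun s => ⨍ t in α..β, F s t := by
  simp only [interval_average_eq]
  exact (intervalIntegral.continuous_parametric_intervalIntegral_of_continuous' hF α β).const_smul _

theorem interval_average_integral_swap {F : ℝ → ℝ → E} (hF : Continuous F.uncurry)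
    (α β c d : ℝ) :
    (⨍ t in α..β, ∫ s in c..d, F t s) = ∫ s in c..d, ⨍ t in α..β, F t s := by
  have hint : IntegrableOn F.uncurry (Set.uIoc α β ×ˢ Set.uIoc c d) :=
    (hF.continuousOn.integrableOn_compact (isCompact_uIcc.prod isCompact_uIcc)).mono_set
      (Set.prod_mono Set.uIoc_subset_uIcc Set.uIoc_subset_uIcc)
  simp only [interval_average_eq]
  rw [intervalIntegral_intervalIntegral_swap hint, intervalIntegral.integral_smul]

theorem interval_average_smul (c : ℝ) (f : ℝ → E) :
    (⨍ t in α..β, c • f t) = c • ⨍ t in α..β, f t :=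
  integral_smul c f

theorem norm_integral_smul_sub_integral_smul_le {K : ℝ → ℝ} {f g : ℝ → E} {T : ℝ} (hT : 0 ≤ T)
    (hK0 : ∀ s, 0 ≤ K s) (hf : IntervalIntegrable (fun s => K s • f s) volume 0 T)
    (hg : IntervalIntegrable (fun s => K s • g s) volume 0 T) :
    ‖(∫ s in (0 : ℝ)..T, K s • f s) - ∫ s in (0 : ℝ)..T, K s • g s‖ ≤
      ∫ s in (0 : ℝ)..T, K s • ‖f s - g s‖ := by
  rw [← intervalIntegral.integral_sub hf hg]
  refine (intervalIntegral.norm_integral_le_integral_norm hT).trans_eq ?_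
  simp only [← smul_sub, norm_smul, Real.norm_of_nonneg (hK0 _), smul_eq_mul]

theorem meanOscillation_average_le {K : ℝ → ℝ} {T N : ℝ} (hT : 0 ≤ T) (hK : Continuous K)
    (hK0 : ∀ s, 0 ≤ K s) (hK1 : ∫ s in (0 : ℝ)..T, K s = 1) (hv : Continuous v) (hαβ : α ≤ β)
    (hN : ∀ s, meanOscillation v (α + s) (β + s) ≤ N) :
    meanOscillation (fun t => ∫ s in (0 : ℝ)..T, K s • v (t + s)) α β ≤ N := by
  have hadd : Continuous fun x : ℝ × ℝ => v (x.1 + x.2) := hv.comp continuous_add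
  set m : ℝ → ℂ := fun s => ⨍ t in α..β, v (t + s) with hm
  have hmc : Continuous m :=
    continuous_interval_average (F := fun s t => v (t + s)) (hadd.comp continuous_swap) α β
  have hKv : Continuous fun x : ℝ × ℝ => K x.2 • v (x.1 + x.2) := (hK.comp continuous_snd).smul hadd
  have hdev : Continuous fun x : ℝ × ℝ => K x.2 • ‖v (x.1 + x.2) - m x.2‖ :=
    (hK.comp continuous_snd).smul (hadd.sub (hmc.comp continuous_snd)).norm
  have hmean : (⨍ t in α..β, ∫ s in (0 : ℝ)..T, K s • v (t + s)) =
      ∫ s in (0 : ℝ)..T, K s • m s := by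
    rw [interval_average_integral_swap (F := fun t s => K s • v (t + s)) hKv]
    simp only [hm, interval_average_smul]
  have hosc (s : ℝ) : (⨍ t in α..β, K s • ‖v (t + s) - m s‖) ≤ K s * N := by
    rw [interval_average_smul]
    refine mul_le_mul_of_nonneg_left ?_ (hK0 s)
    rw [← meanOscillation, meanOscillation_comp_add_right]
    exact hN s
  rw [meanOscillation, hmean]
  calc (⨍ t in α..β, ‖(∫ s in (0 : ℝ)..T, K s • v (t + s)) - ∫ s in (0 : ℝ)..T, K s • m s‖)
      ≤ ⨍ t in α..β, ∫ s in (0 : ℝ)..T, K s • ‖v (t + s) - m s‖ := by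
        refine interval_average_mono hαβ (Continuous.intervalIntegrable ?_ _ _)
          (Continuous.intervalIntegrable ?_ _ _) fun t _ =>
            norm_integral_smul_sub_integral_smul_le hT hK0
              ((hKv.comp (Continuous.prodMk_right t)).intervalIntegrable _ _)
              ((hK.smul hmc).intervalIntegrable _ _)
        · exact ((intervalIntegral.continuous_parametric_intervalIntegral_of_continuous'
            (f := fun t s => K s • v (t + s)) hKv 0 T).sub continuous_const).norm
        · exact intervalIntegral.continuous_parametric_intervalIntegral_of_continuous'
            (f := fun t s => K s • ‖v (t + s) - m s‖) hdev 0 T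
    _ = ∫ s in (0 : ℝ)..T, ⨍ t in α..β, K s • ‖v (t + s) - m s‖ :=
        interval_average_integral_swap (F := fun t s => K s • ‖v (t + s) - m s‖) hdev ..
    _ ≤ ∫ s in (0 : ℝ)..T, K s * N :=
        intervalIntegral.integral_mono hT
          ((continuous_interval_average (F := fun s t => K s • ‖v (t + s) - m s‖)
            (hdev.comp continuous_swap) α β).intervalIntegrable _ _)
          ((hK.mul continuous_const).intervalIntegrable _ _) hosc
    _ = N := by rw [intervalIntegral.integral_mul_const, hK1, one_mul]

theorem meanOscillation_le_add (hαβ : α < β) (hu : IntervalIntegrable u volume α β)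
    (hv : IntervalIntegrable v volume α β) :
    meanOscillation v α β ≤ meanOscillation u α β + 2 * ⨍ t in α..β, ‖v t - u t‖ := by
  set D := ⨍ t in α..β, ‖v t - u t‖
  have hmean : ‖(⨍ t in α..β, u t) - ⨍ t in α..β, v t‖ ≤ D := by
    rw [norm_sub_rev, ← interval_average_sub hv hu]
    exact norm_integral_le_integral_norm _
  have hdist : IntervalIntegrable (fun t => ‖v t - u t‖) volume α β := (hv.sub hu).norm
  have hdev {w : ℝ → ℂ} (hw : IntervalIntegrable w volume α β) :
      IntervalIntegrable (fun t => ‖w t - ⨍ s in α..β, w s‖) volume α β :=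
    (hw.sub intervalIntegrable_const).norm
  calc meanOscillation v α β
      ≤ ⨍ t in α..β, (‖u t - ⨍ s in α..β, u s‖ + (‖v t - u t‖ + D)) := by
        refine interval_average_mono hαβ.le (hdev hv)
          ((hdev hu).add (hdist.add intervalIntegrable_const)) fun t _ => ?_
        linarith [norm_sub_le_norm_sub_add_norm_sub (v t) (u t) (⨍ t in α..β, v t),
          norm_sub_le_norm_sub_add_norm_sub (u t) (⨍ t in α..β, u t) (⨍ t in α..β, v t)]
    _ = meanOscillation u α β + 2 * D := by
        rw [interval_average_add (hdev hu) (hdist.add intervalIntegrable_const),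
          interval_average_add hdist intervalIntegrable_const, interval_average_const hαβ.ne,
          ← meanOscillation, two_mul]

theorem interval_average_norm_sub_le {C : ℝ} (hαβ : α < β) (hu : IntervalIntegrable u volume α β)
    (hv : IntervalIntegrable v volume α β) (hC : ∀ t ∈ Set.Icc α β, ‖v t - u t‖ ≤ C) :
    (⨍ t in α..β, ‖v t - u t‖) ≤ C :=
  (interval_average_mono hαβ.le (hv.sub hu).norm intervalIntegrable_const hC).trans_eq
    (interval_average_const hαβ.ne C)

theorem meanOscillation_const (hαβ : α ≠ β) (c : ℂ) : meanOscillation (fun _ => c) α β = 0 := by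
  rw [meanOscillation, interval_average_const hαβ]
  simp only [sub_self, norm_zero, interval_average_const hαβ]

theorem meanOscillation_le_of_norm_sub_le {C : ℝ} {c : ℂ} (hαβ : α < β)
    (hv : IntervalIntegrable v volume α β) (hC : ∀ t ∈ Set.Icc α β, ‖v t - c‖ ≤ C) :
    meanOscillation v α β ≤ 2 * C := by
  have hle := meanOscillation_le_add hαβ (intervalIntegrable_const (c := c)) hv
  rw [meanOscillation_const hαβ.ne, zero_add] at hle
  linarith [interval_average_norm_sub_le hαβ intervalIntegrable_const hv hC]

end Oscillation

section Boundary

variable {f : ℂ → ℂ} {u : ℝ → ℂ} {c : ℕ → ℂ} {r ρ τ N ε : ℝ}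

theorem ofReal_mul_circleMap (τ r θ : ℝ) : (τ : ℂ) * circleMap 0 r θ = circleMap 0 (τ * r) θ := by
  simp only [circleMap, zero_add, Complex.ofReal_mul, mul_assoc]

theorem ofReal_mul_mem_unitBall (hτ : |τ| ≤ 1) {z : ℂ} (hz : z ∈ ball (0 : ℂ) 1) :
    (τ : ℂ) * z ∈ ball (0 : ℂ) 1 := by
  rw [mem_ball_zero_iff] at hz ⊢
  rw [norm_mul, Complex.norm_real]
  exact (mul_le_of_le_one_left (norm_nonneg z) hτ).trans_lt hz

theorem mapsTo_ofReal_mul_closedBall (hτ : |τ| < 1) :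
    Set.MapsTo (fun z : ℂ => (τ : ℂ) * z) (closedBall 0 1) (ball 0 1) := fun z hz => by
  rw [mem_closedBall_zero_iff] at hz
  rw [mem_ball_zero_iff, norm_mul, Complex.norm_real]
  exact (mul_le_of_le_one_right (abs_nonneg τ) hz).trans_lt hτ

theorem HasTaylor.dilate (h : HasTaylor f c) (hτ : |τ| ≤ 1) :
    HasTaylor (fun z => f (τ * z)) fun n => c n * τ ^ n := fun z hz =>
  (h _ (ofReal_mul_mem_unitBall hτ hz)).congr_fun fun n => by rw [mul_pow, mul_assoc]

theorem one_sub_pow_mem_Icc (hρ : ρ ∈ Set.Icc (0 : ℝ) 1) (n : ℕ) :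
    1 - ρ ^ n ∈ Set.Icc (0 : ℝ) 1 :=
  ⟨sub_nonneg.2 (pow_le_one₀ hρ.1 hρ.2), sub_le_self _ (pow_nonneg hρ.1 n)⟩

theorem norm_sq_mul_one_sub_pow_sq_le (hρ : ρ ∈ Set.Icc (0 : ℝ) 1) (n : ℕ) :
    ‖c n‖ ^ 2 * (1 - ρ ^ n) ^ 2 ≤ ‖c n‖ ^ 2 :=
  have hpow := one_sub_pow_mem_Icc hρ n
  mul_le_of_le_one_right (by positivity) (pow_le_one₀ hpow.1 hpow.2)

theorem HasTaylor.circleAverage_norm_sub_dilate_sq_le (h : HasTaylor f c)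
    (hs : Summable fun n => ‖c n‖ ^ 2) (hρ : 0 ≤ ρ) (hρr : ρ < r) (hr : r < 1) :
    Real.circleAverage (fun z => ‖f z - f ((ρ / r : ℝ) * z)‖ ^ 2) 0 r ≤
      ∑' n, ‖c n‖ ^ 2 * (1 - ρ ^ n) ^ 2 := by
  have hr0 : 0 < r := hρ.trans_lt hρr
  have hτ0 : 0 ≤ ρ / r := by positivity
  have hτ1 : ρ / r ≤ 1 := (div_le_one hr0).2 hρr.le
  have hparseval := (h.sub (h.dilate (τ := ρ / r) (by rwa [abs_of_nonneg hτ0]))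
    ).hasSum_circleAverage_norm_sq (r := r) (by rwa [abs_of_pos hr0])
  have hsummable : Summable fun n => ‖c n‖ ^ 2 * (1 - ρ ^ n) ^ 2 :=
    hs.of_nonneg_of_le (fun n => by positivity)
      (norm_sq_mul_one_sub_pow_sq_le ⟨hρ, (hρr.trans hr).le⟩)
  rw [← hparseval.tsum_eq]
  refine hparseval.summable.tsum_le_tsum (fun n => ?_) hsummable
  have hcoeff : c n - c n * ((ρ / r : ℝ) : ℂ) ^ n = c n * ((1 - (ρ / r) ^ n : ℝ) : ℂ) := by
    push_cast
    ring
  rw [hcoeff, norm_mul, Complex.norm_real, mul_pow, Real.norm_eq_abs, sq_abs]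
  calc ‖c n‖ ^ 2 * (1 - (ρ / r) ^ n) ^ 2 * r ^ (2 * n) ≤ ‖c n‖ ^ 2 * (1 - (ρ / r) ^ n) ^ 2 :=
        mul_le_of_le_one_right (by positivity) (pow_le_one₀ hr0.le hr.le)
    _ ≤ ‖c n‖ ^ 2 * (1 - ρ ^ n) ^ 2 := by
        have hnonneg := (one_sub_pow_mem_Icc ⟨hτ0, hτ1⟩ n).1
        gcongr
        exact le_div_self hρ hr0 hr.le

theorem tendsto_tsum_one_sub_pow_sq (hs : Summable fun n => ‖c n‖ ^ 2) :
    Tendsto (fun ρ : ℝ => ∑' n, ‖c n‖ ^ 2 * (1 - ρ ^ n) ^ 2) (𝓝[<] 1) (𝓝 0) := by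
  have hterm (n : ℕ) :
      Tendsto (fun ρ : ℝ => ‖c n‖ ^ 2 * (1 - ρ ^ n) ^ 2) (𝓝[<] 1) (𝓝 0) := by
    have hc : Continuous fun ρ : ℝ => ‖c n‖ ^ 2 * (1 - ρ ^ n) ^ 2 := by fun_prop
    simpa using (hc.tendsto 1).mono_left (nhdsWithin_le_nhds (s := Set.Iio 1))
  rw [← tsum_zero (β := ℕ)]
  refine tendsto_tsum_of_dominated_convergence hs hterm ?_
  filter_upwards [Ioo_mem_nhdsLT zero_lt_one] with ρ hρ n
  rw [Real.norm_of_nonneg (by positivity)]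
  exact norm_sq_mul_one_sub_pow_sq_le (Set.Ioo_subset_Icc_self hρ) n

theorem sq_circleAverage_le {v : ℂ → ℝ} {x : ℂ} (hv : ContinuousOn v (sphere x |r|)) :
    Real.circleAverage v x r ^ 2 ≤ Real.circleAverage (fun z => v z ^ 2) x r := by
  set A := Real.circleAverage v x r with hA
  have hvariance : 0 ≤ Real.circleAverage (fun z => v z ^ 2 + (-2 * A * v z + A ^ 2)) x r :=
    Real.circleAverage_nonneg_of_nonneg fun z _ => by
      linarith [sq_nonneg (v z - A), sub_sq (v z) A]
  have hlin : CircleIntegrable (fun z => -2 * A * v z) x r :=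
    (continuousOn_const.mul hv).circleIntegrable'
  have hsq : CircleIntegrable (fun z => v z ^ 2) x r := (hv.pow 2).circleIntegrable'
  have hconst : CircleIntegrable (fun _ => A ^ 2) x r := circleIntegrable_const _ _ _
  have haffine : CircleIntegrable (fun z => -2 * A * v z + A ^ 2) x r := hlin.add hconst
  rw [Real.circleAverage_fun_add hsq haffine, Real.circleAverage_fun_add hlin hconst,
    circleAverage_const_mul, Real.circleAverage_const, ← hA] at hvariance
  linarith

theorem HasTaylor.circleAverage_norm_sub_dilate_le (h : HasTaylor f c)
    (hs : Summable fun n => ‖c n‖ ^ 2) (hρ : 0 ≤ ρ) (hρr : ρ < r) (hr : r < 1) (hε : 0 ≤ ε)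
    (hsum : ∑' n, ‖c n‖ ^ 2 * (1 - ρ ^ n) ^ 2 ≤ ε ^ 2) :
    Real.circleAverage (fun z => ‖f z - f ((ρ / r : ℝ) * z)‖) 0 r ≤ ε := by
  have hr0 : 0 < r := hρ.trans_lt hρr
  have hdilate := h.dilate (τ := ρ / r)
    (by rw [abs_of_nonneg (by positivity)]; exact (div_le_one hr0).2 hρr.le)
  have hcont := (h.sub hdilate).continuousOn_sphere (r := r) (by rwa [abs_of_pos hr0])
  exact le_of_sq_le_sq ((sq_circleAverage_le hcont.norm).trans
    ((h.circleAverage_norm_sub_dilate_sq_le hs hρ hρr hr).trans hsum)) hε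

theorem integral_norm_sub_circleMap (f : ℂ → ℂ) (hr : r ≠ 0) (ρ α : ℝ) :
    ∫ t in α..α + 2 * Real.pi, ‖f (circleMap 0 r t) - f (circleMap 0 ρ t)‖ =
      2 * Real.pi * Real.circleAverage (fun z => ‖f z - f ((ρ / r : ℝ) * z)‖) 0 r := by
  have hperiodic : Function.Periodic (fun t => ‖f (circleMap 0 r t) - f (circleMap 0 ρ t)‖)
      (2 * Real.pi) := fun t => by
    simp only [periodic_circleMap 0 r t, periodic_circleMap 0 ρ t]
  rw [hperiodic.intervalIntegral_add_eq α 0, zero_add, Real.circleAverage, smul_eq_mul,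
    mul_inv_cancel_left₀ Real.two_pi_pos.ne']
  simp only [ofReal_mul_circleMap, div_mul_cancel₀ _ hr]

theorem integral_norm_sub_boundary_le (hf : ContinuousOn f (ball 0 1))
    (hu : HasBoundaryFunction f u) (hui : ∀ α β : ℝ, IntervalIntegrable u volume α β)
    (hρ : ρ ∈ Set.Ioo (0 : ℝ) 1) {α β : ℝ} (hαβ : α ≤ β) (hε : 0 ≤ ε)
    (h : ∀ r, ρ < r → r < 1 → ∫ t in α..β, ‖f (circleMap 0 r t) - f (circleMap 0 ρ t)‖ ≤ ε) :
    ∫ t in α..β, ‖f (circleMap 0 ρ t) - u t‖ ≤ ε := by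
  obtain ⟨r, -, hr, hrt⟩ := exists_seq_strictMono_tendsto' hρ.2
  have hcr (n : ℕ) : Continuous fun t => f (circleMap 0 (r n) t) :=
    continuous_comp_circleMap hf (abs_lt_one_of_mem_Ioo ⟨hρ.1.trans (hr n).1, (hr n).2⟩)
  have hcρ : Continuous fun t => f (circleMap 0 ρ t) :=
    continuous_comp_circleMap hf (abs_lt_one_of_mem_Ioo hρ)
  have hlim : ∀ᵐ t ∂volume.restrict (Set.Ioc α β),
      Tendsto (fun n => ‖f (circleMap 0 (r n) t) - f (circleMap 0 ρ t)‖) atTop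
        (𝓝 ‖f (circleMap 0 ρ t) - u t‖) := by
    filter_upwards [ae_restrict_of_ae hu] with t ht
    rw [norm_sub_rev]
    exact ((ht.comp (tendsto_nhdsWithin_iff.2
      ⟨hrt, Eventually.of_forall fun n => (hr n).2⟩)).sub_const _).norm
  have hfatou := lintegral_enorm_le_liminf_of_tendsto hlim
    fun n => ((hcr n).sub hcρ).norm.aemeasurable.enorm
  have hbound (n : ℕ) : ∫⁻ t in Set.Ioc α β,
      ‖‖f (circleMap 0 (r n) t) - f (circleMap 0 ρ t)‖‖ₑ ≤ ENNReal.ofReal ε := by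
    have hint : IntegrableOn (fun t => ‖f (circleMap 0 (r n) t) - f (circleMap 0 ρ t)‖)
        (Set.Ioc α β) := ((hcr n).sub hcρ).norm.integrableOn_Ioc
    rw [← ofReal_integral_norm_eq_lintegral_enorm hint]
    simp only [norm_norm]
    rw [← intervalIntegral.integral_of_le hαβ]
    exact ENNReal.ofReal_le_ofReal (h _ (hr n).1 (hr n).2)
  have hle := hfatou.trans (liminf_le_of_frequently_le' (Frequently.of_forall hbound))
  have hint : IntegrableOn (fun t => ‖f (circleMap 0 ρ t) - u t‖) (Set.Ioc α β) :=
    (intervalIntegrable_iff_integrableOn_Ioc_of_le hαβ).1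
      ((hcρ.intervalIntegrable _ _).sub (hui α β)).norm
  rw [← ofReal_integral_norm_eq_lintegral_enorm hint, ENNReal.ofReal_le_ofReal_iff hε] at hle
  simpa only [norm_norm, intervalIntegral.integral_of_le hαβ] using hle

theorem eventually_integral_norm_dilate_sub_boundary_le (hf : f ∈ hardyTwo)
    (hu : HasBoundaryFunction f u) (hui : ∀ α β : ℝ, IntervalIntegrable u volume α β)
    (hε : 0 < ε) :
    ∀ᶠ ρ in 𝓝[<] (1 : ℝ), ∀ α : ℝ,
      ∫ t in α..α + 2 * Real.pi, ‖f (circleMap 0 ρ t) - u t‖ ≤ ε := by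
  obtain ⟨c, hc⟩ := exists_hasTaylor hf.1
  have hs := hc.mem_hardyTwo_iff.1 hf
  have hδ : 0 < ε / (2 * Real.pi) := by positivity
  filter_upwards [(tendsto_tsum_one_sub_pow_sq hs).eventually_le_const (sq_pos_of_pos hδ),
    Ioo_mem_nhdsLT zero_lt_one] with ρ hsum hρ α
  refine integral_norm_sub_boundary_le hf.1.continuousOn hu hui hρ (by linarith [Real.pi_pos])
    hε.le fun r hρr hr => ?_
  rw [integral_norm_sub_circleMap f (hρ.1.trans hρr).ne', ← le_div_iff₀' Real.two_pi_pos]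
  exact hc.circleAverage_norm_sub_dilate_le hs hρ.1.le hρr hr hδ.le hsum

theorem poissonKernel_circleMap_add (r s θ : ℝ) :
    poissonKernel 0 (circleMap 0 r θ) (circleMap 0 1 (s + θ)) =
      poissonKernel 0 (r : ℂ) (circleMap 0 1 s) := by
  have hrotate : circleMap 0 1 (s + θ) - circleMap 0 r θ =
      (circleMap 0 1 s - r) * circleMap 0 1 θ := by
    simp only [circleMap, zero_add, Complex.ofReal_one, one_mul, Complex.ofReal_add, add_mul,
      Complex.exp_add]
    ring
  simp only [poissonKernel, sub_zero, hrotate, norm_mul, norm_circleMap_zero, Complex.norm_real,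
    Real.norm_eq_abs, abs_one, mul_one]

theorem eval_dilate_eq_integral (hf : DifferentiableOn ℂ f (ball 0 1)) (hr : |r| < 1)
    (hρ : |ρ| < 1) (θ : ℝ) :
    f (circleMap 0 (r * ρ) θ) = ∫ s in (0 : ℝ)..(2 * Real.pi),
      ((2 * Real.pi)⁻¹ * poissonKernel 0 (r : ℂ) (circleMap 0 1 s)) •
        f (circleMap 0 ρ (θ + s)) := by
  have hmaps := mapsTo_ofReal_mul_closedBall hρ
  have hmul : Differentiable ℂ fun z : ℂ => (ρ : ℂ) * z := differentiable_fun_id.const_mul _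
  have hdilate : DiffContOnCl ℂ (fun z => f (ρ * z)) (ball 0 1) := by
    refine ⟨hf.comp hmul.differentiableOn (hmaps.mono_left ball_subset_closedBall), ?_⟩
    rw [closure_ball _ one_ne_zero]
    exact hf.continuousOn.comp hmul.continuous.continuousOn hmaps
  have hpoisson := hdilate.circleAverage_poissonKernel_smul (circleMap_mem_unitBall hr θ)
  rw [Real.circleAverage_eq_integral_add θ, ← intervalIntegral.integral_smul,
    ofReal_mul_circleMap, mul_comm ρ r] at hpoisson
  rw [← hpoisson]
  refine intervalIntegral.integral_congr fun s _ => ?_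
  simp only [Pi.smul_apply']
  rw [poissonKernel_circleMap_add, ofReal_mul_circleMap, mul_one, smul_smul, add_comm s θ]

theorem meanOscillation_dilate_le_of_lt (hf : DifferentiableOn ℂ f (ball 0 1)) (hr : 0 ≤ r)
    (hrρ : r < ρ) (hρ : ρ < 1) {α β : ℝ} (hαβ : α ≤ β)
    (hN : ∀ s, meanOscillation (fun θ => f (circleMap 0 ρ θ)) (α + s) (β + s) ≤ N) :
    meanOscillation (fun θ => f (circleMap 0 r θ)) α β ≤ N := by
  have hρ0 : 0 < ρ := hr.trans_lt hrρ
  have hρ1 : |ρ| < 1 := by rwa [abs_of_pos hρ0]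
  have hratio : |r / ρ| < 1 := by
    rw [abs_of_nonneg (by positivity)]
    exact (div_lt_one hρ0).2 hrρ
  have hball : ((r / ρ : ℝ) : ℂ) ∈ ball (0 : ℂ) 1 := by
    rwa [mem_ball_zero_iff, Complex.norm_real]
  have hmass := poissonMean_const hball 1
  simp only [poissonMean, mul_one] at hmass
  have hrepr : (fun θ => f (circleMap 0 r θ)) = fun θ => ∫ s in (0 : ℝ)..(2 * Real.pi),
      ((2 * Real.pi)⁻¹ * poissonKernel 0 ((r / ρ : ℝ) : ℂ) (circleMap 0 1 s)) •
        f (circleMap 0 ρ (θ + s)) := by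
    ext θ
    rw [← eval_dilate_eq_integral hf hratio hρ1, div_mul_cancel₀ _ hρ0.ne']
  rw [hrepr]
  refine meanOscillation_average_le (v := fun t => f (circleMap 0 ρ t)) Real.two_pi_pos.le
    (continuous_const.mul ((continuousOn_poissonKernel_sphere hball).comp_continuous
      (continuous_circleMap 0 1) fun s => by simp))
    (fun s => mul_nonneg (by positivity) (poissonKernel_nonneg_of_mem_sphere hball (by simp)))
    ?_ (continuous_comp_circleMap hf.continuousOn hρ1) hαβ hN
  rwa [intervalIntegral.integral_const_mul, ← smul_eq_mul]

theorem eventually_meanOscillation_dilate_le_add (hf : f ∈ hardyTwo)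
    (hu : HasBoundaryFunction f u) (hui : ∀ α β : ℝ, IntervalIntegrable u volume α β)
    {ℓ : ℝ} (hℓ : 0 < ℓ) (hℓπ : ℓ ≤ 2 * Real.pi) (hN : ∀ α, meanOscillation u α (α + ℓ) ≤ N)
    (hε : 0 < ε) :
    ∀ᶠ ρ in 𝓝[<] (1 : ℝ), ∀ α,
      meanOscillation (fun θ => f (circleMap 0 ρ θ)) α (α + ℓ) ≤ N + ε := by
  filter_upwards [eventually_integral_norm_dilate_sub_boundary_le hf hu hui
    (show 0 < ε * ℓ / 2 by positivity), eventually_abs_lt_one] with ρ hρε hρ α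
  have hv := (continuous_comp_circleMap hf.1.continuousOn hρ).intervalIntegrable (μ := volume)
  have hint : ∫ t in α..α + ℓ, ‖f (circleMap 0 ρ t) - u t‖ ≤ ε * ℓ / 2 :=
    (intervalIntegral.integral_mono_interval le_rfl (by linarith) (by linarith)
      (Eventually.of_forall fun _ => norm_nonneg _) ((hv _ _).sub (hui _ _)).norm).trans (hρε α)
  have havg : (⨍ t in α..α + ℓ, ‖f (circleMap 0 ρ t) - u t‖) ≤ ε / 2 := by
    rw [interval_average_eq, add_sub_cancel_left, smul_eq_mul, inv_mul_le_iff₀ hℓ]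
    linarith
  have hadd := meanOscillation_le_add (by linarith) (hui α (α + ℓ)) (hv α (α + ℓ))
  linarith [hN α]

theorem meanOscillation_dilate_le (hf : f ∈ hardyTwo) (hu : HasBoundaryFunction f u)
    (hui : ∀ α β : ℝ, IntervalIntegrable u volume α β)
    (hN : ∀ α β : ℝ, α < β → β ≤ α + 2 * Real.pi → meanOscillation u α β ≤ N)
    (hr : r ∈ Set.Ico (0 : ℝ) 1) {α β : ℝ} (hαβ : α < β) (hβ : β ≤ α + 2 * Real.pi) :
    meanOscillation (fun θ => f (circleMap 0 r θ)) α β ≤ N := by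
  refine le_of_forall_pos_le_add fun ε hε => ?_
  obtain ⟨ρ, hosc, hrρ, hρ⟩ := ((eventually_meanOscillation_dilate_le_add hf hu hui
    (sub_pos.2 hαβ) (by linarith) (fun α' => hN α' _ (by linarith) (by linarith)) hε).and
      (Ioo_mem_nhdsLT hr.2)).exists
  refine meanOscillation_dilate_le_of_lt hf.1 hr.1 hrρ hρ hαβ.le fun s => ?_
  convert hosc (α + s) using 2
  ring

end Boundary

section Membership

variable {a b f : ℂ → ℂ} {p : Polynomial ℂ} {r N ε : ℝ}

theorem exists_polynomial_near_dilate (hf : DifferentiableOn ℂ f (ball 0 1)) (hr : |r| < 1)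
    (hε : 0 < ε) :
    ∃ p : Polynomial ℂ, ∀ z ∈ closedBall (0 : ℂ) 1, ‖p.eval z - f (r * z)‖ ≤ ε := by
  obtain ⟨c, hc⟩ := exists_hasTaylor hf
  have hunif := tendstoUniformlyOn_tsum_nat (f := fun n (z : ℂ) => c n * (r * z) ^ n)
    (s := closedBall 0 1) (hc.summable_norm hr) fun n z hz => by
      rw [mem_closedBall_zero_iff] at hz
      rw [norm_mul, norm_pow, norm_mul, Complex.norm_real]
      gcongr
      exact mul_le_of_le_one_right (abs_nonneg r) hz
  obtain ⟨m, hm⟩ := (Metric.tendstoUniformlyOn_iff.1 hunif ε hε).exists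
  refine ⟨∑ n ∈ Finset.range m, Polynomial.monomial n (c n * r ^ n), fun z hz => ?_⟩
  have hdist := hm z hz
  rw [(hc _ (mapsTo_ofReal_mul_closedBall hr hz)).tsum_eq, dist_eq_norm, norm_sub_rev] at hdist
  refine le_of_eq_of_le ?_ hdist.le
  simp only [Polynomial.eval_finsetSum, Polynomial.eval_monomial, mul_pow, mul_assoc]

theorem HankelBound.mono {C D : ℝ} (h : HankelBound p C) (hCD : C ≤ D) : HankelBound p D :=
  fun g k => (h g k).trans (by gcongr)

theorem hankelBound_of_near_dilate (hf : ContinuousOn f (ball 0 1)) (hr : |r| < 1)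
    (hp : ∀ z ∈ closedBall (0 : ℂ) 1, ‖p.eval z - f (r * z)‖ ≤ 1) (hN0 : 0 ≤ N)
    (hN : ∀ α β : ℝ, α < β → β ≤ α + 2 * Real.pi →
      meanOscillation (fun θ => f (circleMap 0 r θ)) α β ≤ N) :
    HankelBound p (48 * (96 * (N + 2)) + (‖f 0‖ + 1)) := by
  have hfc : Continuous fun θ => f (circleMap 0 r θ) := continuous_comp_circleMap hf hr
  have hpc : Continuous fun θ => p.eval (circleMap 0 1 θ) :=
    p.continuous.comp (continuous_circleMap 0 1)
  have hnear (t : ℝ) : ‖p.eval (circleMap 0 1 t) - f (circleMap 0 r t)‖ ≤ 1 := by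
    have hcircle := hp (circleMap 0 1 t) (by simp)
    rwa [ofReal_mul_circleMap, mul_one] at hcircle
  have hosc (α β : ℝ) (hαβ : α < β) (hβ : β ≤ α + 2 * Real.pi) :
      meanOscillation (fun t => p.eval (circleMap 0 1 t)) α β ≤ N + 2 := by
    have hfi := hfc.intervalIntegrable (μ := volume) α β
    have hpi := hpc.intervalIntegrable (μ := volume) α β
    linarith [meanOscillation_le_add hαβ hfi hpi, hN α β hαβ hβ,
      interval_average_norm_sub_le hαβ hfi hpi fun t _ => hnear t]
  have hzero := hp 0 (by simp)
  rw [mul_zero] at hzero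
  refine (hankelBound_of_meanOscillation_le (by linarith) hosc).mono ?_
  linarith [norm_le_norm_add_norm_sub' (p.eval 0) (f 0)]

theorem IsOuterPair.mem_of_meanOscillation_dilate_le (h : IsOuterPair a b)
    (hφ : (fun z => b z / a z) ∈ hardyTwo) (hf : DifferentiableOn ℂ f (ball 0 1)) (hN0 : 0 ≤ N)
    (hN : ∀ r ∈ Set.Ioo (0 : ℝ) 1, ∀ α β : ℝ, α < β → β ≤ α + 2 * Real.pi →
      meanOscillation (fun θ => f (circleMap 0 r θ)) α β ≤ N) : f ∈ deBrangesRovnyak b := by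
  obtain ⟨r, -, hr, hrt⟩ := exists_seq_strictMono_tendsto' (zero_lt_one (α := ℝ))
  have hr1 (n : ℕ) : |r n| < 1 := abs_lt_one_of_mem_Ioo (hr n)
  choose p hp using fun n : ℕ =>
    exists_polynomial_near_dilate hf (hr1 n) (Nat.one_div_pos_of_nat (α := ℝ) (n := n))
  have hp1 (n : ℕ) : ∀ z ∈ closedBall (0 : ℂ) 1, ‖(p n).eval z - f (r n * z)‖ ≤ 1 := fun z hz =>
    (hp n z hz).trans (Nat.one_div_le_one_div (α := ℝ) n.zero_le |>.trans (by simp))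
  refine h.mem_of_hankelBound hφ (fun n => hankelBound_of_near_dilate hf.continuousOn (hr1 n)
    (hp1 n) hN0 (hN _ (hr n))) fun z hz => ?_
  have hdilate : Tendsto (fun n => f (r n * z)) atTop (𝓝 (f z)) := by
    refine (hf.continuousOn.continuousAt (isOpen_ball.mem_nhds hz)).tendsto.comp ?_
    simpa using ((Complex.continuous_ofReal.tendsto (1 : ℝ)).comp hrt).mul_const z
  have hdiff : Tendsto (fun n => (p n).eval z - f (r n * z)) atTop (𝓝 0) :=
    squeeze_zero_norm (fun n => hp n z (ball_subset_closedBall hz))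
      tendsto_one_div_add_atTop_nhds_zero_nat
  simpa using hdiff.add hdilate

theorem IsOuterPair.hardyInfty_subset (h : IsOuterPair a b)
    (hφ : (fun z => b z / a z) ∈ hardyTwo) : hardyInfty ⊆ deBrangesRovnyak b := by
  rintro f ⟨hf, C, hC⟩
  have hC0 : 0 ≤ C := (norm_nonneg _).trans (hC 0 (by simp))
  refine h.mem_of_meanOscillation_dilate_le hφ hf (N := 2 * C) (by positivity)
    fun r hr α β hαβ _ => ?_
  have hr1 := abs_lt_one_of_mem_Ioo hr
  refine meanOscillation_le_of_norm_sub_le (c := 0) hαβ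
    ((continuous_comp_circleMap hf.continuousOn hr1).intervalIntegrable _ _) fun t _ => ?_
  rw [sub_zero]
  exact hC _ (circleMap_mem_unitBall hr1 t)

theorem IsOuterPair.BMOA_subset (h : IsOuterPair a b) (hφ : (fun z => b z / a z) ∈ hardyTwo) :
    BMOA ⊆ deBrangesRovnyak b := by
  rintro f ⟨hf, u, hu, hui, C, hC⟩
  exact h.mem_of_meanOscillation_dilate_le hφ hf.1 (le_max_right C 0) fun r hr α β hαβ hβ =>
    meanOscillation_dilate_le hf hu hui
      (fun α β hαβ hβ => (hC α β hαβ hβ).trans (le_max_left _ _)) ⟨hr.1.le, hr.2⟩ hαβ hβ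

end Membership

/-! ### Inclusions between the spaces -/

theorem diskAlgebra_subset_hardyInfty : diskAlgebra ⊆ hardyInfty := by
  rintro f ⟨hf, g, hg, hgf⟩
  obtain ⟨C, hC⟩ := (isCompact_closedBall (0 : ℂ) 1).exists_bound_of_continuousOn hg
  exact ⟨hf, C, fun z hz => hgf hz ▸ hC z (ball_subset_closedBall hz)⟩

theorem VMOA_subset_BMOA : VMOA ⊆ BMOA := fun _ ⟨hf, u, hu, hv⟩ => ⟨hf, u, hu, hv.1⟩

theorem hasBoundaryFunction_of_continuousOn_closedBall {f g : ℂ → ℂ}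
    (hg : ContinuousOn g (closedBall 0 1)) (hgf : Set.EqOn g f (ball 0 1)) :
    HasBoundaryFunction f fun θ => g (circleMap 0 1 θ) := by
  refine .of_forall fun θ => ?_
  have hmem : ∀ᶠ r : ℝ in 𝓝[<] 1, circleMap 0 r θ ∈ ball (0 : ℂ) 1 :=
    eventually_abs_lt_one.mono fun r hr => circleMap_mem_unitBall hr θ
  have hradial : Continuous fun r : ℝ => circleMap 0 r θ := by
    unfold circleMap
    fun_prop
  have hlim : Tendsto (fun r : ℝ => circleMap 0 r θ) (𝓝[<] 1)
      (𝓝[closedBall 0 1] (circleMap 0 1 θ)) :=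
    tendsto_nhdsWithin_iff.2 ⟨(hradial.tendsto 1).mono_left nhdsWithin_le_nhds,
      hmem.mono fun r hr => ball_subset_closedBall hr⟩
  exact ((hg _ (by simp)).tendsto.comp hlim).congr' (hmem.mono fun r hr => hgf hr)

theorem isVMO_of_uniformContinuous {u : ℝ → ℂ} {C : ℝ} (hu : UniformContinuous u)
    (hC : ∀ θ, ‖u θ‖ ≤ C) : IsVMO u := by
  have hint := hu.continuous.intervalIntegrable (μ := volume)
  refine ⟨⟨hint, 2 * C, fun α β hαβ _ => meanOscillation_le_of_norm_sub_le (c := 0) hαβ (hint α β)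
    fun t _ => by simpa using hC t⟩, fun ε hε => ?_⟩
  obtain ⟨δ, hδ, hclose⟩ := Metric.uniformContinuous_iff.1 hu (ε / 3) (by positivity)
  refine ⟨δ, hδ, fun α β hαβ _ hlt => ?_⟩
  refine (meanOscillation_le_of_norm_sub_le (c := u α) (C := ε / 3) hαβ (hint α β)
    fun t ht => ?_).trans_lt (by linarith)
  rw [← dist_eq_norm]
  refine (hclose ?_).le
  rw [Real.dist_eq, abs_of_nonneg (sub_nonneg.2 ht.1)]
  linarith [ht.2]

theorem diskAlgebra_subset_VMOA : diskAlgebra ⊆ VMOA := by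
  intro f hfA
  refine ⟨hardyInfty_subset_hardyTwo (diskAlgebra_subset_hardyInfty hfA), ?_⟩
  obtain ⟨-, g, hg, hgf⟩ := hfA
  have hcompact := isCompact_closedBall (0 : ℂ) 1
  have hcircle (θ : ℝ) : circleMap 0 1 θ ∈ closedBall (0 : ℂ) 1 := by simp
  obtain ⟨C, hC⟩ := hcompact.exists_bound_of_continuousOn hg
  refine ⟨_, hasBoundaryFunction_of_continuousOn_closedBall hg hgf,
    isVMO_of_uniformContinuous ?_ fun θ => hC _ (hcircle θ)⟩
  exact uniformContinuousOn_univ.1 ((hcompact.uniformContinuousOn_of_continuous hg).comp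
    (lipschitzWith_circleMap 0 1).uniformContinuous.uniformContinuousOn fun θ _ => hcircle θ)

theorem mainTheorem2 (a b : ℂ → ℂ)
    (hb : DifferentiableOn ℂ b (Metric.ball 0 1))
    (hbD : Set.MapsTo b (Metric.ball 0 1) (Metric.ball 0 1))
    (hab : IsPythagoreanMate a b) :
    List.TFAE [
      (fun z => b z / a z) ∈ hardyTwo,
      hardyInfty ⊆ deBrangesRovnyak b,
      diskAlgebra ⊆ deBrangesRovnyak b,
      VMOA ⊆ deBrangesRovnyak b,
      BMOA ⊆ deBrangesRovnyak b] := by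
  have h := hab.isOuterPair hb hbD
  tfae_have 1 → 5 := h.BMOA_subset
  tfae_have 5 → 4 := VMOA_subset_BMOA.trans
  tfae_have 4 → 3 := diskAlgebra_subset_VMOA.trans
  tfae_have 3 → 1 := h.mem_hardyTwo_of_diskAlgebra_subset
  tfae_have 1 → 2 := h.hardyInfty_subset
  tfae_have 2 → 3 := diskAlgebra_subset_hardyInfty.trans
  tfae_finish
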